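/- Let $\mathfrak A$ be a (real or complex) unital Banach algebra with submultiplicative norm $|\cdot|$, and let $X,Y\in\mathfrak A$. For $A$ in $\mathfrak A$ (or in an algebra of formal power series) and $\lambda\in[0,1]$ put $\mathcal R(A,\lambda)=\frac{A-1}{\lambda+(1-\lambda)A}$; if $\operatorname{spec}(A)\cap(-\infty,0]=\emptyset$, call $A$ $\log$-able and put $\log A=\int_0^1\mathcal R(A,\lambda)\,d\lambda$. Let $\phi$ be the density on $[0,2]$ which is $X$ on $[0,1]$ and $Y$ on $(1,2]$ (the concatenation of $X\mathbf 1_{[0,1]}$ with $Y\mathbf 1_{[0,1]}$), and for $n\ge1$ let $$R^{(\lambda)}_{n}(\phi)=\int_{t\in[0,2]^n}\lambda^{\mathrm{asc}(t)}(\lambda-1)^{\mathrm{des}(t)}\phi(t_1)\cdots\phi(t_n)\,dt,$$ where $\mathrm{asc}(t)$, $\mathrm{des}(t)$ are the numbers of $i$ with $t_i<t_{i+1}$, respectively $t_i>t_{i+1}$. Let $\mu_n(X_1,\dots,X_n)$ be the part of the formal series $\log(\exp(X_1)\cdots\exp(X_n))$ in which every variable has multiplicity one, and let $$\Delta_n(X,Y)=\sum_{j=0}^n\frac1{j!\,(n-j)!}\,\mu_n(\underbrace{X,\dots,X}_{j},\underbrace{Y,\dots,Y}_{n-j}).$$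 For $\lambda\in[0,1]$ and $x,y\in[0,\infty)$ let $\Gamma^{(\lambda)}(x,y)\in[0,\infty]$ be the value at $(x,y)$ of the series obtained from the formal noncommutative power series of $\mathcal R((\exp X)(\exp Y),\lambda)$ by replacing all coefficients by their absolute values and making the variables commute; let $\tilde\rho_\lambda(x)\in[0,\infty]$ be the sum of the power series of $\mathcal R(\exp x,\lambda)$ at $0$ with the coefficients replaced by their absolute values. Let $a=|1-2\lambda|$, $D=8\lambda^2-8\lambda+1$, $s=\sqrt{|D|}$, $$h(\lambda)=\begin{cases}\frac2s\arctan\frac sa&D<0,\\ 2\sqrt2&D=0,\\ \frac2s\operatorname{artanh}\frac sa&D>0,\end{cases}$$ with $h(\tfrac12)=\pi$ and $h(0)=h(1)=\infty$, and let $g_\lambda(0)=0$ and, for $0<x<h(\lambda)$, $$g_\lambda(x)=\begin{cases}\dfrac{2}{-a+s\cot(xs/2)}&D<0,\\ \dfrac{4x}{4-\sqrt2x}&D=0,\\ \dfrac{2}{-a+s\coth(xs/2)}&D>0,\end{cases}$$ (the solution of $g'=1+a g+\lambda(1-\lambda)g^2$, $g(0)=0$), with $g_\lambda(x)=+\infty$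 for $x\ge h(\lambda)$. For $p,q\in[0,\infty]$ let $F_\lambda(p,q)=\dfrac{p+q+pq}{1-\lambda(1-\lambda)pq}$, read as $+\infty$ when $\lambda(1-\lambda)pq\ge1$ or when the numerator is $+\infty$ (where $0\cdot\infty=0$). Then the following hold. (1) The minimum $C_1=\min_{\lambda\in[0,1]}h(\lambda)$ exists and $C_1=2.7014\ldots$, that is, $2.7014\le C_1<2.7015$. (2) For every $\lambda\in[0,1]$, as inequalities in $[0,\infty]$, $$\sum_{n=1}^\infty|R^{(\lambda)}_{n}(\phi)|\le\Gamma^{(\lambda)}(|X|,|Y|)\le F_\lambda\big(\tilde\rho_\lambda(|X|),\tilde\rho_\lambda(|Y|)\big)\le F_\lambda\big(g_\lambda(|X|),g_\lambda(|Y|)\big).$$ (3) For all $n\ge1$, $\int_{0\le t_1\le\dots\le t_n\le2}\mu_n(\phi(t_1),\dots,\phi(t_n))\,dt=\Delta_n(X,Y)$. (4) Suppose $|X|+|Y|<C_1$. Then for every $\lambda\in[0,1]$ one has $|X|,|Y|<h(\lambda)$ and $\lambda(1-\lambda)g_\lambda(|X|)g_\lambda(|Y|)<1$, and all the bounds in (2)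 are finite; $\sum_{n\ge1}|R^{(\lambda)}_n(\phi)|$ is bounded uniformly in $\lambda\in[0,1]$; and the logarithmic Baker–Campbell–Hausdorff formula holds: $\sum_{n\ge1}|\Delta_n(X,Y)|<\infty$, the element $\exp(X)\exp(Y)$ is $\log$-able, and $$\log\big(\exp(X)\exp(Y)\big)=\sum_{n=1}^\infty\Delta_n(X,Y).$$ -/

import Mathlib

namespace MagnusBCH

noncomputable section

open MeasureTheory Set
open scoped ENNReal

/-! ### The resolvent expression and the logarithm -/

/-- The resolvent expression `R(a, lam) = (a - 1) / (lam + (1 - lam) a)` in a real algebra.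
It is used in Banach algebras and in algebras of formal power series. Numerator and denominator
commute; the value is meaningful when the denominator is invertible. -/
def cayleyResolvent {R : Type*} [Ring R] [Algebra ℝ R] (a : R) (lam : ℝ) : R :=
  (a - 1) * Ring.inverse (algebraMap ℝ R lam + (1 - lam) • a)

/-- `a` is log-able: its spectrum does not meet the closed negative real half-line. (A real number
belongs to the spectrum of `a` in the complexification of a real algebra if and only if it belongs
to the real spectrum.) -/
def Logable {A : Type*} [NormedRing A] [NormedAlgebra ℝ A] (a : A) : Prop :=
  Disjoint (spectrum ℝ a) (Iic 0)

/-- The logarithm `∫₀¹ (a - 1) / (lam + (1 - lam) a) dlam` in a Banach algebra, meaningful for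
log-able `a`. -/
def blog {A : Type*} [NormedRing A] [NormedAlgebra ℝ A] (a : A) : A :=
  ∫ lam in (0 : ℝ)..1, cayleyResolvent a lam

/-! ### Formal power series in noncommuting variables

A formal power series in noncommuting variables indexed by `α` is written as a power series in a
bookkeeping (central) variable, whose `n`-th coefficient is the component of degree `n`: a real
combination of words of length `n`. -/

/-- Noncommutative polynomials. -/
abbrev NCPoly (α : Type*) : Type _ := MonoidAlgebra ℝ (FreeMonoid α)

/-- The ring in which formal noncommutative power series live. -/
abbrev NCSeries (α : Type*) : Type _ := PowerSeries (NCPoly α)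

/-- The exponential of the formal variable with index `a`. -/
def expVar {α : Type*} (a : α) : NCSeries α :=
  PowerSeries.mk fun n => MonoidAlgebra.single (FreeMonoid.of a ^ n) ((n.factorial : ℝ)⁻¹)

/-- The coefficient of the word `w` (which sits in degree `w.length`). -/
def wordCoeff {α : Type*} (F : NCSeries α) (w : FreeMonoid α) : ℝ :=
  (PowerSeries.coeff w.length F).coeff w

/-- The formal logarithm `∑_{m ≥ 1} (-1)^(m-1) (F - 1)^m / m` of a series `F` with constant
term `1`; only the terms with `m ≤ n` contribute in degree `n`. -/
def formalLog {α : Type*} (F : NCSeries α) : NCSeries α :=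
  PowerSeries.mk fun n => ∑ m ∈ Finset.Icc 1 n,
    ((-1 : ℝ) ^ (m - 1) / m) • PowerSeries.coeff n ((F - 1) ^ m)

/-! ### Magnus commutators, the Magnus expansion and its resolvent version -/

section Banach

variable {A : Type*} [NormedRing A] [NormedAlgebra ℝ A]

/-- The Magnus commutator `μ_k(X₁, …, X_k)`: the part of `log (exp X₁ ⋯ exp X_k)` in which every
variable has multiplicity one. -/
def magnusCommutator (k : ℕ) (X : Fin k → A) : A :=
  ∑ σ : Equiv.Perm (Fin k),
    wordCoeff (formalLog (List.ofFn fun i : Fin k => expVar i).prod)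
        (FreeMonoid.ofList (List.ofFn fun i => σ i)) •
      (List.ofFn fun i => X (σ i)).prod

/-- The number of ascents `t i < t (i + 1)` of a finite sequence. -/
def asc {n : ℕ} (t : Fin n → ℝ) : ℕ :=
  Set.ncard {i : Fin n | ∃ hi : i.1 + 1 < n, t i < t ⟨i.1 + 1, hi⟩}

/-- The number of descents `t (i + 1) < t i` of a finite sequence. -/
def des {n : ℕ} (t : Fin n → ℝ) : ℕ :=
  Set.ncard {i : Fin n | ∃ hi : i.1 + 1 < n, t ⟨i.1 + 1, hi⟩ < t i}

/-- The `n`-th term of the right Magnus expansion of the measure with density `φ` on `I`: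
`∫_{t₁ ≤ … ≤ t_n in I} μ_n(φ(t₁), …, φ(t_n))`. -/
def magnusTerm (I : Set ℝ) (φ : ℝ → A) (n : ℕ) : A :=
  ∫ t in {t : Fin n → ℝ | (∀ i, t i ∈ I) ∧ Monotone t},
    magnusCommutator n fun i => φ (t i)

/-- The `n`-th term of the resolvent series of the measure with density `φ` on `I`:
`∫_{t in I^n} lam^asc(t) (lam - 1)^des(t) φ(t₁) ⋯ φ(t_n)`. -/
def resolventTerm (lam : ℝ) (I : Set ℝ) (φ : ℝ → A) (n : ℕ) : A :=
  ∫ t in {t : Fin n → ℝ | ∀ i, t i ∈ I},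
    (lam ^ asc t * (lam - 1) ^ des t) • (List.ofFn fun i => φ (t i)).prod

/-- The density, on `[0, 2]`, of the concatenation of `X·1_[0,1]` with `Y·1_[0,1]`. -/
def concatDensity (X Y : A) (t : ℝ) : A := if t ≤ 1 then X else Y

/-- The Baker–Campbell–Hausdorff term of degree `n`:
`∑_{j=0}^n 1/(j! (n-j)!) μ_n(X, …, X, Y, …, Y)` with `j` entries `X` and `n - j` entries `Y`. -/
def bchTerm (X Y : A) (n : ℕ) : A :=
  ∑ j ∈ Finset.range (n + 1), ((j.factorial : ℝ) * ((n - j).factorial : ℝ))⁻¹ •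
    magnusCommutator n fun i : Fin n => if i.1 < j then X else Y

end Banach

/-! ### The majorants (functions with values in `[0, ∞]`) -/

/-- `Γ^(lam)(x, y)`: the noncommutative power series of `R((exp X)(exp Y), lam)` with its
coefficients replaced by their absolute values, evaluated at `X = x`, `Y = y`. -/
def Gam (lam : ℝ) (x y : ℝ≥0∞) : ℝ≥0∞ :=
  ∑' w : FreeMonoid (Fin 2),
    ENNReal.ofReal |wordCoeff (cayleyResolvent (expVar (0 : Fin 2) * expVar 1) lam) w| *
      (x ^ w.toList.count 0 * y ^ w.toList.count 1)

/-- The power series of `R(exp x, lam)` around `x = 0` with its coefficients replaced by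
their absolute values. -/
def rhoTilde (lam : ℝ) (x : ℝ≥0∞) : ℝ≥0∞ :=
  ∑' n : ℕ, ENNReal.ofReal
    |PowerSeries.coeff n (cayleyResolvent (PowerSeries.exp ℝ) lam)| * x ^ n

/-- The discriminant `8 lam² - 8 lam + 1`. -/
def disc (lam : ℝ) : ℝ := 8 * lam ^ 2 - 8 * lam + 1

/-- `h(lam)` for `lam` in `[0, 1]`, with `artanh 1 = ∞` (at `lam = 0, 1`) and
`arctan (1 / 0) = π / 2` (at `lam = 1 / 2`). -/
def h (lam : ℝ) : ℝ≥0∞ :=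
  if lam = 0 ∨ lam = 1 then ⊤
  else if lam = 1 / 2 then ENNReal.ofReal Real.pi
  else if disc lam < 0 then
    ENNReal.ofReal (2 * Real.arctan (√(-disc lam) / |1 - 2 * lam|) / √(-disc lam))
  else if disc lam = 0 then ENNReal.ofReal (2 * √2)
  else ENNReal.ofReal (2 * Real.artanh (√(disc lam) / |1 - 2 * lam|) / √(disc lam))

/-- The solution of `g' = 1 + |1 - 2 lam| g + lam (1 - lam) g²`, `g(0) = 0`, in closed form,
for `0 ≤ x < h lam`. -/
def gReal (lam x : ℝ) : ℝ :=
  if x = 0 then 0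
  else if disc lam < 0 then
    2 / (-|1 - 2 * lam| + √(-disc lam) * Real.cot (x / 2 * √(-disc lam)))
  else if disc lam = 0 then 4 * x / (4 - √2 * x)
  else
    2 / (-|1 - 2 * lam| + √(disc lam) *
      (Real.cosh (x / 2 * √(disc lam)) / Real.sinh (x / 2 * √(disc lam))))

/-- `g_lam` on `[0, ∞]`, equal to `∞` from its blow-up point `h lam` on. -/
def g (lam : ℝ) (x : ℝ≥0∞) : ℝ≥0∞ :=
  if x < h lam then ENNReal.ofReal (gReal lam x.toReal) else ⊤

/-- `(p + q + p q) / (1 - lam (1 - lam) p q)` for `p, q` in `[0, ∞]`; this is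
`∞` as soon as `lam (1 - lam) p q ≥ 1`. -/
def frac (lam : ℝ) (p q : ℝ≥0∞) : ℝ≥0∞ :=
  (p + q + p * q) / (1 - ENNReal.ofReal (lam * (1 - lam)) * (p * q))

/-- The constant `C₁`, the minimum of `h` over `[0, 1]`. -/
def C₁ : ℝ≥0∞ := sInf (h '' Icc 0 1)

end

end MagnusBCH

open Set MagnusBCH

namespace MagnusBCH

noncomputable section

open MeasureTheory Set
open scoped ENNReal

/-! ### Resolvents in rings -/

section Ring

variable {R : Type*} [Ring R] [Algebra ℝ R]

/-! Everything is done for the resolvent at fixed `lam` and integrated over `lam` at the end. The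
formal resolvent of a series E with constant term 1 satisfies R = (E - 1) + (lam - 1)(E - 1)R. The
ascent-descent weight of a sequence obeys the same recursion when its first increasing block is
split off (`ascWeight_rec`), with the indicator of increasing sequences in place of E - 1. For the
two-step density the cube is a union of cells indexed by words in two letters. The increasing part
of a cell has as volume the coefficient of its word in exp X exp Y, and integrals over cells factor
along splittings of words. Hence the integrated weights are the coefficients of the formal resolvent
(`integral_ascWeight`), and the norms of the resolvent terms sum to at most `Gam`.

To bound `Gam`, the resolvent of AB splits as U + V with U = R(A)(1 + lam V) and V = R(B)(1 + (lam -
1)U) (`cayleyResolvent_mul_decomp`). Weighted coefficient norms turn this into two linear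
inequalities, whose solution is `frac` (`Gam_le_frac`). In one variable, R(exp x) solves a Riccati
equation. The absolute values of its coefficients therefore satisfy the recursion of the equation
with nonnegative coefficients as an inequality, and comparison with its solution g gives
`rhoTilde_le_g`.

Writing g = S / Q with S a rescaled sine or hyperbolic sine, the addition theorem Q(x + y) =
Q(x)Q(y) - lam(1 - lam)S(x)S(y) shows that lam(1 - lam)g(x)g(y) < 1 as long as x + y lies below the
blow-up point h. If x + y lies below the minimum of h, the remaining slack gives a bound uniform in
`lam` (`exists_uniform_bound`).

A finite majorant permits evaluating the formal resolvent in the Banach algebra. This produces the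
inverse of the denominator for every `lam` in [0, 1], hence log-ability. The uniform bound allows
series and `lam`-integral to be exchanged. Integrating the weights over `lam` gives the coefficients
of the formal logarithm on words without repetition, so the integrated terms are the Magnus terms,
which are the Baker–Campbell–Hausdorff terms (`bch_of_bounded`).

For the constant, where the discriminant is negative h becomes an explicit function of the angle φ =
arctan(s / a), handled by Taylor bounds for the sine; elsewhere h ≥ 2√2. -/

lemma resolventDenom_eq (a : R) (lam : ℝ) :
    algebraMap ℝ R lam + (1 - lam) • a = 1 + (1 - lam) • (a - 1) := by
  rw [Algebra.algebraMap_eq_smul_one]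
  module

lemma commute_resolventDenom (a : R) (lam : ℝ) :
    Commute (a - 1) (algebraMap ℝ R lam + (1 - lam) • a) := by
  rw [resolventDenom_eq]
  exact (Commute.one_right _).add_right ((Commute.refl _).smul_right _)

lemma cayleyResolvent_mul {a : R} {lam : ℝ} (h : IsUnit (algebraMap ℝ R lam + (1 - lam) • a)) :
    cayleyResolvent a lam * (algebraMap ℝ R lam + (1 - lam) • a) = a - 1 := by
  rw [cayleyResolvent, mul_assoc, Ring.inverse_mul_cancel _ h, mul_one]

lemma mul_cayleyResolvent {a : R} {lam : ℝ} (h : IsUnit (algebraMap ℝ R lam + (1 - lam) • a)) :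
    (algebraMap ℝ R lam + (1 - lam) • a) * cayleyResolvent a lam = a - 1 := by
  rw [cayleyResolvent, ← mul_assoc, ← (commute_resolventDenom a lam).eq, mul_assoc,
    Ring.mul_inverse_cancel _ h, mul_one]

lemma eq_cayleyResolvent {a r : R} {lam : ℝ}
    (h : IsUnit (algebraMap ℝ R lam + (1 - lam) • a))
    (hr : r * (algebraMap ℝ R lam + (1 - lam) • a) = a - 1) : r = cayleyResolvent a lam := by
  rw [cayleyResolvent, ← hr, mul_assoc, Ring.mul_inverse_cancel _ h, mul_one]

lemma cayleyResolvent_rec {a : R} {lam : ℝ} (h : IsUnit (algebraMap ℝ R lam + (1 - lam) • a)) :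
    cayleyResolvent a lam = (a - 1) + (lam - 1) • ((a - 1) * cayleyResolvent a lam) := by
  have h1 := mul_cayleyResolvent h
  rw [resolventDenom_eq, add_mul, one_mul, smul_mul_assoc] at h1
  rw [← sub_eq_zero] at h1 ⊢
  rw [← h1]
  module

/-- Decomposition of the resolvent of a product: the parts starting with the resolvents of
the first, respectively second factor. -/
lemma cayleyResolvent_mul_decomp {A B : R} {lam : ℝ}
    (hA : IsUnit (algebraMap ℝ R lam + (1 - lam) • A))
    (hB : IsUnit (algebraMap ℝ R lam + (1 - lam) • B))
    (hAB : IsUnit (algebraMap ℝ R lam + (1 - lam) • (A * B))) :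
    ∃ U V : R, cayleyResolvent (A * B) lam = U + V ∧
      U = cayleyResolvent A lam * (1 + lam • V) ∧
      V = cayleyResolvent B lam * (1 + (lam - 1) • U) := by
  obtain ⟨T, hT⟩ : ∃ T, T = Ring.inverse (algebraMap ℝ R lam + (1 - lam) • (A * B)) := ⟨_, rfl⟩
  have hQT := Ring.mul_inverse_cancel _ hAB
  rw [← hT] at hQT
  -- The splitting is AB - 1 = (A - 1)B + (B - 1). Replacing 1 by denominator times T makes 1 + lam
  -- V and 1 + (lam - 1)U left multiples of the denominators of A and B.
  refine ⟨(A - 1) * B * T, (B - 1) * T, ?_, ?_, ?_⟩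
  · rw [cayleyResolvent, ← hT, ← add_mul]
    congr 1
    noncomm_ring
  · have : 1 + lam • ((B - 1) * T) = (algebraMap ℝ R lam + (1 - lam) • A) * (B * T) := by
      nth_rw 1 [← hQT]
      simp only [Algebra.algebraMap_eq_smul_one, add_mul, smul_mul_assoc, sub_mul, one_mul,
        mul_assoc]
      module
    rw [this, ← mul_assoc, cayleyResolvent_mul hA, mul_assoc]
  · have : 1 + (lam - 1) • ((A - 1) * B * T) = (algebraMap ℝ R lam + (1 - lam) • B) * T := by
      nth_rw 1 [← hQT]
      simp only [Algebra.algebraMap_eq_smul_one, add_mul, smul_mul_assoc, sub_mul, one_mul,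
        mul_assoc]
      module
    rw [this, ← mul_assoc, cayleyResolvent_mul hB]

lemma map_cayleyResolvent {S : Type*} [Ring S] [Algebra ℝ S] (f : R →ₐ[ℝ] S) {a : R} {lam : ℝ}
    (h : IsUnit (algebraMap ℝ R lam + (1 - lam) • a)) :
    f (cayleyResolvent a lam) = cayleyResolvent (f a) lam := by
  have e : f (algebraMap ℝ R lam + (1 - lam) • a) = algebraMap ℝ S lam + (1 - lam) • f a := by
    simp
  refine eq_cayleyResolvent (e ▸ h.map f) ?_
  rw [← e, ← map_mul, cayleyResolvent_mul h]
  simp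

end Ring

lemma isUnit_of_constantCoeff_eq_one {R : Type*} [Ring R] {F : PowerSeries R}
    (hF : PowerSeries.constantCoeff F = 1) : IsUnit F :=
  ⟨⟨F, PowerSeries.invOfUnit F 1, PowerSeries.mul_invOfUnit _ _ (by simpa using hF),
    PowerSeries.invOfUnit_mul _ _ (by simpa using hF)⟩, rfl⟩

/-- The constant coefficient is lam + (1 - lam) = 1, so formally no restriction on `lam` is needed.
-/
lemma isUnit_resolventDenom {R : Type*} [Ring R] [Algebra ℝ R] {F : PowerSeries R}
    (hF : PowerSeries.constantCoeff F = 1) (lam : ℝ) :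
    IsUnit (algebraMap ℝ (PowerSeries R) lam + (1 - lam) • F) := by
  apply isUnit_of_constantCoeff_eq_one
  rw [resolventDenom_eq, map_add, map_one, ← PowerSeries.coeff_zero_eq_constantCoeff_apply]
  have : PowerSeries.coeff 0 ((1 - lam) • (F - 1)) = (1 - lam) • PowerSeries.coeff 0 (F - 1) := rfl
  rw [this]
  simp [hF]

/-! ### Homogeneous formal series -/

section Formal

variable {α : Type*}

lemma coeff_real_smul (n : ℕ) (c : ℝ) (F : NCSeries α) :
    PowerSeries.coeff n (c • F) = c • PowerSeries.coeff n F := rfl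

@[simp] lemma wordCoeff_add (F G : NCSeries α) (w : FreeMonoid α) :
    wordCoeff (F + G) w = wordCoeff F w + wordCoeff G w := by simp [wordCoeff]

@[simp] lemma wordCoeff_sub (F G : NCSeries α) (w : FreeMonoid α) :
    wordCoeff (F - G) w = wordCoeff F w - wordCoeff G w := by
  simp [wordCoeff]

@[simp] lemma wordCoeff_smul (c : ℝ) (F : NCSeries α) (w : FreeMonoid α) :
    wordCoeff (c • F) w = c * wordCoeff F w := by
  simp [wordCoeff]

/-- The `n`-th coefficient involves only words of length `n`. -/
def Homog (F : NCSeries α) : Prop :=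
  ∀ n (w : FreeMonoid α), w.length ≠ n → (PowerSeries.coeff n F).coeff w = 0

lemma Homog.add {F G : NCSeries α} (hF : Homog F) (hG : Homog G) : Homog (F + G) := by
  intro n w hw
  simp [hF n w hw, hG n w hw]

lemma Homog.sub {F G : NCSeries α} (hF : Homog F) (hG : Homog G) : Homog (F - G) := by
  intro n w hw
  simp [hF n w hw, hG n w hw]

lemma Homog.smul {F : NCSeries α} (c : ℝ) (hF : Homog F) : Homog (c • F) := by
  intro n w hw
  simp [hF n w hw]

lemma homog_one : Homog (1 : NCSeries α) := by
  classical
  intro n w hw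
  rw [PowerSeries.coeff_one]
  split_ifs with h
  · subst h
    rw [MonoidAlgebra.one_def, MonoidAlgebra.coeff_single, Finsupp.single_apply, if_neg]
    rintro rfl
    exact hw rfl
  · rfl

lemma freeMonoid_length_pow (a : α) (n : ℕ) : (FreeMonoid.of a ^ n).length = n := by
  induction n with
  | zero => rfl
  | succ n ih => rw [pow_succ, FreeMonoid.length_mul, ih]; rfl

lemma toList_of_pow (a : α) (n : ℕ) : (FreeMonoid.of a ^ n).toList = List.replicate n a := by
  induction n with
  | zero => rfl
  | succ n ih => rw [pow_succ', FreeMonoid.toList_mul, ih]; rfl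

lemma homog_expVar (a : α) : Homog (expVar a) := by
  classical
  intro n w hw
  rw [expVar, PowerSeries.coeff_mk, MonoidAlgebra.coeff_single, Finsupp.single_apply, if_neg]
  rintro rfl
  exact hw (freeMonoid_length_pow a n)

lemma Homog.mul {F G : NCSeries α} (hF : Homog F) (hG : Homog G) : Homog (F * G) := by
  classical
  intro n w hw
  rw [PowerSeries.coeff_mul, MonoidAlgebra.coeff_sum, Finsupp.finsetSum_apply]
  refine Finset.sum_eq_zero fun p hp => ?_
  rw [MonoidAlgebra.coeff_mul, Finsupp.sum]
  refine Finset.sum_eq_zero fun u _ => Finset.sum_eq_zero fun v _ => ?_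
  by_contra hne
  have h1 : u * v = w := by by_contra h; exact hne (by simp [h])
  simp only [if_pos h1] at hne
  have h2 : u.length = p.1 := by by_contra h; exact hne (by simp [hF _ _ h])
  have h3 : v.length = p.2 := by by_contra h; exact hne (by simp [hG _ _ h])
  rw [Finset.HasAntidiagonal.mem_antidiagonal] at hp
  apply hw
  rw [← h1, FreeMonoid.length_mul, h2, h3, hp]

/-- In degrees (k, n - k) homogeneity of F leaves only the prefix of length k as first factor, and
the second factor is then forced to be the remaining suffix. This is why G may be arbitrary. -/
lemma wordCoeff_mul {F : NCSeries α} (hF : Homog F) (G : NCSeries α) (l : List α) :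
    wordCoeff (F * G) (FreeMonoid.ofList l) = ∑ k ∈ Finset.range (l.length + 1),
      wordCoeff F (FreeMonoid.ofList (l.take k)) * wordCoeff G (FreeMonoid.ofList (l.drop k)) := by
  classical
  have hlen : ∀ l : List α, (FreeMonoid.ofList l).length = l.length := fun _ => rfl
  rw [wordCoeff, PowerSeries.coeff_mul, MonoidAlgebra.coeff_sum, Finsupp.finsetSum_apply, hlen,
    Finset.Nat.sum_antidiagonal_eq_sum_range_succ_mk]
  refine Finset.sum_congr rfl fun k hk => ?_
  rw [Finset.mem_range] at hk
  have hs : ∀ {p : FreeMonoid α × FreeMonoid α},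
      p ∈ (Finset.range (l.length + 1)).image
        (fun k => (FreeMonoid.ofList (l.take k), FreeMonoid.ofList (l.drop k))) ↔
        p.1 * p.2 = FreeMonoid.ofList l := by
    rintro ⟨u, v⟩
    simp only [Finset.mem_image, Finset.mem_range, Prod.mk.injEq]
    constructor
    · rintro ⟨k, -, rfl, rfl⟩
      rw [← FreeMonoid.ofList_append, List.take_append_drop]
    · intro h
      have h' : l = u.toList ++ v.toList := by
        rw [← FreeMonoid.toList_mul, h, FreeMonoid.toList_ofList]
      refine ⟨u.toList.length, ?_, ?_, ?_⟩
      · rw [h', List.length_append]; omega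
      · rw [h', List.take_left]; rfl
      · rw [h', List.drop_left]; rfl
  rw [MonoidAlgebra.coeff_mul_antidiag _ _ _ _ hs, Finset.sum_eq_single
    (FreeMonoid.ofList (l.take k), FreeMonoid.ofList (l.drop k))]
  · rw [wordCoeff, wordCoeff, hlen, hlen, List.length_take, List.length_drop,
      min_eq_left (by omega)]
  · rintro ⟨u, v⟩ hp hne
    rw [hF, zero_mul]
    intro hu
    apply hne
    obtain ⟨j, hj, hj'⟩ := Finset.mem_image.1 hp
    rw [Finset.mem_range] at hj
    simp only [Prod.mk.injEq] at hj'
    rw [← hj'.1, hlen, List.length_take, min_eq_left (by omega)] at hu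
    rw [← hj'.1, ← hj'.2, hu]
  · intro h
    exact absurd (Finset.mem_image.2 ⟨k, by simpa using hk, rfl⟩) h

/-- A solution of `G = H + M G` is homogeneous if `H` and `M` are, and `M` has no constant term. -/
lemma homog_of_rec {G H M : NCSeries α} (hH : Homog H) (hM : Homog M)
    (hM0 : PowerSeries.constantCoeff M = 0) (h : G = H + M * G) : Homog G := by
  classical
  intro n
  induction n using Nat.strong_induction_on with
  | _ n ih =>
  intro w hw
  rw [h, map_add, MonoidAlgebra.coeff_add, Finsupp.add_apply, hH n w hw, zero_add,
    PowerSeries.coeff_mul, MonoidAlgebra.coeff_sum, Finsupp.finsetSum_apply]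
  refine Finset.sum_eq_zero fun p hp => ?_
  rw [Finset.HasAntidiagonal.mem_antidiagonal] at hp
  -- Since M has no constant term, only p.1 > 0 contributes; then p.2 < n and the induction
  -- hypothesis applies to G.
  rcases Nat.eq_zero_or_pos p.1 with h0 | h0
  · rw [h0, PowerSeries.coeff_zero_eq_constantCoeff_apply, hM0, zero_mul]; rfl
  rw [MonoidAlgebra.coeff_mul, Finsupp.sum]
  refine Finset.sum_eq_zero fun u _ => Finset.sum_eq_zero fun v _ => ?_
  by_contra hne
  have h1 : u * v = w := by by_contra h; exact hne (by simp [h])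
  simp only [if_pos h1] at hne
  have h2 : u.length = p.1 := by by_contra h; exact hne (by simp [hM _ _ h])
  have h3 : v.length = p.2 := by by_contra h; exact hne (by simp [ih p.2 (by omega) _ h])
  apply hw
  rw [← h1, FreeMonoid.length_mul, h2, h3, hp]

lemma cayleyResolvent_rec' {E : NCSeries α} (hE0 : PowerSeries.constantCoeff E = 1) (lam : ℝ) :
    cayleyResolvent E lam = (E - 1) + (lam - 1) • ((E - 1) * cayleyResolvent E lam) :=
  cayleyResolvent_rec (isUnit_resolventDenom hE0 lam)

lemma Homog.cayleyResolvent {E : NCSeries α} (hE : Homog E)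
    (hE0 : PowerSeries.constantCoeff E = 1) (lam : ℝ) : Homog (cayleyResolvent E lam) := by
  refine homog_of_rec (hE.sub homog_one) ((hE.sub homog_one).smul (lam - 1)) ?_ ?_
  · rw [← PowerSeries.coeff_zero_eq_constantCoeff_apply, coeff_real_smul]
    simp [hE0]
  · rw [smul_mul_assoc]
    exact cayleyResolvent_rec' hE0 lam

lemma constantCoeff_expVar (a : α) : PowerSeries.constantCoeff (expVar a) = 1 := by
  rw [← PowerSeries.coeff_zero_eq_constantCoeff_apply, expVar, PowerSeries.coeff_mk]
  simp [MonoidAlgebra.one_def]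

lemma wordCoeff_one (l : List α) :
    wordCoeff (1 : NCSeries α) (FreeMonoid.ofList l) = if l = [] then 1 else 0 := by
  classical
  rw [wordCoeff, PowerSeries.coeff_one]
  cases l with
  | nil => 
    rw [if_pos rfl]
    simp [MonoidAlgebra.one_def]
  | cons a l => 
    rw [if_neg (by simp [FreeMonoid.length])]
    simp

lemma wordCoeff_expVar [DecidableEq α] (a : α) (l : List α) :
    wordCoeff (expVar a) (FreeMonoid.ofList l) =
      if l = List.replicate l.length a then ((l.length.factorial : ℝ))⁻¹ else 0 := by
  have hlen : (FreeMonoid.ofList l).length = l.length := rfl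
  classical
  rw [wordCoeff, hlen, expVar, PowerSeries.coeff_mk, MonoidAlgebra.coeff_single,
    Finsupp.single_apply]
  congr 1
  rw [← FreeMonoid.toList.apply_eq_iff_eq, toList_of_pow, FreeMonoid.toList_ofList]
  exact propext eq_comm

lemma wordCoeff_nil {E : NCSeries α} (hE0 : PowerSeries.constantCoeff E = 1) :
    wordCoeff E (FreeMonoid.ofList []) = 1 := by
  have : (FreeMonoid.ofList ([] : List α)).length = 0 := rfl
  rw [wordCoeff, this, PowerSeries.coeff_zero_eq_constantCoeff_apply, hE0]
  simp [MonoidAlgebra.one_def]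

lemma wordCoeff_sub_one_nil {E : NCSeries α} (hE0 : PowerSeries.constantCoeff E = 1) :
    wordCoeff (E - 1) (FreeMonoid.ofList []) = 0 := by
  rw [wordCoeff_sub, wordCoeff_nil hE0, wordCoeff_one]; simp

/-- The recursion for the coefficients of the resolvent. -/
lemma wordCoeff_cayleyResolvent {E : NCSeries α} (hE : Homog E)
    (hE0 : PowerSeries.constantCoeff E = 1) (lam : ℝ) (l : List α) :
    wordCoeff (cayleyResolvent E lam) (FreeMonoid.ofList l) =
      wordCoeff (E - 1) (FreeMonoid.ofList l) + (lam - 1) *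
        ∑ k ∈ Finset.range (l.length + 1), wordCoeff (E - 1) (FreeMonoid.ofList (l.take k)) *
          wordCoeff (cayleyResolvent E lam) (FreeMonoid.ofList (l.drop k)) := by
  rw [← wordCoeff_mul (hE.sub homog_one), ← wordCoeff_smul, ← wordCoeff_add,
    ← cayleyResolvent_rec' hE0]

/-- Iterate the recursion. The remainder has order at least N, so each fixed degree sees only a
polynomial in `lam`. -/
lemma cayleyResolvent_geom {E : NCSeries α} (hE0 : PowerSeries.constantCoeff E = 1) (lam : ℝ)
    (N : ℕ) : cayleyResolvent E lam =
      ∑ m ∈ Finset.Icc 1 N, (lam - 1) ^ (m - 1) • (E - 1) ^ m +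
        (lam - 1) ^ N • ((E - 1) ^ N * cayleyResolvent E lam) := by
  induction N with
  | zero => simp
  | succ N ih =>
    rw [Finset.sum_Icc_succ_top (by omega), add_assoc]
    nth_rw 1 [ih]
    congr 1
    nth_rw 1 [cayleyResolvent_rec' hE0]
    rw [mul_add, smul_add, Nat.add_sub_cancel, pow_succ (E - 1), mul_smul_comm, smul_smul,
      ← pow_succ (lam - 1), mul_assoc]

/-- The coefficients of the formal logarithm are the integrals of those of the resolvent. -/
lemma wordCoeff_formalLog {E : NCSeries α} (hE0 : PowerSeries.constantCoeff E = 1)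
    (w : FreeMonoid α) :
    wordCoeff (formalLog E) w = ∫ lam in (0 : ℝ)..1, wordCoeff (cayleyResolvent E lam) w := by
  have hz : PowerSeries.constantCoeff (E - 1) = 0 := by simp [hE0]
  -- Powers of E - 1 beyond the length of w do not reach its degree. The factors (lam - 1)^(m - 1)
  -- then integrate to (-1)^(m - 1) / m, the coefficients of the logarithm.
  have key : ∀ lam : ℝ, wordCoeff (cayleyResolvent E lam) w =
      ∑ m ∈ Finset.Icc 1 w.length, (lam - 1) ^ (m - 1) *
        (PowerSeries.coeff w.length ((E - 1) ^ m)).coeff w := by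
    intro lam
    have h0 : PowerSeries.coeff w.length
        ((lam - 1) ^ (w.length + 1) • ((E - 1) ^ (w.length + 1) * cayleyResolvent E lam)) = 0 := by
      rw [coeff_real_smul]
      have : PowerSeries.coeff w.length ((E - 1) ^ (w.length + 1) * cayleyResolvent E lam) = 0 := by
        rw [PowerSeries.coeff_mul]
        refine Finset.sum_eq_zero fun p hp => ?_
        rw [Finset.HasAntidiagonal.mem_antidiagonal] at hp
        rw [PowerSeries.coeff_of_lt_order, zero_mul]
        refine lt_of_lt_of_le ?_ (PowerSeries.le_order_pow_of_constantCoeff_eq_zero _ hz)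
        exact_mod_cast (by omega : p.1 < w.length + 1)
      rw [this, smul_zero]
    have h1 : PowerSeries.coeff w.length ((E - 1) ^ (w.length + 1)) = 0 := by
      rw [PowerSeries.coeff_of_lt_order]
      refine lt_of_lt_of_le ?_ (PowerSeries.le_order_pow_of_constantCoeff_eq_zero _ hz)
      exact_mod_cast Nat.lt_succ_self _
    rw [wordCoeff, cayleyResolvent_geom hE0 lam (w.length + 1), map_add, h0, add_zero,
      Finset.sum_Icc_succ_top (by omega), map_add, coeff_real_smul, h1, smul_zero, add_zero,
      map_sum, MonoidAlgebra.coeff_sum, Finsupp.finsetSum_apply]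
    simp
  simp_rw [key]
  rw [intervalIntegral.integral_finsetSum
    (fun m _ => Continuous.intervalIntegrable (by fun_prop) _ _), wordCoeff, formalLog,
    PowerSeries.coeff_mk, MonoidAlgebra.coeff_sum, Finsupp.finsetSum_apply]
  refine Finset.sum_congr rfl fun m hm => ?_
  rw [intervalIntegral.integral_mul_const, MonoidAlgebra.coeff_smul, Finsupp.smul_apply,
    smul_eq_mul]
  congr 1
  have hm1 : 1 ≤ m := (Finset.mem_Icc.1 hm).1
  rw [intervalIntegral.integral_comp_sub_right (fun x => x ^ (m - 1)) 1, integral_pow,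
    Nat.sub_add_cancel hm1]
  have : (m : ℝ) = ((m - 1 : ℕ) : ℝ) + 1 := by
    rw [← Nat.cast_succ, Nat.succ_eq_add_one, Nat.sub_add_cancel hm1]
  rw [← this]
  obtain ⟨k, rfl⟩ : ∃ k, m = k + 1 := ⟨m - 1, by omega⟩
  simp [pow_succ]

end Formal

/-! ### Weights of ascents and descents -/

section Words

/-- The product over adjacent pairs of `lam` for ascents and `lam - 1` otherwise; `0` for the
empty list. -/
def ascWeight {β : Type*} [LinearOrder β] (lam : ℝ) : List β → ℝ
  | [] => 0
  | [_] => 1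
  | a :: b :: l => ((if a < b then 1 else 0) + (lam - 1)) * ascWeight lam (b :: l)

/-- The indicator function of nonempty strictly increasing lists. -/
def incInd {β : Type*} [LinearOrder β] (l : List β) : ℝ :=
  if l ≠ [] ∧ l.Pairwise (· < ·) then 1 else 0

variable {β : Type*} [LinearOrder β]

@[simp] lemma incInd_nil : incInd ([] : List β) = 0 := by simp [incInd]

@[simp] lemma incInd_singleton (a : β) : incInd [a] = 1 := by simp [incInd]

lemma incInd_cons_cons (a b : β) (l : List β) :
    incInd (a :: b :: l) = (if a < b then 1 else 0) * incInd (b :: l) := by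
  unfold incInd
  by_cases h : a < b
  · by_cases h2 : (b :: l).Pairwise (· < ·)
    · have : (a :: b :: l).Pairwise (· < ·) := by
        rw [List.pairwise_cons]
        refine ⟨fun c hc => ?_, h2⟩
        rcases List.mem_cons.1 hc with rfl | hc
        · exact h
        · exact h.trans ((List.pairwise_cons.1 h2).1 c hc)
      rw [if_pos h, if_pos ⟨by simp, this⟩, if_pos ⟨by simp, h2⟩, one_mul]
    · rw [if_pos h, if_neg (fun H => h2 (List.pairwise_cons.1 H.2).2), if_neg (fun H => h2 H.2),
        mul_zero]
  · rw [if_neg h, if_neg, zero_mul]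
    rintro ⟨-, H⟩
    exact h ((List.pairwise_cons.1 H).1 b (by simp))

/-- Decomposition of the weight according to the first increasing block. -/
lemma ascWeight_rec (lam : ℝ) : ∀ l : List β, ascWeight lam l = incInd l + (lam - 1) *
    ∑ k ∈ Finset.range (l.length + 1), incInd (l.take k) * ascWeight lam (l.drop k)
  | [] => by simp [ascWeight]
  | [a] => by simp [ascWeight, Finset.sum_range_succ]
  | a :: b :: l => by
    have ih := ascWeight_rec lam (b :: l)
    -- The term k = 0 vanishes, k = 1 contributes the weight of b :: l, and for k ≥ 2 the prefix
    -- contains both a and b, so the factor for a < b comes out.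
    have hs : ∑ k ∈ Finset.range ((a :: b :: l).length + 1),
        incInd ((a :: b :: l).take k) * ascWeight lam ((a :: b :: l).drop k) =
        ascWeight lam (b :: l) + (if a < b then 1 else 0) *
          ∑ k ∈ Finset.range ((b :: l).length + 1),
            incInd ((b :: l).take k) * ascWeight lam ((b :: l).drop k) := by
      rw [List.length_cons, Finset.sum_range_succ', List.take_zero, incInd_nil, zero_mul, add_zero,
        List.length_cons, Finset.sum_range_succ', Finset.sum_range_succ' _ (l.length + 1)]
      simp only [List.take_succ_cons, List.drop_succ_cons, List.take_zero, List.drop_zero,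
        incInd_singleton, incInd_cons_cons, incInd_nil, one_mul, zero_mul, add_zero,
        Finset.mul_sum, mul_assoc]
      ring
    rw [hs, incInd_cons_cons, ascWeight]
    nth_rw 1 [add_mul, ih]
    ring

lemma ascWeight_map {γ : Type*} [LinearOrder γ] {f : β → γ} (hf : StrictMono f) (lam : ℝ) :
    ∀ l : List β, ascWeight lam (l.map f) = ascWeight lam l
  | [] => rfl
  | [_] => rfl
  | a :: b :: l => by
    have ih := ascWeight_map hf lam (b :: l)
    simp only [List.map_cons] at ih
    simp only [List.map_cons, ascWeight, hf.lt_iff_lt, ih]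

lemma ascWeight_ofFn (lam : ℝ) : ∀ {n : ℕ} (t : Fin (n + 1) → β),
    ascWeight lam (List.ofFn t) =
      ∏ i : Fin n, ((if t i.castSucc < t i.succ then 1 else 0) + (lam - 1))
  | 0, t => by simp [ascWeight]
  | n + 1, t => by
    have ih := ascWeight_ofFn lam (fun i : Fin (n + 1) => t i.succ)
    rw [Fin.prod_univ_succ, List.ofFn_succ, List.ofFn_succ, ascWeight]
    rw [List.ofFn_succ] at ih
    rw [ih]
    rfl

lemma abs_ascWeight_le {lam : ℝ} (h : lam ∈ Icc (0 : ℝ) 1) :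
    ∀ l : List β, |ascWeight lam l| ≤ 1
  | [] => by simp [ascWeight]
  | [_] => by simp [ascWeight]
  | a :: b :: l => by
    have ih := abs_ascWeight_le h (b :: l)
    obtain ⟨h0, h1⟩ := h
    rw [ascWeight, abs_mul]
    refine mul_le_one₀ ?_ (abs_nonneg _) ih
    rw [abs_le]
    split_ifs <;> constructor <;> linarith

lemma continuous_ascWeight : ∀ l : List β, Continuous fun lam : ℝ => ascWeight lam l
  | [] => by simp only [ascWeight]; fun_prop
  | [_] => by simp only [ascWeight]; fun_prop
  | a :: b :: l => by
    have ih := continuous_ascWeight (b :: l)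
    simp only [ascWeight]
    fun_prop

/-- Uniqueness in convolution recursions. -/
lemma eq_of_conv_rec {α : Type*} {e e' c c' : List α → ℝ} {s : ℝ} (P : List α → Prop)
    (htake : ∀ l k, P l → P (l.take k)) (hdrop : ∀ l k, P l → P (l.drop k)) (e0 : e [] = 0)
    (hee : ∀ l, P l → e l = e' l)
    (hc : ∀ l, P l → c l = e l + s * ∑ k ∈ Finset.range (l.length + 1),
      e (l.take k) * c (l.drop k))
    (hc' : ∀ l, P l → c' l = e' l + s * ∑ k ∈ Finset.range (l.length + 1),
      e' (l.take k) * c' (l.drop k)) :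
    ∀ n (l : List α), l.length = n → P l → c l = c' l := by
  intro n
  induction n using Nat.strong_induction_on with
  | _ n ih =>
  intro l hn hl
  rw [hc l hl, hc' l hl, hee l hl]
  congr 2
  refine Finset.sum_congr rfl fun k hk => ?_
  rw [hee _ (htake l k hl)]
  -- The vanishing of e on the empty list removes k = 0, so the recursion refers only to strictly
  -- shorter lists.
  rcases Nat.eq_zero_or_pos k with rfl | hk0
  · have : e' [] = 0 := by rw [← hee [] (by simpa using htake l 0 hl), e0]
    simp [this]
  · rcases Nat.eq_zero_or_pos l.length with h0 | h0
    · have : l = [] := List.length_eq_zero_iff.1 h0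
      subst this
      have : e' [] = 0 := by rw [← hee [] hl, e0]
      simp [this]
    · rw [ih (l.drop k).length (by rw [List.length_drop]; omega) _ rfl (hdrop l k hl)]

end Words

/-! ### Coefficients of products of exponentials -/

section Products

variable {α : Type*}

lemma homog_prod_expVar (L : List α) : Homog (L.map expVar).prod := by
  induction L with
  | nil => exact homog_one
  | cons a L ih => rw [List.map_cons, List.prod_cons]; exact (homog_expVar a).mul ih

lemma constantCoeff_prod_expVar (L : List α) :
    PowerSeries.constantCoeff (L.map expVar).prod = 1 := by
  induction L with
  | nil => simp
  | cons a L ih => rw [List.map_cons, List.prod_cons, map_mul, ih, constantCoeff_expVar, one_mul]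

/-- In a word without repetition each exponential contributes either nothing or its letter once,
with coefficient 1; the letters used must appear in the order of L. -/
lemma wordCoeff_prod_expVar [DecidableEq α] (L : List α) (hL : L.Nodup) (l : List α)
    (hl : l.Nodup) :
    wordCoeff (L.map expVar).prod (FreeMonoid.ofList l) = if l.Sublist L then 1 else 0 := by
  induction L generalizing l with
  | nil =>
    rw [List.map_nil, List.prod_nil, wordCoeff_one]
    simp
  | cons a L ih =>
    rw [List.nodup_cons] at hL
    rw [List.map_cons, List.prod_cons, wordCoeff_mul (homog_expVar a)]
    have hterm : ∀ k, wordCoeff ((L.map expVar).prod) (FreeMonoid.ofList (l.drop k)) =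
        if (l.drop k).Sublist L then 1 else 0 := fun k =>
      ih hL.2 _ (hl.sublist (List.drop_sublist k l))
    simp only [hterm, wordCoeff_expVar]
    cases l with
    | nil => simp
    | cons b l =>
      -- Only prefixes of length 0 and 1 survive: a longer one would have to be a repeated letter.
      rw [List.length_cons, Finset.sum_range_succ', Finset.sum_range_succ', Finset.sum_eq_zero]
      · by_cases hab : b = a
        · subst hab
          have h1 : ¬ (b :: l).Sublist L := fun h => hL.1 (h.subset (by simp))
          have h2 : (b :: l).Sublist (b :: L) ↔ l.Sublist L := by simp
          simp [h1, h2]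
        · have h2 : (b :: l).Sublist (a :: L) ↔ (b :: l).Sublist L := by
            rw [List.sublist_cons_iff]
            simp [hab]
          simp [h2, hab]
      · intro k hk
        rw [Finset.mem_range] at hk
        rw [if_neg, zero_mul]
        intro h
        obtain ⟨c, l', rfl⟩ : ∃ c l', l = c :: l' := by
          cases l with
          | nil => simp at hk
          | cons c l' => exact ⟨c, l', rfl⟩
        simp only [List.take_succ_cons, List.length_cons, List.replicate_succ] at h
        injection h with h1 h2
        injection h2 with h2 h3
        rw [h1, h2] at hl
        simp at hl

lemma sublist_finRange_iff {n : ℕ} (l : List (Fin n)) :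
    l.Sublist (List.finRange n) ↔ l.Pairwise (· < ·) := by
  constructor
  · intro h
    exact (List.pairwise_lt_finRange n).sublist h
  · intro h
    refine List.sublist_of_subperm_of_sortedLE (l₁ := l) ?_ ?_ (List.sortedLT_finRange n).sortedLE
    · exact List.subperm_of_subset (h.imp fun h => ne_of_lt h) fun x _ => List.mem_finRange x
    · exact List.SortedLT.sortedLE (List.sortedLT_iff_pairwise.2 h)

/-- The coefficients of the resolvent of `exp X₁ ⋯ exp X_n` on words without repetition. -/
lemma wordCoeff_cayleyResolvent_ofFn {n : ℕ} (lam : ℝ) (l : List (Fin n)) (hl : l.Nodup) :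
    wordCoeff (cayleyResolvent (List.ofFn fun i : Fin n => expVar i).prod lam)
      (FreeMonoid.ofList l) = ascWeight lam l := by
  have hE : (List.ofFn fun i : Fin n => expVar i) = (List.finRange n).map expVar := by
    rw [List.ofFn_eq_map]
  rw [hE]
  have h0 := constantCoeff_prod_expVar (List.finRange n)
  refine eq_of_conv_rec
    (e := fun l => wordCoeff (((List.finRange n).map expVar).prod - 1) (FreeMonoid.ofList l))
    (c := fun l => wordCoeff (cayleyResolvent ((List.finRange n).map expVar).prod lam)
      (FreeMonoid.ofList l)) (e' := incInd) (s := lam - 1) (c' := ascWeight lam) List.Nodup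
    (fun l k h => h.sublist (List.take_sublist k l))
    (fun l k h => h.sublist (List.drop_sublist k l)) (wordCoeff_sub_one_nil h0) ?_
    (fun l _ => wordCoeff_cayleyResolvent (homog_prod_expVar _) h0 lam l)
    (fun l _ => ascWeight_rec lam l) _ l rfl hl
  intro l hl
  show wordCoeff _ (FreeMonoid.ofList l) = _
  rw [wordCoeff_sub, wordCoeff_one, wordCoeff_prod_expVar _ (List.nodup_finRange n) l hl]
  by_cases h : l = []
  · subst h; simp
  · simp [incInd, h, sublist_finRange_iff]

/-- Words given by permutations have no repetition, so the coefficient of the logarithm is the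
`lam`-integral of an explicit ascent-descent weight. -/
lemma magnusCommutator_eq {A : Type*} [NormedRing A] [NormedAlgebra ℝ A] {n : ℕ} (X : Fin n → A) :
    magnusCommutator n X = ∑ σ : Equiv.Perm (Fin n),
      (∫ lam in (0 : ℝ)..1, ascWeight lam (List.ofFn σ)) • (List.ofFn fun i => X (σ i)).prod := by
  refine Finset.sum_congr rfl fun σ _ => ?_
  have h0 : PowerSeries.constantCoeff (List.ofFn fun i : Fin n => expVar i).prod = 1 := by
    rw [List.ofFn_eq_map]
    exact constantCoeff_prod_expVar _
  rw [wordCoeff_formalLog h0]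
  congr 2
  ext lam
  exact wordCoeff_cayleyResolvent_ofFn lam _ (List.nodup_ofFn.2 σ.injective)

/-- The word `0 ⋯ 0 1 ⋯ 1` with `k` zeros, of length `n`. -/
def splitWord (n k : ℕ) : Fin n → Fin 2 := fun i => if i.1 < k then 0 else 1

lemma ofFn_splitWord {n k : ℕ} (hk : k ≤ n) :
    List.ofFn (splitWord n k) = List.replicate k 0 ++ List.replicate (n - k) 1 := by
  apply List.ext_getElem
  · simp; omega
  · intro i h1 h2
    rw [List.getElem_ofFn, List.getElem_append]
    simp [splitWord]

/-- At most one summand is nonzero. The sum over k is kept because its index becomes the summation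
index of `bchTerm`. -/
lemma wordCoeff_expVar_mul_expVar {n : ℕ} (v : Fin n → Fin 2) :
    wordCoeff (expVar (0 : Fin 2) * expVar 1) (FreeMonoid.ofList (List.ofFn v)) =
      ∑ k ∈ Finset.range (n + 1), if v = splitWord n k then
        ((k.factorial : ℝ) * ((n - k).factorial : ℝ))⁻¹ else 0 := by
  rw [wordCoeff_mul (homog_expVar _), List.length_ofFn]
  refine Finset.sum_congr rfl fun k hk => ?_
  have hk' : k ≤ n := by rw [Finset.mem_range] at hk; omega
  rw [wordCoeff_expVar, wordCoeff_expVar, List.length_take, List.length_drop, List.length_ofFn,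
    min_eq_left hk', mul_inv]
  by_cases h : v = splitWord n k
  · rw [if_pos h, if_pos, if_pos]
    · rw [h, ofFn_splitWord hk', List.drop_left' (by simp)]
    · rw [h, ofFn_splitWord hk', List.take_left' (by simp)]
  · rw [if_neg h]
    by_cases h1 : (List.ofFn v).take k = List.replicate k 0
    · rw [if_neg (c := _ = List.replicate (n - k) 1), mul_zero]
      intro h2
      apply h
      rw [← List.ofFn_inj, ofFn_splitWord hk', ← h1, ← h2, List.take_append_drop]
    · rw [if_neg h1, zero_mul]

end Products

/-! ### Integration over cubes, chambers and cells -/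

section Chambers

/-- Two coordinates coincide only on a proper subspace, which is null. Ties can thus be ignored in
all integrals below. -/
lemma ae_injective (n : ℕ) : ∀ᵐ t : Fin n → ℝ, Function.Injective t := by
  have h : ∀ᵐ t : Fin n → ℝ, ∀ i j, i ≠ j → t i ≠ t j := by
    rw [ae_all_iff]; intro i
    rw [ae_all_iff]; intro j
    by_cases hij : i = j
    · exact Filter.Eventually.of_forall fun t h => absurd hij h
    let s : Submodule ℝ (Fin n → ℝ) :=
      LinearMap.ker (LinearMap.proj (R := ℝ) (φ := fun _ : Fin n => ℝ) i - LinearMap.proj j)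
    have hs : s ≠ ⊤ := by
      intro h
      have : (Pi.single i 1 : Fin n → ℝ) ∈ s := by rw [h]; trivial
      have h2 : (Pi.single i 1 : Fin n → ℝ) i - (Pi.single i 1 : Fin n → ℝ) j = 0 := this
      rw [Pi.single_eq_same, Pi.single_eq_of_ne (Ne.symm hij)] at h2
      norm_num at h2
    have h0 := Measure.addHaar_submodule (volume : Measure (Fin n → ℝ)) s hs
    have := measure_eq_zero_iff_ae_notMem.1 h0
    filter_upwards [this] with t ht _ heq
    exact ht (show t i - t j = 0 by rw [heq, sub_self])
  filter_upwards [h] with t ht i j hij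
  by_contra hne
  exact ht i j hne hij

/-- Permutation of coordinates. -/
def permCoord {n : ℕ} (σ : Equiv.Perm (Fin n)) : (Fin n → ℝ) ≃ᵐ (Fin n → ℝ) :=
  MeasurableEquiv.piCongrLeft (fun _ => ℝ) σ.symm

lemma permCoord_apply {n : ℕ} (σ : Equiv.Perm (Fin n)) (t : Fin n → ℝ) :
    permCoord σ t = t ∘ σ := by
  ext i
  rw [permCoord, MeasurableEquiv.coe_piCongrLeft]
  have := Equiv.piCongrLeft_apply_apply (fun _ => ℝ) σ.symm t (σ i)
  simpa using this

lemma measurePreserving_permCoord {n : ℕ} (σ : Equiv.Perm (Fin n)) :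
    MeasurePreserving (permCoord σ) volume volume :=
  volume_measurePreserving_piCongrLeft (fun _ => ℝ) σ.symm

lemma measurableSet_cube {n : ℕ} {S : Set ℝ} (hS : MeasurableSet S) :
    MeasurableSet {t : Fin n → ℝ | ∀ i, t i ∈ S} := by
  have : {t : Fin n → ℝ | ∀ i, t i ∈ S} = univ.pi fun _ => S := by ext; simp
  rw [this]
  exact MeasurableSet.univ_pi fun _ => hS

lemma measurableSet_strictMono {n : ℕ} : MeasurableSet {t : Fin n → ℝ | StrictMono t} := by
  have : {t : Fin n → ℝ | StrictMono t} = ⋂ i, ⋂ j, {t | i < j → t i < t j} := by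
    ext t; simp [StrictMono]
  rw [this]
  refine MeasurableSet.iInter fun i => MeasurableSet.iInter fun j => ?_
  by_cases h : i < j
  · simp only [h, forall_true_left]
    exact measurableSet_lt (measurable_pi_apply i) (measurable_pi_apply j)
  · simp [h]

lemma monotone_ae_eq_strictMono {n : ℕ} (S : Set ℝ) :
    {t : Fin n → ℝ | (∀ i, t i ∈ S) ∧ Monotone t} =ᵐ[volume]
      {t : Fin n → ℝ | (∀ i, t i ∈ S) ∧ StrictMono t} := by
  filter_upwards [ae_injective n] with t ht
  refine propext ⟨fun h => ⟨h.1, h.2.strictMono_of_injective ht⟩, fun h => ⟨h.1, h.2.monotone⟩⟩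

/-- Decomposition of an integral over a cube into chambers. -/
lemma setIntegral_cube_eq_sum_perm {E : Type*} [NormedAddCommGroup E] [NormedSpace ℝ E] {n : ℕ}
    {S : Set ℝ} (hS : MeasurableSet S) {f : (Fin n → ℝ) → E}
    (hf : IntegrableOn f {t | ∀ i, t i ∈ S}) :
    ∫ t in {t : Fin n → ℝ | ∀ i, t i ∈ S}, f t =
      ∑ σ : Equiv.Perm (Fin n), ∫ t in {t : Fin n → ℝ | (∀ i, t i ∈ S) ∧ Monotone t}, f (t ∘ σ) := by
  have hm : MeasurableSet {t : Fin n → ℝ | (∀ i, t i ∈ S) ∧ StrictMono t} :=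
    (measurableSet_cube hS).inter measurableSet_strictMono
  have h1 : {t : Fin n → ℝ | ∀ i, t i ∈ S} =ᵐ[volume]
      ⋃ σ : Equiv.Perm (Fin n), permCoord σ ⁻¹' {t | (∀ i, t i ∈ S) ∧ StrictMono t} := by
    filter_upwards [ae_injective n] with t ht
    refine propext ⟨fun h => ?_, fun h => ?_⟩
    -- A point with distinct coordinates lies in the chamber of its sorting permutation.
    · refine mem_iUnion.2 ⟨Tuple.sort t, ?_⟩
      rw [mem_preimage, permCoord_apply]
      exact ⟨fun i => h _, (Tuple.monotone_sort t).strictMono_of_injective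
        (ht.comp (Tuple.sort t).injective)⟩
    · obtain ⟨σ, hσ⟩ := mem_iUnion.1 h
      rw [mem_preimage, permCoord_apply] at hσ
      intro i
      simpa using hσ.1 (σ.symm i)
  rw [setIntegral_congr_set h1, integral_iUnion_fintype
    (fun σ => (permCoord σ).measurable hm)]
  -- Pulling a chamber back along σ⁻¹ composes the integrand with σ, so the sum is reindexed by
  -- inversion.
  · rw [← Equiv.sum_comp (Equiv.inv (Equiv.Perm (Fin n)))]
    refine Finset.sum_congr rfl fun σ _ => ?_
    rw [setIntegral_congr_set (monotone_ae_eq_strictMono S),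
      ← (measurePreserving_permCoord σ⁻¹).setIntegral_preimage_emb
        (permCoord _).measurableEmbedding (fun t => f (t ∘ σ))]
    refine setIntegral_congr_fun ((permCoord _).measurable hm) fun t _ => ?_
    rw [permCoord_apply]
    congr 1
    ext i
    simp
  · intro σ τ hστ
    rw [Function.onFun, Set.disjoint_left]
    intro t h1 h2
    rw [mem_preimage, permCoord_apply] at h1 h2
    apply hστ
    have hinj : Function.Injective t := by
      intro i j hij
      have := h1.2.injective.eq_iff (a := σ.symm i) (b := σ.symm j)
      simpa [hij] using this
    have e1 : t ∘ σ = t ∘ τ := by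
      -- Two increasing enumerations of the same finite set of coordinates agree, so the chambers
      -- are disjoint.
      apply StrictMono.range_inj h1.2 h2.2 |>.1
      rw [range_comp, range_comp, σ.surjective.range_eq, τ.surjective.range_eq]
    ext i
    have := congrFun e1 i
    exact congrArg Fin.val (hinj this)
  · intro σ
    refine hf.mono_set fun t ht => ?_
    rw [mem_preimage, permCoord_apply] at ht
    intro i
    simpa using ht.1 (σ.symm i)

/-- The n! chambers have equal volume and fill a cube of volume 1 up to a null set. -/
lemma volume_real_monotone_cube {n : ℕ} {S : Set ℝ} (hS : MeasurableSet S)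
    (hv : volume S = 1) :
    volume.real {t : Fin n → ℝ | (∀ i, t i ∈ S) ∧ Monotone t} = (n.factorial : ℝ)⁻¹ := by
  have hc : volume {t : Fin n → ℝ | ∀ i, t i ∈ S} = 1 := by
    have : {t : Fin n → ℝ | ∀ i, t i ∈ S} = univ.pi fun _ => S := by ext; simp
    rw [this, volume_pi_pi]
    simp [hv]
  have := setIntegral_cube_eq_sum_perm (E := ℝ) (n := n) hS (f := fun _ => 1)
    (integrableOn_const (by rw [hc]; simp))
  simp only [setIntegral_const, smul_eq_mul, mul_one, Finset.sum_const, Finset.card_univ,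
    Fintype.card_perm, Fintype.card_fin, nsmul_eq_mul, Measure.real, hc,
    ENNReal.toReal_one] at this
  rw [Measure.real]
  exact eq_inv_of_mul_eq_one_right this.symm

end Chambers

/-! ### Cells indexed by words, and integration over them -/

section Cells

/-- The two halves of the interval `[0, 2]`. -/
def cell (c : Fin 2) : Set ℝ := if c = 0 then Icc 0 1 else Ioc 1 2

lemma measurableSet_cell (c : Fin 2) : MeasurableSet (cell c) := by
  unfold cell; split_ifs; exacts [measurableSet_Icc, measurableSet_Ioc]

lemma volume_cell (c : Fin 2) : volume (cell c) = 1 := by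
  unfold cell; split_ifs <;> simp; norm_num

instance (c : Fin 2) : IsProbabilityMeasure ((volume : Measure ℝ).restrict (cell c)) :=
  ⟨by rw [Measure.restrict_apply_univ, volume_cell]⟩

/-- Lebesgue measure on the cell given by a word. -/
def cellMeas {n : ℕ} (v : Fin n → Fin 2) : Measure (Fin n → ℝ) :=
  Measure.pi fun i => (volume : Measure ℝ).restrict (cell (v i))

instance {n : ℕ} (v : Fin n → Fin 2) : IsProbabilityMeasure (cellMeas v) := by
  unfold cellMeas; infer_instance

lemma cellMeas_eq {n : ℕ} (v : Fin n → Fin 2) :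
    cellMeas v = volume.restrict (univ.pi fun i => cell (v i)) := by
  rw [cellMeas, volume_pi, Measure.restrict_pi_pi]

lemma ae_cellMeas {n : ℕ} (v : Fin n → Fin 2) :
    ∀ᵐ t ∂(cellMeas v), Function.Injective t ∧ ∀ i, t i ∈ cell (v i) := by
  rw [cellMeas_eq]
  filter_upwards [ae_restrict_of_ae (ae_injective n),
    ae_restrict_mem (MeasurableSet.univ_pi fun i => measurableSet_cell (v i))] with t h1 h2
  exact ⟨h1, fun i => h2 i trivial⟩

lemma restrict_cube_eq_sum (n : ℕ) :
    (volume : Measure (Fin n → ℝ)).restrict {t | ∀ i, t i ∈ Icc (0 : ℝ) 2} =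
      ∑ v : Fin n → Fin 2, cellMeas v := by
  have h1 : {t : Fin n → ℝ | ∀ i, t i ∈ Icc (0 : ℝ) 2} =
      ⋃ v : Fin n → Fin 2, univ.pi fun i => cell (v i) := by
    ext t
    simp only [mem_ofPred_eq, mem_iUnion, mem_univ_pi]
    constructor
    · intro h
      refine ⟨fun i => if t i ≤ 1 then 0 else 1, fun i => ?_⟩
      by_cases hi : t i ≤ 1
      · simp [cell, hi, (h i).1]
      · simp only [cell, hi, if_false, one_ne_zero]
        exact ⟨not_le.1 hi, (h i).2⟩
    · rintro ⟨v, hv⟩ i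
      have := hv i
      unfold cell at this
      split_ifs at this
      · exact ⟨this.1, this.2.trans (by norm_num)⟩
      · exact ⟨by linarith [this.1], this.2⟩
  rw [h1, Measure.restrict_iUnion _ fun v => MeasurableSet.univ_pi fun i => measurableSet_cell _,
    Measure.sum_fintype]
  · simp_rw [cellMeas_eq]
  · intro v w hvw
    rw [Function.onFun, Set.disjoint_left]
    intro t h1 h2
    apply hvw
    ext1 i
    have h1 : t i ∈ cell (v i) := h1 i trivial
    have h2 : t i ∈ cell (w i) := h2 i trivial
    unfold cell at h1 h2
    split_ifs at h1 h2 with a b b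
    · rw [a, b]
    · exact absurd h1.2 (not_le.2 h2.1)
    · exact absurd h2.2 (not_le.2 h1.1)
    · rw [Fin.eq_one_of_ne_zero _ a, Fin.eq_one_of_ne_zero _ b]

/-- The analogue for measures of cutting a word in two. It makes integrals of (function of the
prefix) × (function of the suffix) factor. -/
lemma measurePreserving_append {k m : ℕ} (v : Fin (k + m) → Fin 2) :
    MeasurePreserving (fun p : (Fin k → ℝ) × (Fin m → ℝ) => Fin.append p.1 p.2)
      ((cellMeas fun i => v (Fin.castAdd m i)).prod (cellMeas fun i => v (Fin.natAdd k i)))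
      (cellMeas v) := by
  have hmeas : Measurable (fun p : (Fin k → ℝ) × (Fin m → ℝ) => Fin.append p.1 p.2) := by
    rw [measurable_pi_iff]
    intro i
    refine Fin.addCases (fun i => ?_) (fun i => ?_) i
    · simp only [Fin.append_left]; fun_prop
    · simp only [Fin.append_right]; fun_prop
  refine ⟨hmeas, ?_⟩
  symm
  refine Measure.pi_eq fun s hs => ?_
  rw [Measure.map_apply hmeas (MeasurableSet.univ_pi hs)]
  have : (fun p : (Fin k → ℝ) × (Fin m → ℝ) => Fin.append p.1 p.2) ⁻¹' (univ.pi s) =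
      (univ.pi fun i => s (Fin.castAdd m i)) ×ˢ (univ.pi fun i => s (Fin.natAdd k i)) := by
    ext p
    simp only [mem_preimage, mem_univ_pi, mem_prod]
    constructor
    · intro h
      exact ⟨fun i => by simpa using h (Fin.castAdd m i), fun i => by simpa using h (Fin.natAdd k i)⟩
    · rintro ⟨h1, h2⟩ i
      refine Fin.addCases (fun i => ?_) (fun i => ?_) i
      · simpa using h1 i
      · simpa using h2 i
  rw [this, Measure.prod_prod, cellMeas, cellMeas, Measure.pi_pi, Measure.pi_pi,
    Fin.prod_univ_add]

lemma integral_take_mul_drop {F G : List ℝ → ℝ}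
    (hF : ∀ n, Measurable fun t : Fin n → ℝ => F (List.ofFn t))
    (hG : ∀ n, Measurable fun t : Fin n → ℝ => G (List.ofFn t))
    {k m : ℕ} (v : Fin (k + m) → Fin 2) :
    ∫ t, F ((List.ofFn t).take k) * G ((List.ofFn t).drop k) ∂(cellMeas v) =
      (∫ t, F (List.ofFn t) ∂(cellMeas fun i => v (Fin.castAdd m i))) *
        ∫ t, G (List.ofFn t) ∂(cellMeas fun i => v (Fin.natAdd k i)) := by
  have e : ∀ t : Fin (k + m) → ℝ, List.ofFn t =
      List.ofFn (fun i => t (Fin.castAdd m i)) ++ List.ofFn (fun i => t (Fin.natAdd k i)) := by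
    intro t
    rw [← List.ofFn_fin_append]
    congr 1
    ext i
    refine Fin.addCases (fun i => ?_) (fun i => ?_) i <;> simp
  have e1 : ∀ t : Fin (k + m) → ℝ, F ((List.ofFn t).take k) * G ((List.ofFn t).drop k) =
      F (List.ofFn (fun i => t (Fin.castAdd m i))) *
        G (List.ofFn (fun i => t (Fin.natAdd k i))) := by
    intro t
    rw [e t, List.take_left' (by simp), List.drop_left' (by simp)]
  simp_rw [e1]
  rw [← (measurePreserving_append v).map_eq, integral_map]
  · simp only [Fin.append_left, Fin.append_right]
    exact integral_prod_mul (fun t => F (List.ofFn t)) (fun t => G (List.ofFn t))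
  · exact (measurePreserving_append v).measurable.aemeasurable
  · refine Measurable.aestronglyMeasurable ?_
    refine Measurable.mul ((hF k).comp ?_) ((hG m).comp ?_) <;> fun_prop

lemma measurable_ascWeight_ofFn (lam : ℝ) :
    ∀ n, Measurable fun t : Fin n → ℝ => ascWeight lam (List.ofFn t)
  | 0 => by simp only [List.ofFn_zero]; fun_prop
  | n + 1 => by
    simp_rw [ascWeight_ofFn]
    refine Finset.measurable_fun_prod _ fun i _ => Measurable.add_const ?_ _
    exact Measurable.ite (measurableSet_lt (measurable_pi_apply _) (measurable_pi_apply _))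
      measurable_const measurable_const

lemma incInd_ofFn {n : ℕ} (t : Fin (n + 1) → ℝ) :
    incInd (List.ofFn t) = {t : Fin (n + 1) → ℝ | StrictMono t}.indicator 1 t := by
  classical
  rw [incInd, indicator_apply]
  refine if_congr ?_ rfl rfl
  rw [List.pairwise_ofFn]
  simp [StrictMono]

lemma measurable_incInd_ofFn : ∀ n, Measurable fun t : Fin n → ℝ => incInd (List.ofFn t)
  | 0 => by simp only [List.ofFn_zero]; fun_prop
  | n + 1 => by
    simp_rw [incInd_ofFn]
    exact measurable_one.indicator measurableSet_strictMono

lemma cellMeas_strictMono_const {n : ℕ} (c : Fin 2) :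
    (cellMeas fun _ : Fin n => c).real {t | StrictMono t} = (n.factorial : ℝ)⁻¹ := by
  rw [← volume_real_monotone_cube (measurableSet_cell c) (volume_cell c), cellMeas_eq,
    measureReal_restrict_apply measurableSet_strictMono,
    measureReal_congr (monotone_ae_eq_strictMono (cell c))]
  congr 1
  ext t
  simp [and_comm]

lemma splitWord_injective {n k l : ℕ} (hk : k ≤ n) (hl : l ≤ n)
    (h : splitWord n k = splitWord n l) : k = l := by
  rcases lt_trichotomy k l with h1 | h1 | h1
  · have := congrFun h ⟨k, by omega⟩
    simp [splitWord, h1] at this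
  · exact h1
  · have := congrFun h ⟨l, by omega⟩
    simp [splitWord, h1] at this

/-- Every point of the first half-interval lies below every point of the second, so being increasing
decouples into the two blocks, each a simplex. -/
lemma cellMeas_strictMono_splitWord (k m : ℕ) :
    (cellMeas (splitWord (k + m) k)).real {t | StrictMono t} =
      ((k.factorial : ℝ) * (m.factorial : ℝ))⁻¹ := by
  have h0 : (fun i : Fin k => splitWord (k + m) k (Fin.castAdd m i)) = fun _ => 0 := by
    ext i; simp [splitWord]
  have h1 : (fun i : Fin m => splitWord (k + m) k (Fin.natAdd k i)) = fun _ => 1 := by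
    ext i; simp [splitWord]
  rw [mul_inv, ← cellMeas_strictMono_const (n := k) 0, ← cellMeas_strictMono_const (n := m) 1,
    ← measureReal_prod_prod, measureReal_def, measureReal_def,
    ← (measurePreserving_append _).measure_preimage measurableSet_strictMono.nullMeasurableSet,
    h0, h1]
  congr 1
  apply measure_congr
  have a0 : ∀ᵐ p ∂((cellMeas fun _ : Fin k => 0).prod (cellMeas fun _ : Fin m => 1)),
      ∀ i, p.1 i ∈ cell 0 :=
    Measure.quasiMeasurePreserving_fst.ae ((ae_cellMeas _).mono fun t ht => ht.2)
  have a1 : ∀ᵐ p ∂((cellMeas fun _ : Fin k => 0).prod (cellMeas fun _ : Fin m => 1)),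
      ∀ i, p.2 i ∈ cell 1 :=
    Measure.quasiMeasurePreserving_snd.ae ((ae_cellMeas _).mono fun t ht => ht.2)
  filter_upwards [a0, a1] with p hp0 hp1
  refine propext ⟨fun h => ⟨fun i j hij => ?_, fun i j hij => ?_⟩, fun h i j hij => ?_⟩
  · simpa using h (show Fin.castAdd m i < Fin.castAdd m j from hij)
  · simpa using h (show Fin.natAdd k i < Fin.natAdd k j by simpa using hij)
  · revert hij
    refine Fin.addCases (fun i => ?_) (fun i => ?_) i <;>
    refine Fin.addCases (fun j => ?_) (fun j => ?_) j <;> intro hij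
    · simpa using h.1 (show i < j from hij)
    · have := hp0 i
      have := hp1 j
      simp only [cell, if_true, one_ne_zero, if_false, mem_Icc, mem_Ioc] at *
      simp only [Fin.append_left, Fin.append_right]
      linarith
    · exfalso
      have : k + i.1 < j.1 := hij
      omega
    · simp only [Fin.append_right]
      exact h.2 (by simpa using hij)

/-- The volume of the part of a cell in the standard chamber is a coefficient of `exp X exp Y`. -/
lemma cellMeas_strictMono {n : ℕ} (v : Fin n → Fin 2) :
    (cellMeas v).real {t | StrictMono t} =
      wordCoeff (expVar (0 : Fin 2) * expVar 1) (FreeMonoid.ofList (List.ofFn v)) := by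
  rw [wordCoeff_expVar_mul_expVar]
  by_cases h : ∃ k ≤ n, v = splitWord n k
  · obtain ⟨k, hk, rfl⟩ := h
    rw [Finset.sum_eq_single k, if_pos rfl]
    · obtain ⟨m, rfl⟩ := Nat.exists_eq_add_of_le hk
      rw [cellMeas_strictMono_splitWord, Nat.add_sub_cancel_left]
    · intro l hl hne
      rw [if_neg]
      intro h
      exact hne (splitWord_injective hk (by simpa [Nat.lt_succ_iff] using hl) h).symm
    · intro h
      exact absurd (Finset.mem_range.2 (by omega)) h
  · rw [Finset.sum_eq_zero]
    -- An increasing point in the cell forces all letters 0 to precede all letters 1, contradicting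
    -- the choice of v; the cut would be at the number of zeros.
    · have hz : ∀ᵐ t ∂(cellMeas v), t ∉ {t : Fin n → ℝ | StrictMono t} := by
        filter_upwards [ae_cellMeas v] with t ht hmono
        apply h
        have hlt : ∀ i j, v i = 1 → v j = 0 → j < i := by
          intro i j hi hj
          have h1 := ht.2 i
          have h2 := ht.2 j
          simp only [cell, hi, hj, one_ne_zero, if_true, if_false, mem_Icc, mem_Ioc] at h1 h2
          by_contra hij
          have := hmono.monotone (not_lt.1 hij)
          linarith
        refine ⟨(Finset.univ.filter fun i => v i = 0).card, ?_, ?_⟩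
        · exact (Finset.card_le_univ _).trans_eq (by simp)
        · ext1 i
          have hcard : ∀ i : Fin n, (Finset.univ.filter fun j : Fin n => j < i).card = i.1 := by
            intro i
            rw [Finset.filter_gt_eq_Iio]; simp
          rw [splitWord]
          by_cases hi : v i = 0
          · rw [hi, if_pos]
            rw [← Nat.succ_le_iff]
            calc i.1 + 1 = (Finset.univ.filter fun j : Fin n => j ≤ i).card := by
                  rw [Finset.filter_ge_eq_Iic]; simp
              _ ≤ _ := by
                  apply Finset.card_le_card
                  intro j hj
                  simp only [Finset.mem_filter, Finset.mem_univ, true_and] at hj ⊢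
                  by_contra hj0
                  exact absurd (hlt j i (Fin.eq_one_of_ne_zero _ hj0) hi) (not_lt.2 hj)
          · rw [Fin.eq_one_of_ne_zero _ hi, if_neg]
            rw [not_lt]
            calc _ ≤ (Finset.univ.filter fun j : Fin n => j < i).card := by
                  apply Finset.card_le_card
                  intro j hj
                  simp only [Finset.mem_filter, Finset.mem_univ, true_and] at hj ⊢
                  exact hlt i j (Fin.eq_one_of_ne_zero _ hi) hj
              _ = i.1 := hcard i
      rw [measureReal_def, measure_eq_zero_iff_ae_notMem.2 hz, ENNReal.toReal_zero]
    · intro k hk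
      rw [if_neg]
      intro hv
      exact h ⟨k, by simpa [Nat.lt_succ_iff] using hk, hv⟩

lemma constantCoeff_expVar_mul_expVar :
    PowerSeries.constantCoeff (expVar (0 : Fin 2) * expVar 1) = 1 := by
  rw [map_mul, constantCoeff_expVar, constantCoeff_expVar, one_mul]

lemma homog_expVar_mul_expVar : Homog (expVar (0 : Fin 2) * expVar 1) :=
  (homog_expVar _).mul (homog_expVar _)

lemma integral_incInd {n : ℕ} (v : Fin n → Fin 2) :
    ∫ t, incInd (List.ofFn t) ∂(cellMeas v) =
      wordCoeff (expVar (0 : Fin 2) * expVar 1 - 1) (FreeMonoid.ofList (List.ofFn v)) := by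
  cases n with
  | zero =>
    simp only [List.ofFn_zero, incInd_nil, integral_zero]
    rw [wordCoeff_sub_one_nil constantCoeff_expVar_mul_expVar]
  | succ n =>
    simp_rw [incInd_ofFn]
    rw [integral_indicator_one measurableSet_strictMono, cellMeas_strictMono, wordCoeff_sub,
      wordCoeff_one, if_neg (by simp), sub_zero]

lemma integrable_of_bounded {n : ℕ} (v : Fin n → Fin 2) {f : (Fin n → ℝ) → ℝ} (hf : Measurable f)
    (hb : ∀ t, |f t| ≤ 1) : Integrable f (cellMeas v) :=
  Integrable.of_bound hf.aestronglyMeasurable 1 (Filter.Eventually.of_forall hb)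

lemma integrable_ascWeight {lam : ℝ} (hlam : lam ∈ Icc (0 : ℝ) 1) {n : ℕ} (v : Fin n → Fin 2) :
    Integrable (fun t => ascWeight lam (List.ofFn t)) (cellMeas v) :=
  integrable_of_bounded v (measurable_ascWeight_ofFn lam n) fun _ => abs_ascWeight_le hlam _

lemma abs_incInd_le {β : Type*} [LinearOrder β] (l : List β) : |incInd l| ≤ 1 := by
  unfold incInd; split_ifs <;> simp

/-- The integrals of the weights over cells are the coefficients of the resolvent of
`exp X exp Y`. -/
lemma integral_ascWeight {lam : ℝ} (hlam : lam ∈ Icc (0 : ℝ) 1) :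
    ∀ (n : ℕ) (v : Fin n → Fin 2), ∫ t, ascWeight lam (List.ofFn t) ∂(cellMeas v) =
      wordCoeff (cayleyResolvent (expVar (0 : Fin 2) * expVar 1) lam)
        (FreeMonoid.ofList (List.ofFn v)) := by
  intro n
  induction n using Nat.strong_induction_on with
  | _ n ih =>
  intro v
  rw [wordCoeff_cayleyResolvent homog_expVar_mul_expVar constantCoeff_expVar_mul_expVar]
  have hmeas : ∀ k ∈ Finset.range (n + 1), Measurable fun t : Fin n → ℝ =>
      incInd ((List.ofFn t).take k) * ascWeight lam ((List.ofFn t).drop k) := by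
    intro k hk
    obtain ⟨m, rfl⟩ := Nat.exists_eq_add_of_le (Finset.mem_range_succ_iff.1 hk)
    have e : ∀ t : Fin (k + m) → ℝ, List.ofFn t =
        List.ofFn (fun i => t (Fin.castAdd m i)) ++ List.ofFn (fun i => t (Fin.natAdd k i)) := by
      intro t
      rw [← List.ofFn_fin_append]
      congr 1
      ext i
      refine Fin.addCases (fun i => ?_) (fun i => ?_) i <;> simp
    have e1 : (fun t : Fin (k + m) → ℝ =>
        incInd ((List.ofFn t).take k) * ascWeight lam ((List.ofFn t).drop k)) = fun t =>
        incInd (List.ofFn (fun i => t (Fin.castAdd m i))) *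
          ascWeight lam (List.ofFn (fun i => t (Fin.natAdd k i))) := by
      ext t
      rw [e t, List.take_left' (by simp), List.drop_left' (by simp)]
    rw [e1]
    refine Measurable.mul ((measurable_incInd_ofFn k).comp ?_)
      ((measurable_ascWeight_ofFn lam m).comp ?_) <;> fun_prop
  have hint : ∀ k ∈ Finset.range (n + 1), Integrable (fun t : Fin n → ℝ =>
      incInd ((List.ofFn t).take k) * ascWeight lam ((List.ofFn t).drop k)) (cellMeas v) := by
    intro k hk
    refine integrable_of_bounded v (hmeas k hk) fun t => ?_
    rw [abs_mul]
    exact mul_le_one₀ (abs_incInd_le _) (abs_nonneg _) (abs_ascWeight_le hlam _)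
  have hrec : (fun t : Fin n → ℝ => ascWeight lam (List.ofFn t)) = fun t =>
      incInd (List.ofFn t) + (lam - 1) * ∑ k ∈ Finset.range (n + 1),
        incInd ((List.ofFn t).take k) * ascWeight lam ((List.ofFn t).drop k) := by
    ext t
    rw [ascWeight_rec, List.length_ofFn]
  rw [hrec, integral_add, integral_incInd, integral_const_mul, integral_finsetSum _ hint,
    List.length_ofFn]
  · congr 2
    refine Finset.sum_congr rfl fun k hk => ?_
    obtain ⟨m, rfl⟩ := Nat.exists_eq_add_of_le (Finset.mem_range_succ_iff.1 hk)
    rw [integral_take_mul_drop measurable_incInd_ofFn (measurable_ascWeight_ofFn lam),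
      integral_incInd]
    have e : List.ofFn v =
        List.ofFn (fun i => v (Fin.castAdd m i)) ++ List.ofFn (fun i => v (Fin.natAdd k i)) := by
      rw [← List.ofFn_fin_append]
      congr 1
      ext1 i
      refine Fin.addCases (fun i => ?_) (fun i => ?_) i <;> simp
    rw [e, List.take_left' (by simp), List.drop_left' (by simp)]
    -- For k = 0 the suffix is the whole word and the induction hypothesis is unavailable, but E - 1
    -- vanishes on the empty word.
    rcases Nat.eq_zero_or_pos k with rfl | hk0
    · rw [List.ofFn_zero, wordCoeff_sub_one_nil constantCoeff_expVar_mul_expVar, zero_mul, zero_mul]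
    · rw [ih m (by omega)]
  · exact integrable_of_bounded v (measurable_incInd_ofFn n) fun t => abs_incInd_le _
  · exact (integrable_finsetSum _ hint).const_mul _

end Cells

/-! ### The resolvent series and the Magnus expansion of the concatenation -/

section Terms

/-- Injectivity is needed because `ascWeight` treats a tie as a descent while `des` does not count
it. Length at least 1 is needed because `ascWeight` is 0 on the empty list, where the left side is
1. -/
lemma pow_asc_mul_pow_des (lam : ℝ) {n : ℕ} {t : Fin (n + 1) → ℝ} (ht : Function.Injective t) :
    lam ^ asc t * (lam - 1) ^ des t = ascWeight lam (List.ofFn t) := by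
  have ha : asc t = (Finset.univ.filter fun i : Fin n => t i.castSucc < t i.succ).card := by
    rw [← Set.ncard_coe_finset, asc,
      ← Set.ncard_image_of_injective _ (Fin.castSucc_injective n)]
    congr 1
    ext i
    simp only [mem_ofPred_eq, mem_image, Finset.coe_filter, Finset.mem_univ, true_and]
    constructor
    · rintro ⟨hi, h⟩
      exact ⟨⟨i.1, by omega⟩, h, rfl⟩
    · rintro ⟨j, h, rfl⟩
      exact ⟨by simp, h⟩
  have hd : des t = (Finset.univ.filter fun i : Fin n => ¬ t i.castSucc < t i.succ).card := by
    rw [← Set.ncard_coe_finset, des,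
      ← Set.ncard_image_of_injective _ (Fin.castSucc_injective n)]
    congr 1
    ext i
    simp only [mem_ofPred_eq, mem_image, Finset.coe_filter, Finset.mem_univ, true_and]
    constructor
    · rintro ⟨hi, h⟩
      exact ⟨⟨i.1, by omega⟩, not_lt.2 h.le, rfl⟩
    · rintro ⟨j, h, rfl⟩
      refine ⟨by simp, lt_of_le_of_ne (not_lt.1 h) fun h => ?_⟩
      have := ht h
      exact absurd this (ne_of_gt Fin.castSucc_lt_succ)
  rw [ascWeight_ofFn, ha, hd]
  have : ∀ i : Fin n, ((if t i.castSucc < t i.succ then 1 else 0) + (lam - 1)) =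
      if t i.castSucc < t i.succ then lam else lam - 1 := by
    intro i; split_ifs <;> ring
  simp_rw [this]
  rw [Finset.prod_ite, Finset.prod_const, Finset.prod_const]

/-- The pair `X, Y` as a function of the letter. -/
def letter {A : Type*} (X Y : A) (c : Fin 2) : A := if c = 0 then X else Y

lemma concatDensity_of_mem_cell {A : Type*} (X Y : A) {c : Fin 2} {t : ℝ} (ht : t ∈ cell c) :
    concatDensity X Y t = letter X Y c := by
  unfold cell at ht
  unfold concatDensity letter
  split_ifs at ht with h
  · rw [if_pos ht.2, if_pos h]
  · rw [if_neg (not_le.2 ht.1), if_neg h]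

lemma ae_concatDensity {A : Type*} (X Y : A) {n : ℕ} (v : Fin n → Fin 2) :
    ∀ᵐ t ∂(cellMeas v), ∀ i, concatDensity X Y (t i) = letter X Y (v i) := by
  filter_upwards [ae_cellMeas v] with t ht i
  exact concatDensity_of_mem_cell X Y (ht.2 i)

variable {A : Type*} [NormedRing A] [NormedAlgebra ℝ A]

/-- A function on the cube which on cells is, up to a bounded scalar factor, constant. -/
lemma integral_cube_smul [CompleteSpace A] {n : ℕ} {w : (Fin n → ℝ) → ℝ}
    (hw : ∀ v : Fin n → Fin 2, Integrable w (cellMeas v)) (Φ : (Fin n → A) → A) (X Y : A) :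
    IntegrableOn (fun t => w t • Φ fun i => concatDensity X Y (t i))
      {t : Fin n → ℝ | ∀ i, t i ∈ Icc (0 : ℝ) 2} ∧
    (∫ t in {t : Fin n → ℝ | ∀ i, t i ∈ Icc (0 : ℝ) 2},
        w t • Φ fun i => concatDensity X Y (t i)) =
      ∑ v : Fin n → Fin 2, (∫ t, w t ∂(cellMeas v)) • Φ fun i => letter X Y (v i) := by
  have hae : ∀ v : Fin n → Fin 2, (fun t => w t • Φ fun i => concatDensity X Y (t i))
      =ᵐ[cellMeas v] fun t => w t • Φ fun i => letter X Y (v i) := by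
    intro v
    filter_upwards [ae_concatDensity X Y v] with t ht
    simp_rw [ht]
  have hint : ∀ v : Fin n → Fin 2,
      Integrable (fun t => w t • Φ fun i => concatDensity X Y (t i)) (cellMeas v) := fun v =>
    ((hw v).smul_const _).congr (hae v).symm
  constructor
  · rw [IntegrableOn, restrict_cube_eq_sum]
    exact integrable_finsetSum_measure.2 fun v _ => hint v
  · rw [restrict_cube_eq_sum, integral_finsetSum_measure fun v _ => hint v]
    refine Finset.sum_congr rfl fun v _ => ?_
    rw [integral_congr_ae (hae v), integral_smul_const]

lemma resolventTerm_eq_integral (lam : ℝ) (X Y : A) (n : ℕ) :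
    resolventTerm lam (Icc 0 2) (concatDensity X Y) (n + 1) =
      ∫ t in {t : Fin (n + 1) → ℝ | ∀ i, t i ∈ Icc (0 : ℝ) 2},
        ascWeight lam (List.ofFn t) • (List.ofFn fun i => concatDensity X Y (t i)).prod := by
  refine integral_congr_ae (ae_restrict_of_ae ?_)
  filter_upwards [ae_injective (n + 1)] with t ht
  rw [pow_asc_mul_pow_des lam ht]

/-- The density is constant on each cell, so a cell contributes its monomial in X and Y times the
integrated weight. -/
lemma resolventTerm_eq_sum [CompleteSpace A] {lam : ℝ} (hlam : lam ∈ Icc (0 : ℝ) 1) (X Y : A)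
    (n : ℕ) : resolventTerm lam (Icc 0 2) (concatDensity X Y) (n + 1) =
      ∑ v : Fin (n + 1) → Fin 2,
        wordCoeff (cayleyResolvent (expVar (0 : Fin 2) * expVar 1) lam)
          (FreeMonoid.ofList (List.ofFn v)) • (List.ofFn fun i => letter X Y (v i)).prod := by
  rw [resolventTerm_eq_integral, (integral_cube_smul (fun v => integrable_ascWeight hlam v)
    (fun x => (List.ofFn x).prod) X Y).2]
  simp_rw [integral_ascWeight hlam]

/-- The Magnus expansion of the concatenation is the Baker–Campbell–Hausdorff series. -/
lemma magnusTerm_eq_bchTerm [CompleteSpace A] (X Y : A) (n : ℕ) :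
    magnusTerm (Icc 0 2) (concatDensity X Y) n = bchTerm X Y n := by
  -- The chamber enters as an indicator weight on the full cube, so the same decomposition into
  -- cells applies.
  have h := integral_cube_smul (w := {t : Fin n → ℝ | StrictMono t}.indicator 1)
    (fun v => (integrable_const (1 : ℝ)).indicator measurableSet_strictMono)
    (magnusCommutator n) X Y
  have h1 : magnusTerm (Icc 0 2) (concatDensity X Y) n =
      ∫ t in {t : Fin n → ℝ | ∀ i, t i ∈ Icc (0 : ℝ) 2},
        {t : Fin n → ℝ | StrictMono t}.indicator (1 : (Fin n → ℝ) → ℝ) t •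
          magnusCommutator n fun i => concatDensity X Y (t i) := by
    have e : (fun t : Fin n → ℝ => {t : Fin n → ℝ | StrictMono t}.indicator
        (1 : (Fin n → ℝ) → ℝ) t • magnusCommutator n fun i => concatDensity X Y (t i)) =
        {t : Fin n → ℝ | StrictMono t}.indicator
          fun t => magnusCommutator n fun i => concatDensity X Y (t i) := by
      ext t
      by_cases ht : t ∈ {t : Fin n → ℝ | StrictMono t}
      · rw [indicator_of_mem ht, indicator_of_mem ht, Pi.one_apply, one_smul]
      · rw [indicator_of_notMem ht, indicator_of_notMem ht, zero_smul]
    rw [e, setIntegral_indicator measurableSet_strictMono, magnusTerm,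
      setIntegral_congr_set (monotone_ae_eq_strictMono _)]
    rfl
  rw [h1, h.2]
  simp_rw [integral_indicator_one measurableSet_strictMono, cellMeas_strictMono,
    wordCoeff_expVar_mul_expVar, Finset.sum_smul]
  rw [Finset.sum_comm, bchTerm]
  refine Finset.sum_congr rfl fun k _ => ?_
  rw [Finset.sum_eq_single (splitWord n k)]
  · rw [if_pos rfl]
    congr 2
    ext i
    by_cases hi : i.1 < k <;> simp [splitWord, letter, hi]
  · intro v _ hv
    rw [if_neg hv, zero_smul]
  · simp

/-- The resolvent terms as combinations of integrals over the standard chamber. -/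
lemma resolventTerm_eq_sum_perm [CompleteSpace A] {lam : ℝ} (hlam : lam ∈ Icc (0 : ℝ) 1) (X Y : A)
    (n : ℕ) : resolventTerm lam (Icc 0 2) (concatDensity X Y) (n + 1) =
      ∑ σ : Equiv.Perm (Fin (n + 1)), ascWeight lam (List.ofFn σ) •
        ∫ t in {t : Fin (n + 1) → ℝ | (∀ i, t i ∈ Icc (0 : ℝ) 2) ∧ Monotone t},
          (List.ofFn fun i => concatDensity X Y (t (σ i))).prod := by
  rw [resolventTerm_eq_integral, setIntegral_cube_eq_sum_perm measurableSet_Icc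
    (integral_cube_smul (fun v => integrable_ascWeight hlam v)
      (fun x => (List.ofFn x).prod) X Y).1]
  refine Finset.sum_congr rfl fun σ _ => ?_
  rw [setIntegral_congr_set (monotone_ae_eq_strictMono _),
    setIntegral_congr_set (monotone_ae_eq_strictMono _), ← integral_smul]
  refine setIntegral_congr_fun
    ((measurableSet_cube measurableSet_Icc).inter measurableSet_strictMono) fun t ht => ?_
  -- On the open chamber t is strictly increasing, so the weight of t ∘ σ depends on σ alone and
  -- leaves the integral.
  have hmap : List.ofFn (t ∘ σ) = (List.ofFn σ).map t := List.map_ofFn.symm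
  simp only [hmap, ascWeight_map ht.2, Function.comp]

lemma continuousOn_resolventTerm [CompleteSpace A] (X Y : A) (n : ℕ) :
    ContinuousOn (fun lam => resolventTerm lam (Icc 0 2) (concatDensity X Y) (n + 1))
      (Icc 0 1) := by
  refine ContinuousOn.congr ?_ fun lam hlam => resolventTerm_eq_sum_perm hlam X Y n
  refine Continuous.continuousOn (continuous_finsetSum _ fun σ _ => ?_)
  exact (continuous_ascWeight _).smul continuous_const

/-- Integrating the resolvent terms yields the Magnus terms. -/
lemma integral_resolventTerm [CompleteSpace A] (X Y : A) (n : ℕ) :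
    ∫ lam in (0 : ℝ)..1, resolventTerm lam (Icc 0 2) (concatDensity X Y) (n + 1) =
      bchTerm X Y (n + 1) := by
  rw [← magnusTerm_eq_bchTerm, magnusTerm]
  have h1 : ∫ lam in (0 : ℝ)..1, resolventTerm lam (Icc 0 2) (concatDensity X Y) (n + 1) =
      ∫ lam in (0 : ℝ)..1, ∑ σ : Equiv.Perm (Fin (n + 1)), ascWeight lam (List.ofFn σ) •
        ∫ t in {t : Fin (n + 1) → ℝ | (∀ i, t i ∈ Icc (0 : ℝ) 2) ∧ Monotone t},
          (List.ofFn fun i => concatDensity X Y (t (σ i))).prod := by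
    refine intervalIntegral.integral_congr fun lam hlam => ?_
    rw [uIcc_of_le zero_le_one] at hlam
    exact resolventTerm_eq_sum_perm hlam X Y n
  rw [h1, intervalIntegral.integral_finsetSum]
  · simp_rw [magnusCommutator_eq, intervalIntegral.integral_smul_const]
    rw [integral_finsetSum]
    · refine Finset.sum_congr rfl fun σ _ => ?_
      rw [integral_smul]
    · intro σ _
      have h := (integral_cube_smul (n := n + 1) (w := fun _ => 1)
        (fun v => integrable_const _) (fun x => (List.ofFn fun i => x (σ i)).prod) X Y).1
      simp only [one_smul] at h
      exact (h.mono_set (fun t ht => ht.1 :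
        {t : Fin (n + 1) → ℝ | (∀ i, t i ∈ Icc (0 : ℝ) 2) ∧ Monotone t} ⊆ _)).smul
        (∫ lam in (0 : ℝ)..1, ascWeight lam (List.ofFn σ))
  · intro σ _
    exact ((continuous_ascWeight _).smul continuous_const).intervalIntegrable _ _

lemma enorm_mul_le_mul {B : Type*} [NormedRing B] (a b : B) : ‖a * b‖ₑ ≤ ‖a‖ₑ * ‖b‖ₑ := by
  simp only [enorm_eq_nnnorm]
  exact_mod_cast nnnorm_mul_le a b

/-- The empty word is excluded because the norm of 1 is not assumed to be at most 1. -/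
lemma enorm_prod_letter_le {A : Type*} [NormedRing A] (X Y : A) : ∀ l : List (Fin 2), l ≠ [] →
    ‖(l.map (letter X Y)).prod‖ₑ ≤ ‖X‖ₑ ^ l.count 0 * ‖Y‖ₑ ^ l.count 1
  | [], h => absurd rfl h
  | [a], _ => by
    fin_cases a <;> simp [letter]
  | a :: b :: l, _ => by
    have ih := enorm_prod_letter_le X Y (b :: l) (by simp)
    rw [List.map_cons, List.prod_cons]
    refine (enorm_mul_le_mul _ _).trans ?_
    refine (mul_le_mul' le_rfl ih).trans ?_
    rw [List.count_cons (a := 0) (b := a), List.count_cons (a := 1) (b := a)]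
    fin_cases a
    · simp only [letter, Fin.zero_eta, Fin.isValue, if_true, beq_self_eq_true]
      rw [pow_succ', ← mul_assoc]
      simp
    · simp only [letter, Fin.mk_one, Fin.isValue, one_ne_zero, if_false, beq_self_eq_true, if_true]
      rw [pow_succ', mul_left_comm]
      simp

lemma tsum_freeMonoid {M : Type*} [AddCommMonoid M] [TopologicalSpace M]
    (f : FreeMonoid (Fin 2) → M) :
    ∑' w, f w = ∑' p : Σ n, Fin n → Fin 2, f (FreeMonoid.ofList (List.ofFn p.2)) :=
  (Equiv.tsum_eq (List.equivSigmaTuple (α := Fin 2)).symm f).symm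

lemma tsum_enorm_resolventTerm_le [CompleteSpace A] {lam : ℝ} (hlam : lam ∈ Icc (0 : ℝ) 1)
    (X Y : A) :
    ∑' n : ℕ, ‖resolventTerm lam (Icc 0 2) (concatDensity X Y) (n + 1)‖ₑ ≤
      Gam lam ‖X‖ₑ ‖Y‖ₑ := by
  rw [Gam, tsum_freeMonoid, ENNReal.tsum_sigma']
  refine le_trans (ENNReal.tsum_le_tsum fun n => ?_)
    (ENNReal.tsum_comp_le_tsum_of_injective (add_left_injective 1) _)
  rw [resolventTerm_eq_sum hlam, tsum_fintype]
  refine (enorm_sum_le _ _).trans (Finset.sum_le_sum fun v _ => ?_)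
  rw [enorm_smul, Real.enorm_eq_ofReal_abs, FreeMonoid.toList_ofList]
  refine mul_le_mul' le_rfl ?_
  have : (List.ofFn fun i => letter X Y (v i)) = (List.ofFn v).map (letter X Y) := by
    rw [List.map_ofFn]; rfl
  rw [this]
  exact enorm_prod_letter_le X Y _ (by simp)

end Terms

/-! ### Weighted norms of formal series -/

section WeightedNorm

/-- Splittings of lists. -/
def splitEquiv (α : Type*) : (Σ l : List α, Fin (l.length + 1)) ≃ List α × List α where
  toFun p := (p.1.take p.2, p.1.drop p.2)
  invFun q := ⟨q.1 ++ q.2, ⟨q.1.length, by rw [List.length_append]; omega⟩⟩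
  left_inv := by
    rintro ⟨l, k, hk⟩
    have h : l.take k ++ l.drop k = l := List.take_append_drop k l
    refine Sigma.ext h ?_
    rw [Fin.heq_ext_iff (by simp only [h])]
    simp only [List.length_take]
    omega
  right_inv := by
    rintro ⟨u, v⟩
    simp

/-- The weight of a word. -/
def wordWt (x y : ℝ≥0∞) (l : List (Fin 2)) : ℝ≥0∞ := x ^ l.count 0 * y ^ l.count 1

lemma wordWt_append (x y : ℝ≥0∞) (u v : List (Fin 2)) :
    wordWt x y (u ++ v) = wordWt x y u * wordWt x y v := by
  simp only [wordWt, List.count_append, pow_add]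
  ring

/-- The weighted `ℓ¹` norm of the coefficients of the words of length at most `N`. -/
def wnorm (x y : ℝ≥0∞) (N : ℕ∞) (F : NCSeries (Fin 2)) : ℝ≥0∞ :=
  ∑' l : List (Fin 2), if (l.length : ℕ∞) ≤ N then
    ENNReal.ofReal |wordCoeff F (FreeMonoid.ofList l)| * wordWt x y l else 0

lemma Gam_eq_wnorm (lam : ℝ) (x y : ℝ≥0∞) :
    Gam lam x y = wnorm x y ⊤ (cayleyResolvent (expVar (0 : Fin 2) * expVar 1) lam) := by
  simp only [wnorm, le_top, if_true]
  rfl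

/-- Pairs of words correspond to words with a cut, and weights multiply under concatenation.
Suffixes of words of length at most N are no longer, so the truncation passes to G. -/
lemma wnorm_mul_le (x y : ℝ≥0∞) (N : ℕ∞) {F : NCSeries (Fin 2)} (hF : Homog F)
    (G : NCSeries (Fin 2)) : wnorm x y N (F * G) ≤ wnorm x y ⊤ F * wnorm x y N G := by
  let f : List (Fin 2) → ℝ≥0∞ := fun l =>
    ENNReal.ofReal |wordCoeff F (FreeMonoid.ofList l)| * wordWt x y l
  let g : List (Fin 2) → ℝ≥0∞ := fun l => if (l.length : ℕ∞) ≤ N then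
    ENNReal.ofReal |wordCoeff G (FreeMonoid.ofList l)| * wordWt x y l else 0
  have h1 : wnorm x y ⊤ F * wnorm x y N G =
      ∑' l : List (Fin 2), ∑ k ∈ Finset.range (l.length + 1), f (l.take k) * g (l.drop k) := by
    have e : wnorm x y ⊤ F = ∑' l, f l := by simp only [wnorm, le_top, if_true, f]
    have e2 : wnorm x y N G = ∑' l, g l := rfl
    rw [e, e2, ← ENNReal.tsum_mul_right]
    simp_rw [← ENNReal.tsum_mul_left]
    rw [← ENNReal.tsum_prod (f := fun u v => f u * g v), ← (splitEquiv (Fin 2)).tsum_eq,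
      ENNReal.tsum_sigma']
    refine tsum_congr fun l => ?_
    rw [tsum_fintype, Finset.sum_range]
    rfl
  rw [h1]
  refine ENNReal.tsum_le_tsum fun l => ?_
  split_ifs with hl
  · rw [wordCoeff_mul hF]
    calc _ ≤ ENNReal.ofReal (∑ k ∈ Finset.range (l.length + 1),
          |wordCoeff F (FreeMonoid.ofList (l.take k))| *
            |wordCoeff G (FreeMonoid.ofList (l.drop k))|) * wordWt x y l := by
          gcongr
          refine (Finset.abs_sum_le_sum_abs _ _).trans_eq ?_
          simp_rw [abs_mul]
      _ = _ := by
          rw [ENNReal.ofReal_sum_of_nonneg (fun _ _ => by positivity), Finset.sum_mul]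
          refine Finset.sum_congr rfl fun k _ => ?_
          have hd : ((l.drop k).length : ℕ∞) ≤ N := by
            refine le_trans ?_ hl
            exact_mod_cast (List.drop_sublist k l).length_le
          simp only [f, g, if_pos hd]
          rw [ENNReal.ofReal_mul (abs_nonneg _)]
          have hw : wordWt x y l = wordWt x y (l.take k) * wordWt x y (l.drop k) := by
            rw [← wordWt_append, List.take_append_drop]
          rw [hw]
          ring
  · exact zero_le

lemma wnorm_add_le (x y : ℝ≥0∞) (N : ℕ∞) (F G : NCSeries (Fin 2)) :
    wnorm x y N (F + G) ≤ wnorm x y N F + wnorm x y N G := by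
  rw [wnorm, wnorm, wnorm, ← ENNReal.tsum_add]
  refine ENNReal.tsum_le_tsum fun l => ?_
  split_ifs
  · rw [wordCoeff_add, ← add_mul, ← ENNReal.ofReal_add (abs_nonneg _) (abs_nonneg _)]
    gcongr
    exact abs_add_le _ _
  · simp

lemma wnorm_smul (x y : ℝ≥0∞) (N : ℕ∞) (c : ℝ) (F : NCSeries (Fin 2)) :
    wnorm x y N (c • F) = ENNReal.ofReal |c| * wnorm x y N F := by
  rw [wnorm, wnorm, ← ENNReal.tsum_mul_left]
  refine tsum_congr fun l => ?_
  split_ifs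
  · rw [wordCoeff_smul, abs_mul, ENNReal.ofReal_mul (abs_nonneg _), mul_assoc]
  · simp

lemma wnorm_one_le (x y : ℝ≥0∞) (N : ℕ∞) : wnorm x y N 1 ≤ 1 := by
  rw [wnorm, tsum_eq_single ([] : List (Fin 2))]
  · rw [wordCoeff_one]; simp [wordWt]
  · intro l hl
    simp [wordCoeff_one, hl]

/-- Only finitely many words are that short. This finiteness is the purpose of the truncation: it
allows solving inequalities with the unknown on both sides. -/
lemma wnorm_ne_top {x y : ℝ≥0∞} (hx : x ≠ ⊤) (hy : y ≠ ⊤) (N : ℕ) (F : NCSeries (Fin 2)) :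
    wnorm x y N F ≠ ⊤ := by
  have hfin : {l : List (Fin 2) | l.length ≤ N}.Finite := List.finite_length_le _ _
  rw [wnorm, tsum_eq_sum (s := hfin.toFinset)]
  · refine ENNReal.sum_ne_top.2 fun l _ => ?_
    split_ifs
    · exact ENNReal.mul_ne_top ENNReal.ofReal_ne_top
        (ENNReal.mul_ne_top (ENNReal.pow_ne_top hx) (ENNReal.pow_ne_top hy))
    · simp
  · intro l hl
    rw [if_neg]
    intro h
    apply hl
    simpa using h

lemma wnorm_top_le {x y : ℝ≥0∞} {F : NCSeries (Fin 2)} {B : ℝ≥0∞}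
    (h : ∀ N : ℕ, wnorm x y N F ≤ B) : wnorm x y ⊤ F ≤ B := by
  rw [wnorm, ENNReal.tsum_eq_iSup_sum]
  refine iSup_le fun s => ?_
  refine le_trans ?_ (h (s.sup List.length))
  refine le_trans (Finset.sum_le_sum fun l hl => ?_) (ENNReal.sum_le_tsum s)
  rw [if_pos le_top, if_pos]
  exact_mod_cast Finset.le_sup (f := List.length) hl

end WeightedNorm

/-! ### One variable -/

section OneVariable

/-- Substitution of a variable into a commutative power series. -/
def substVar {α : Type*} (a : α) : PowerSeries ℝ →ₐ[ℝ] NCSeries α where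
  toFun f := PowerSeries.mk fun n => MonoidAlgebra.single (FreeMonoid.of a ^ n)
    (PowerSeries.coeff n f)
  map_one' := by
    ext1 n
    rw [PowerSeries.coeff_mk, PowerSeries.coeff_one, PowerSeries.coeff_one]
    split_ifs with h
    · subst h; rfl
    · simp
  map_mul' f g := by
    ext1 n
    rw [PowerSeries.coeff_mk, PowerSeries.coeff_mul, PowerSeries.coeff_mul,
      ← MonoidAlgebra.singleAddHom_apply, map_sum]
    refine Finset.sum_congr rfl fun p hp => ?_
    rw [MonoidAlgebra.singleAddHom_apply, PowerSeries.coeff_mk, PowerSeries.coeff_mk,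
      MonoidAlgebra.single_mul_single, ← pow_add,
      Finset.HasAntidiagonal.mem_antidiagonal.1 hp]
  map_zero' := by ext1 n; simp
  map_add' f g := by ext1 n; simp [MonoidAlgebra.single_add]
  commutes' r := by
    ext1 n
    rw [Algebra.algebraMap_eq_smul_one, Algebra.algebraMap_eq_smul_one, PowerSeries.coeff_mk,
      coeff_real_smul, PowerSeries.coeff_smul, PowerSeries.coeff_one, PowerSeries.coeff_one]
    split_ifs with h
    · subst h
      rw [MonoidAlgebra.one_def]; simp
    · simp

lemma substVar_exp {α : Type*} (a : α) : substVar a (PowerSeries.exp ℝ) = expVar a := by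
  ext1 n
  simp [substVar, expVar, PowerSeries.coeff_exp]

lemma constantCoeff_exp_real : PowerSeries.constantCoeff (PowerSeries.exp ℝ) = 1 := by simp

lemma cayleyResolvent_expVar {α : Type*} (a : α) (lam : ℝ) :
    cayleyResolvent (expVar a) lam = substVar a (cayleyResolvent (PowerSeries.exp ℝ) lam) := by
  rw [map_cayleyResolvent _ (isUnit_resolventDenom constantCoeff_exp_real lam), substVar_exp]

lemma wordCoeff_substVar {α : Type*} [DecidableEq α] (a : α) (f : PowerSeries ℝ) (l : List α) :
    wordCoeff (substVar a f) (FreeMonoid.ofList l) =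
      if l = List.replicate l.length a then PowerSeries.coeff l.length f else 0 := by
  have hlen : (FreeMonoid.ofList l).length = l.length := rfl
  classical
  have : PowerSeries.coeff l.length (substVar a f) =
      MonoidAlgebra.single (FreeMonoid.of a ^ l.length) (PowerSeries.coeff l.length f) := by
    simp [substVar]
  rw [wordCoeff, hlen, this, MonoidAlgebra.coeff_single, Finsupp.single_apply]
  congr 1
  rw [← FreeMonoid.toList.apply_eq_iff_eq, toList_of_pow, FreeMonoid.toList_ofList]
  exact propext eq_comm

lemma wnorm_substVar (x y : ℝ≥0∞) (c : Fin 2) (f : PowerSeries ℝ) :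
    wnorm x y ⊤ (substVar c f) =
      ∑' n : ℕ, ENNReal.ofReal |PowerSeries.coeff n f| * (if c = 0 then x else y) ^ n := by
  simp only [wnorm, le_top, if_true]
  have hinj : Function.Injective fun n : ℕ => List.replicate n c := fun m n h => by
    simpa using congrArg List.length h
  rw [← hinj.tsum_eq]
  · refine tsum_congr fun n => ?_
    rw [wordCoeff_substVar, List.length_replicate, if_pos rfl, wordWt, List.count_replicate,
      List.count_replicate]
    fin_cases c <;> simp
  · intro l hl
    rw [Function.mem_support, wordCoeff_substVar] at hl
    by_cases h : l = List.replicate l.length c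
    · exact ⟨l.length, h.symm⟩
    · simp [h] at hl

/-- Inserting each inequality into the other and adding gives (1 - lam(1 - lam)pq)(u + v) ≤ p + q +
pq. The last step needs u and v finite to subtract. -/
lemma frac_bound {lam : ℝ} (hlam : lam ∈ Icc (0 : ℝ) 1) {p q u v : ℝ≥0∞}
    (hu : u ≠ ⊤) (hv : v ≠ ⊤) (h1 : u ≤ p * (1 + ENNReal.ofReal lam * v))
    (h2 : v ≤ q * (1 + ENNReal.ofReal (1 - lam) * u)) : u + v ≤ frac lam p q := by
  obtain ⟨h0, h1'⟩ := hlam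
  have hb : 0 ≤ lam * (1 - lam) := mul_nonneg h0 (by linarith)
  unfold frac
  by_cases hp : p = ⊤
  · subst hp
    rw [top_add, top_add, ENNReal.top_div_of_ne_top]
    · exact le_top
    · exact ENNReal.sub_ne_top ENNReal.one_ne_top
  by_cases hq : q = ⊤
  · subst hq
    rw [add_top, top_add, ENNReal.top_div_of_ne_top]
    · exact le_top
    · exact ENNReal.sub_ne_top ENNReal.one_ne_top
  lift p to NNReal using hp
  lift q to NNReal using hq
  lift u to NNReal using hu
  lift v to NNReal using hv
  obtain ⟨P, rfl⟩ : ∃ P : NNReal, P = p := ⟨_, rfl⟩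
  have h10 : 0 ≤ 1 - lam := by linarith
  have e1 : (u : ℝ) ≤ P * (1 + lam * v) := by
    rw [ENNReal.ofReal] at h1
    have h3 : u ≤ P * (1 + lam.toNNReal * v) := by exact_mod_cast h1
    have h4 := NNReal.coe_le_coe.2 h3
    push_cast at h4
    rwa [Real.coe_toNNReal _ h0] at h4
  have e2 : (v : ℝ) ≤ q * (1 + (1 - lam) * u) := by
    rw [ENNReal.ofReal] at h2
    have h3 : v ≤ q * (1 + (1 - lam).toNNReal * u) := by exact_mod_cast h2
    have h4 := NNReal.coe_le_coe.2 h3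
    push_cast at h4
    rwa [Real.coe_toNNReal _ h10] at h4
  have hP : (0 : ℝ) ≤ P := P.2
  have hQ : (0 : ℝ) ≤ q := q.2
  have eden : 1 - ENNReal.ofReal (lam * (1 - lam)) * ((P : ℝ≥0∞) * q) =
      ENNReal.ofReal (1 - lam * (1 - lam) * (P * q)) := by
    rw [ENNReal.ofReal_sub _ (by positivity), ENNReal.ofReal_one, ENNReal.ofReal_mul hb,
      ENNReal.ofReal_mul hP, ENNReal.ofReal_coe_nnreal, ENNReal.ofReal_coe_nnreal]
  have enum : (P : ℝ≥0∞) + q + P * q = ENNReal.ofReal (P + q + P * q) := by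
    rw [ENNReal.ofReal_add (by positivity) (by positivity), ENNReal.ofReal_add hP hQ,
      ENNReal.ofReal_mul hP, ENNReal.ofReal_coe_nnreal, ENNReal.ofReal_coe_nnreal]
  have euv : (u : ℝ≥0∞) + v = ENNReal.ofReal (u + v) := by
    rw [ENNReal.ofReal_add u.coe_nonneg v.coe_nonneg, ENNReal.ofReal_coe_nnreal, ENNReal.ofReal_coe_nnreal]
  rw [eden, enum, euv]
  -- A nonpositive denominator forces pq > 0, so the quotient is a positive number over 0, that is
  -- ∞.
  rcases le_or_gt (1 - lam * (1 - lam) * (P * q)) 0 with hd | hd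
  · rw [ENNReal.ofReal_of_nonpos hd, ENNReal.div_zero]
    · exact le_top
    · have : (0 : ℝ) < P * q := by
        by_contra hn
        have : (P : ℝ) * q = 0 := le_antisymm (not_lt.1 hn) (by positivity)
        rw [this] at hd
        norm_num at hd
      rw [Ne, ENNReal.ofReal_eq_zero, not_le]
      positivity
  · rw [ENNReal.le_div_iff_mul_le (Or.inl (by simpa using hd)) (Or.inl ENNReal.ofReal_ne_top),
      ← ENNReal.ofReal_mul (by positivity)]
    apply ENNReal.ofReal_le_ofReal
    have a1 : (P : ℝ) * (lam * v) ≤ P * (lam * (q * (1 + (1 - lam) * u))) := by gcongr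
    have a2 : (q : ℝ) * ((1 - lam) * u) ≤ q * ((1 - lam) * (P * (1 + lam * v))) := by
      have : 0 ≤ 1 - lam := by linarith
      gcongr
    nlinarith

/-- The comparison of the two-variable majorant with the one-variable majorants. -/
lemma Gam_le_frac {lam : ℝ} (hlam : lam ∈ Icc (0 : ℝ) 1) {x y : ℝ≥0∞} (hx : x ≠ ⊤) (hy : y ≠ ⊤) :
    Gam lam x y ≤ frac lam (rhoTilde lam x) (rhoTilde lam y) := by
  rw [Gam_eq_wnorm]
  obtain ⟨U, V, hUV, hU, hV⟩ := cayleyResolvent_mul_decomp (lam := lam)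
    (isUnit_resolventDenom (constantCoeff_expVar (0 : Fin 2)) lam)
    (isUnit_resolventDenom (constantCoeff_expVar (1 : Fin 2)) lam)
    (isUnit_resolventDenom constantCoeff_expVar_mul_expVar lam)
  have hp : ∀ c : Fin 2, wnorm x y ⊤ (cayleyResolvent (expVar c) lam) =
      rhoTilde lam (if c = 0 then x else y) := by
    intro c
    rw [cayleyResolvent_expVar, wnorm_substVar, rhoTilde]
  -- The bound is proved for words of length at most N, where the norms of U and V are finite, and
  -- does not depend on N.
  refine wnorm_top_le fun N => ?_
  rw [hUV]
  refine (wnorm_add_le _ _ _ _ _).trans ?_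
  refine frac_bound hlam (wnorm_ne_top hx hy N U) (wnorm_ne_top hx hy N V) ?_ ?_
  · nth_rw 1 [hU]
    refine (wnorm_mul_le x y N ((homog_expVar _).cayleyResolvent (constantCoeff_expVar _) _)
      _).trans ?_
    rw [hp, if_pos rfl]
    gcongr
    refine (wnorm_add_le _ _ _ _ _).trans ?_
    rw [wnorm_smul, abs_of_nonneg hlam.1]
    gcongr
    exact wnorm_one_le _ _ _
  · nth_rw 1 [hV]
    refine (wnorm_mul_le x y N ((homog_expVar _).cayleyResolvent (constantCoeff_expVar _) _)
      _).trans ?_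
    rw [hp, if_neg one_ne_zero]
    gcongr
    refine (wnorm_add_le _ _ _ _ _).trans ?_
    rw [wnorm_smul, abs_of_nonpos (by linarith [hlam.2]), neg_sub]
    gcongr
    exact wnorm_one_le _ _ _

lemma frac_mono (lam : ℝ) {p q p' q' : ℝ≥0∞} (hp : p ≤ p') (hq : q ≤ q') :
    frac lam p q ≤ frac lam p' q' := by
  unfold frac
  gcongr

end OneVariable

/-! ### The Riccati equation -/

section Riccati

/-- The solution of `S'' = (D / 4) S`, `S 0 = 0`, `S' 0 = 1`. -/
def sinD (D x : ℝ) : ℝ :=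
  if D < 0 then 2 / √(-D) * Real.sin (x / 2 * √(-D))
  else if D = 0 then x
  else 2 / √D * Real.sinh (x / 2 * √D)

/-- The derivative of `sinD D`. -/
def cosD (D x : ℝ) : ℝ :=
  if D < 0 then Real.cos (x / 2 * √(-D))
  else if D = 0 then 1
  else Real.cosh (x / 2 * √D)

lemma sinD_zero (D : ℝ) : sinD D 0 = 0 := by
  unfold sinD; split_ifs <;> simp

lemma cosD_sq (D x : ℝ) : cosD D x ^ 2 - D / 4 * sinD D x ^ 2 = 1 := by
  unfold cosD sinD
  split_ifs with h1 h2
  · have hs : √(-D) ^ 2 = -D := Real.sq_sqrt (by linarith)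
    have hs0 : √(-D) ≠ 0 := (Real.sqrt_pos.2 (by linarith)).ne'
    have := Real.sin_sq_add_cos_sq (x / 2 * √(-D))
    have e : D = -√(-D) ^ 2 := by rw [hs]; ring
    rw [mul_pow, div_pow, hs]
    have hD : D ≠ 0 := h1.ne
    generalize Real.sin (x / 2 * √(-D)) = S at *
    generalize Real.cos (x / 2 * √(-D)) = C at *
    field_simp
    linarith
  · rw [h2]; ring
  · have hD : 0 < D := lt_of_le_of_ne (not_lt.1 h1) (Ne.symm h2)
    have hs : √D ^ 2 = D := Real.sq_sqrt hD.le
    have := Real.cosh_sq (x / 2 * √D)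
    rw [mul_pow, div_pow, hs]
    generalize Real.sinh (x / 2 * √D) = S at *
    generalize Real.cosh (x / 2 * √D) = C at *
    field_simp
    linarith

lemma hasDerivAt_sinD (D x : ℝ) : HasDerivAt (sinD D) (cosD D x) x := by
  have hl : ∀ s : ℝ, HasDerivAt (fun x : ℝ => x / 2 * s) (1 / 2 * s) x := fun s =>
    ((hasDerivAt_id x).div_const 2).mul_const s
  unfold cosD
  split_ifs with h1 h2
  · have hs0 : √(-D) ≠ 0 := (Real.sqrt_pos.2 (by linarith)).ne'
    have e : sinD D = fun x => 2 / √(-D) * Real.sin (x / 2 * √(-D)) := by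
      ext x; simp [sinD, h1]
    rw [e]
    refine (((Real.hasDerivAt_sin _).comp x (hl √(-D))).const_mul (2 / √(-D))).congr_deriv ?_
    field_simp
  · have e : sinD D = fun x => x := by
      ext x; simp [sinD, h2]
    rw [e]; exact hasDerivAt_id x
  · have hD : 0 < D := lt_of_le_of_ne (not_lt.1 h1) (Ne.symm h2)
    have hs0 : √D ≠ 0 := (Real.sqrt_pos.2 hD).ne'
    have e : sinD D = fun x => 2 / √D * Real.sinh (x / 2 * √D) := by
      ext x; simp [sinD, h1, h2]
    rw [e]
    refine (((Real.hasDerivAt_sinh _).comp x (hl √D)).const_mul (2 / √D)).congr_deriv ?_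
    field_simp

lemma hasDerivAt_cosD (D x : ℝ) : HasDerivAt (cosD D) (D / 4 * sinD D x) x := by
  have hl : ∀ s : ℝ, HasDerivAt (fun x : ℝ => x / 2 * s) (1 / 2 * s) x := fun s =>
    ((hasDerivAt_id x).div_const 2).mul_const s
  unfold sinD
  split_ifs with h1 h2
  · have hs : √(-D) ^ 2 = -D := Real.sq_sqrt (by linarith)
    have hs0 : √(-D) ≠ 0 := (Real.sqrt_pos.2 (by linarith)).ne'
    have e : cosD D = fun x => Real.cos (x / 2 * √(-D)) := by
      ext x; simp [cosD, h1]
    rw [e]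
    refine ((Real.hasDerivAt_cos _).comp x (hl √(-D))).congr_deriv ?_
    field_simp
    rw [hs]; ring
  · have e : cosD D = fun x => 1 := by
      ext x; simp [cosD, h2]
    rw [e, h2]; simpa using hasDerivAt_const x (1 : ℝ)
  · have hD : 0 < D := lt_of_le_of_ne (not_lt.1 h1) (Ne.symm h2)
    have hs0 : √D ≠ 0 := (Real.sqrt_pos.2 hD).ne'
    have hs : √D ^ 2 = D := Real.sq_sqrt hD.le
    have e : cosD D = fun x => Real.cosh (x / 2 * √D) := by
      ext x; simp [cosD, h1, h2]
    rw [e]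
    refine ((Real.hasDerivAt_cosh _).comp x (hl √D)).congr_deriv ?_
    field_simp
    rw [hs]; ring

lemma sinD_add (D x y : ℝ) : sinD D (x + y) = sinD D x * cosD D y + cosD D x * sinD D y := by
  unfold sinD cosD
  split_ifs with h1 h2
  · rw [add_div, add_mul, Real.sin_add]; ring
  · ring
  · rw [add_div, add_mul, Real.sinh_add]; ring

lemma cosD_add (D x y : ℝ) :
    cosD D (x + y) = cosD D x * cosD D y + D / 4 * (sinD D x * sinD D y) := by
  unfold sinD cosD
  split_ifs with h1 h2
  · have hs : √(-D) ^ 2 = -D := Real.sq_sqrt (by linarith)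
    have hs0 : √(-D) ≠ 0 := (Real.sqrt_pos.2 (by linarith)).ne'
    rw [add_div, add_mul, Real.cos_add]
    have : D / 4 * (2 / √(-D) * (2 / √(-D))) = -1 := by
      field_simp; rw [hs]; ring
    linear_combination (-Real.sin (x / 2 * √(-D)) * Real.sin (y / 2 * √(-D))) * this
  · rw [h2]; ring
  · have hD : 0 < D := lt_of_le_of_ne (not_lt.1 h1) (Ne.symm h2)
    have hs0 : √D ≠ 0 := (Real.sqrt_pos.2 hD).ne'
    have hs : √D ^ 2 = D := Real.sq_sqrt hD.le
    rw [add_div, add_mul, Real.cosh_add]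
    have : D / 4 * (2 / √D * (2 / √D)) = 1 := by
      field_simp; rw [hs]; ring
    linear_combination (-Real.sinh (x / 2 * √D) * Real.sinh (y / 2 * √D)) * this

/-- The denominator in the closed form of `g`. -/
def gDen (lam x : ℝ) : ℝ := cosD (disc lam) x - |1 - 2 * lam| / 2 * sinD (disc lam) x

lemma disc_eq (lam : ℝ) : disc lam = 1 - 8 * (lam * (1 - lam)) := by unfold disc; ring

lemma abs_sq_eq (lam : ℝ) : |1 - 2 * lam| ^ 2 = 1 - 4 * (lam * (1 - lam)) := by
  rw [sq_abs]; ring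

/-- With a = |1 - 2 lam|, the addition theorems leave the coefficient (disc - a²) / 4, which equals
-lam(1 - lam). -/
lemma gDen_add (lam x y : ℝ) : gDen lam (x + y) = gDen lam x * gDen lam y -
    lam * (1 - lam) * (sinD (disc lam) x * sinD (disc lam) y) := by
  unfold gDen
  rw [sinD_add, cosD_add]
  have h1 := abs_sq_eq lam
  have h2 := disc_eq lam
  linear_combination (-1 / 4 * sinD (disc lam) x * sinD (disc lam) y) * h1 +
    (1 / 4 * sinD (disc lam) x * sinD (disc lam) y) * h2

/-- The closed form of `g` without singularity at `0`. -/
def gFun (lam x : ℝ) : ℝ := sinD (disc lam) x / gDen lam x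

lemma gFun_zero (lam : ℝ) : gFun lam 0 = 0 := by simp [gFun, sinD_zero]

/-- By the quotient rule the numerator of the derivative is `cosD`² - (disc / 4) `sinD`² = 1. The
Riccati right side has the same numerator over the same squared denominator. -/
lemma hasDerivAt_gFun {lam x : ℝ} (hx : gDen lam x ≠ 0) :
    HasDerivAt (gFun lam)
      (1 + |1 - 2 * lam| * gFun lam x + lam * (1 - lam) * gFun lam x ^ 2) x := by
  have h1 := hasDerivAt_sinD (disc lam) x
  have h2 : HasDerivAt (gDen lam)
      (disc lam / 4 * sinD (disc lam) x - |1 - 2 * lam| / 2 * cosD (disc lam) x) x :=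
    (hasDerivAt_cosD (disc lam) x).sub (h1.const_mul _)
  refine (h1.div h2 hx).congr_deriv ?_
  have h3 := cosD_sq (disc lam) x
  have ha := abs_sq_eq lam
  have hd := disc_eq lam
  unfold gFun
  field_simp
  unfold gDen
  linear_combination (2 * sinD (disc lam) x ^ 2) * ha - (2 * sinD (disc lam) x ^ 2) * hd

/-- Below the blow-up point, the denominator of `g` is positive. -/
lemma gDen_pos {lam x : ℝ} (hlam : lam ∈ Icc (0 : ℝ) 1) (hx0 : 0 ≤ x)
    (hx : ENNReal.ofReal x < h lam) : 0 < gDen lam x ∧ 0 ≤ sinD (disc lam) x ∧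
      (0 < x → 0 < sinD (disc lam) x) := by
  unfold h at hx
  have hb : 0 ≤ lam * (1 - lam) := mul_nonneg hlam.1 (by linarith [hlam.2])
  have hd := disc_eq lam
  have ha := abs_sq_eq lam
  have ha0 : 0 ≤ |1 - 2 * lam| := abs_nonneg _
  split_ifs at hx with h1 h2 h3 h4
  · have hD : disc lam = 1 := by rcases h1 with rfl | rfl <;> norm_num [disc]
    have ha1 : |1 - 2 * lam| = 1 := by rcases h1 with rfl | rfl <;> norm_num
    have n1 : ¬ ((1 : ℝ) < 0) := by norm_num
    refine ⟨?_, ?_, ?_⟩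
    · have := Real.sinh_lt_cosh (x / 2)
      simp only [gDen, hD, ha1, cosD, sinD, if_neg n1, one_ne_zero, if_false, Real.sqrt_one, mul_one]
      linarith
    · have := Real.sinh_nonneg_iff.2 (by linarith : 0 ≤ x / 2)
      simp only [hD, sinD, if_neg n1, one_ne_zero, if_false, Real.sqrt_one, mul_one]
      linarith
    · intro hx
      have := Real.sinh_pos_iff.2 (by linarith : 0 < x / 2)
      simp only [hD, sinD, if_neg n1, one_ne_zero, if_false, Real.sqrt_one, mul_one]
      linarith
  · have hD : disc lam = -1 := by rw [h2]; norm_num [disc]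
    have ha1 : |1 - 2 * lam| = 0 := by rw [h2]; norm_num
    rw [ENNReal.ofReal_lt_ofReal_iff Real.pi_pos] at hx
    refine ⟨?_, ?_, ?_⟩
    · have := Real.cos_pos_of_mem_Ioo (x := x / 2) ⟨by linarith [Real.pi_pos], by linarith⟩
      simp [gDen, hD, ha1, cosD, this]
    · have := Real.sin_nonneg_of_nonneg_of_le_pi (x := x / 2) (by linarith) (by linarith)
      simp [hD, sinD, this]
    · intro hx
      have := Real.sin_pos_of_pos_of_lt_pi (x := x / 2) (by linarith) (by linarith [Real.pi_pos])
      simp [hD, sinD, this]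
  · have hs : 0 < √(-disc lam) := Real.sqrt_pos.2 (by linarith)
    have hapos : 0 < |1 - 2 * lam| := abs_pos.2 fun h => h2 (by linarith)
    have harc : 0 < Real.arctan (√(-disc lam) / |1 - 2 * lam|) :=
      Real.arctan_pos.2 (by positivity)
    rw [ENNReal.ofReal_lt_ofReal_iff (by positivity), lt_div_iff₀ hs] at hx
    have hv : x / 2 * √(-disc lam) < Real.arctan (√(-disc lam) / |1 - 2 * lam|) := by linarith
    have hv0 : 0 ≤ x / 2 * √(-disc lam) := by positivity
    have hv1 := hv.trans (Real.arctan_lt_pi_div_two _)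
    have hcos := Real.cos_pos_of_mem_Ioo (x := x / 2 * √(-disc lam))
      ⟨by linarith [Real.pi_pos], hv1⟩
    refine ⟨?_, ?_, ?_⟩
    · have ht := Real.tan_lt_tan_of_nonneg_of_lt_pi_div_two hv0 (Real.arctan_lt_pi_div_two _) hv
      rw [Real.tan_arctan, Real.tan_eq_sin_div_cos, div_lt_div_iff₀ hcos hapos] at ht
      simp only [gDen, cosD, sinD, if_pos h3]
      have : |1 - 2 * lam| / 2 * (2 / √(-disc lam) * Real.sin (x / 2 * √(-disc lam))) =
          Real.sin (x / 2 * √(-disc lam)) * |1 - 2 * lam| / √(-disc lam) := by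
        field_simp
      rw [this, sub_pos, div_lt_iff₀ hs]
      linarith
    · have := Real.sin_nonneg_of_nonneg_of_le_pi hv0 (by linarith [Real.pi_pos])
      simp only [sinD, if_pos h3]
      positivity
    · intro hx
      have hv0 : 0 < x / 2 * √(-disc lam) := by positivity
      have := Real.sin_pos_of_pos_of_lt_pi hv0 (by linarith [Real.pi_pos])
      simp only [sinD, if_pos h3]
      positivity
  · rw [ENNReal.ofReal_lt_ofReal_iff (by positivity)] at hx
    have n1 : ¬ disc lam < 0 := by rw [h4]; norm_num
    refine ⟨?_, ?_, ?_⟩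
    · simp only [gDen, cosD, sinD, if_neg n1, if_pos h4]
      have e : |1 - 2 * lam| = √2 / 2 := by
        rw [← sq_eq_sq₀ ha0 (by positivity), div_pow, Real.sq_sqrt (by norm_num)]
        linarith
      rw [e]
      have : √2 * √2 = 2 := Real.mul_self_sqrt (by norm_num)
      have h5 : √2 * x < √2 * (2 * √2) := mul_lt_mul_of_pos_left hx (by positivity)
      linarith
    · simpa only [sinD, if_neg n1, if_pos h4] using hx0
    · intro hx
      simpa only [sinD, if_neg n1, if_pos h4] using hx
  · have hD : 0 < disc lam := lt_of_le_of_ne (not_lt.1 h3) (Ne.symm h4)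
    have hs : 0 < √(disc lam) := Real.sqrt_pos.2 hD
    have hs2 : √(disc lam) ^ 2 = disc lam := Real.sq_sqrt hD.le
    have hb' : 0 < lam * (1 - lam) := by
      push Not at h1
      exact mul_pos (lt_of_le_of_ne hlam.1 (Ne.symm h1.1))
        (by have := lt_of_le_of_ne hlam.2 h1.2; linarith)
    have hapos : 0 < |1 - 2 * lam| := by nlinarith
    -- Here a² - s² = 4 lam(1 - lam) > 0 away from the endpoints, so s / a lies in the domain of
    -- artanh.
    have hlt : √(disc lam) / |1 - 2 * lam| < 1 := by
      rw [div_lt_one hapos]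
      nlinarith
    have hmem : √(disc lam) / |1 - 2 * lam| ∈ Ioo (-1 : ℝ) 1 :=
      ⟨lt_of_lt_of_le (by norm_num) (by positivity : 0 ≤ √(disc lam) / |1 - 2 * lam|), hlt⟩
    have hx' := ENNReal.ofReal_lt_ofReal_iff_of_nonneg hx0 |>.1 hx
    rw [lt_div_iff₀ hs] at hx'
    have hv : x / 2 * √(disc lam) < Real.artanh (√(disc lam) / |1 - 2 * lam|) := by linarith
    have ht : Real.tanh (x / 2 * √(disc lam)) < √(disc lam) / |1 - 2 * lam| := by
      rw [← Real.artanh_tanh (x / 2 * √(disc lam))] at hv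
      exact (Real.artanh_lt_artanh_iff ⟨Real.neg_one_lt_tanh _, Real.tanh_lt_one _⟩ hmem).1 hv
    rw [Real.tanh_eq_sinh_div_cosh,
      div_lt_div_iff₀ (Real.cosh_pos _) hapos] at ht
    have hv0 : 0 ≤ x / 2 * √(disc lam) := by positivity
    refine ⟨?_, ?_, ?_⟩
    · simp only [gDen, cosD, sinD, if_neg h3, if_neg h4]
      have : |1 - 2 * lam| / 2 * (2 / √(disc lam) * Real.sinh (x / 2 * √(disc lam))) =
          Real.sinh (x / 2 * √(disc lam)) * |1 - 2 * lam| / √(disc lam) := by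
        field_simp
      rw [this, sub_pos, div_lt_iff₀ hs]
      linarith
    · have := Real.sinh_nonneg_iff.2 hv0
      simp only [sinD, if_neg h3, if_neg h4]
      positivity
    · intro hx
      have hv0 : 0 < x / 2 * √(disc lam) := by positivity
      have := Real.sinh_pos_iff.2 hv0
      simp only [sinD, if_neg h3, if_neg h4]
      positivity

lemma gReal_eq_gFun {lam x : ℝ} (hlam : lam ∈ Icc (0 : ℝ) 1) (hx0 : 0 ≤ x)
    (hx : ENNReal.ofReal x < h lam) : gReal lam x = gFun lam x := by
  rcases hx0.eq_or_lt with rfl | hpos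
  · rw [gFun_zero, gReal, if_pos rfl]
  obtain ⟨hden, -, hS⟩ := gDen_pos hlam hx0 hx
  have hS := hS hpos
  have ha := abs_sq_eq lam
  have hd := disc_eq lam
  unfold gReal gFun
  unfold gDen at *
  unfold sinD cosD at *
  rw [if_neg hpos.ne']
  split_ifs at * with h1 h2
  · have hs : 0 < √(-disc lam) := Real.sqrt_pos.2 (by linarith)
    have hsin : 0 < Real.sin (x / 2 * √(-disc lam)) := by
      by_contra hn
      have : 2 / √(-disc lam) * Real.sin (x / 2 * √(-disc lam)) ≤ 0 :=
        mul_nonpos_of_nonneg_of_nonpos (by positivity) (not_lt.1 hn)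
      linarith
    have e : -|1 - 2 * lam| + √(-disc lam) * Real.cot (x / 2 * √(-disc lam)) =
        (Real.cos (x / 2 * √(-disc lam)) - |1 - 2 * lam| / 2 *
          (2 / √(-disc lam) * Real.sin (x / 2 * √(-disc lam)))) *
          (√(-disc lam) / Real.sin (x / 2 * √(-disc lam))) := by
      rw [Real.cot_eq_cos_div_sin]
      generalize Real.cos (x / 2 * √(-disc lam)) = C
      generalize Real.sin (x / 2 * √(-disc lam)) = S at *
      field_simp
      ring
    rw [e]
    field_simp
  · have e : |1 - 2 * lam| = √2 / 2 := by
      rw [← sq_eq_sq₀ (abs_nonneg _) (by positivity), div_pow, Real.sq_sqrt (by norm_num)]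
      linarith
    rw [e] at hden ⊢
    have e2 : 4 - √2 * x = 4 * (1 - √2 / 2 / 2 * x) := by ring
    rw [e2, mul_div_mul_left _ _ (by norm_num)]
  · have hD : 0 < disc lam := lt_of_le_of_ne (not_lt.1 h1) (Ne.symm h2)
    have hs : 0 < √(disc lam) := Real.sqrt_pos.2 hD
    have hsinh : 0 < Real.sinh (x / 2 * √(disc lam)) := Real.sinh_pos_iff.2 (by positivity)
    have e : -|1 - 2 * lam| + √(disc lam) *
        (Real.cosh (x / 2 * √(disc lam)) / Real.sinh (x / 2 * √(disc lam))) =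
        (Real.cosh (x / 2 * √(disc lam)) - |1 - 2 * lam| / 2 *
          (2 / √(disc lam) * Real.sinh (x / 2 * √(disc lam)))) *
          (√(disc lam) / Real.sinh (x / 2 * √(disc lam))) := by
      field_simp
      ring
    rw [e]
    field_simp

lemma g_eq_gFun {lam x : ℝ} (hlam : lam ∈ Icc (0 : ℝ) 1) (hx0 : 0 ≤ x)
    (hx : ENNReal.ofReal x < h lam) : g lam (ENNReal.ofReal x) = ENNReal.ofReal (gFun lam x) := by
  rw [g, if_pos hx, ENNReal.toReal_ofReal hx0, gReal_eq_gFun hlam hx0 hx]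

lemma gFun_nonneg {lam x : ℝ} (hlam : lam ∈ Icc (0 : ℝ) 1) (hx0 : 0 ≤ x)
    (hx : ENNReal.ofReal x < h lam) : 0 ≤ gFun lam x := by
  obtain ⟨h1, h2, -⟩ := gDen_pos hlam hx0 hx
  exact div_nonneg h2 h1.le

/-- The key inequality on the solutions: `g x g y` stays below the critical value. -/
lemma gFun_mul_lt {lam x y : ℝ} (hlam : lam ∈ Icc (0 : ℝ) 1) (hx0 : 0 ≤ x) (hy0 : 0 ≤ y)
    (hxy : ENNReal.ofReal (x + y) < h lam) : lam * (1 - lam) * (gFun lam x * gFun lam y) < 1 := by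
  have hx := lt_of_le_of_lt (ENNReal.ofReal_le_ofReal (by linarith : x ≤ x + y)) hxy
  have hy := lt_of_le_of_lt (ENNReal.ofReal_le_ofReal (by linarith : y ≤ x + y)) hxy
  have h1 := (gDen_pos hlam hx0 hx).1
  have h2 := (gDen_pos hlam hy0 hy).1
  have h3 := (gDen_pos hlam (by linarith) hxy).1
  rw [gDen_add] at h3
  unfold gFun
  rw [div_mul_div_comm, ← mul_div_assoc, div_lt_one (by positivity)]
  linarith

/-- The Riccati right side is at least 1 where the solution is nonnegative. This converts slack in
the argument into slack in the value. -/
lemma gFun_add_le {lam x δ : ℝ} (hlam : lam ∈ Icc (0 : ℝ) 1) (hx0 : 0 ≤ x) (hδ : 0 ≤ δ)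
    (hxδ : ENNReal.ofReal (x + δ) < h lam) : gFun lam x + δ ≤ gFun lam (x + δ) := by
  have hdom : ∀ t ∈ Icc x (x + δ), ENNReal.ofReal t < h lam := fun t ht =>
    lt_of_le_of_lt (ENNReal.ofReal_le_ofReal ht.2) hxδ
  have hd : ∀ t ∈ Icc x (x + δ), HasDerivAt (gFun lam)
      (1 + |1 - 2 * lam| * gFun lam t + lam * (1 - lam) * gFun lam t ^ 2) t := fun t ht =>
    hasDerivAt_gFun (gDen_pos hlam (hx0.trans ht.1) (hdom t ht)).1.ne'
  have := (convex_Icc x (x + δ)).mul_sub_le_image_sub_of_le_deriv (f := gFun lam) (C := 1)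
    (fun t ht => (hd t ht).continuousAt.continuousWithinAt)
    (fun t ht => (hd t (interior_subset ht)).differentiableAt.differentiableWithinAt)
    (fun t ht => by
      have ht' := interior_subset ht
      rw [(hd t ht').deriv]
      have h0 := gFun_nonneg hlam (hx0.trans ht'.1) (hdom t ht')
      have hb : 0 ≤ lam * (1 - lam) := mul_nonneg hlam.1 (by linarith [hlam.2])
      have : 0 ≤ |1 - 2 * lam| * gFun lam t := by positivity
      have : 0 ≤ lam * (1 - lam) * gFun lam t ^ 2 := by positivity
      linarith) x (left_mem_Icc.2 (by linarith)) (x + δ) (right_mem_Icc.2 (by linarith))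
      (by linarith)
  linarith

end Riccati

/-! ### Comparison of the one-variable majorant with the Riccati solution -/

section Comparison

/-- The coefficients of the one-variable resolvent series. -/
def rhoCoeff (lam : ℝ) (n : ℕ) : ℝ :=
  PowerSeries.coeff n (cayleyResolvent (PowerSeries.exp ℝ) lam)

/-- Differentiate R Q = E - 1 using E' = E. The claim is checked after multiplying by Q², which is
cancellable in the domain of real power series. -/
lemma rho_ode (lam : ℝ) :
    PowerSeries.derivative ℝ (cayleyResolvent (PowerSeries.exp ℝ) lam) =
      1 + (2 * lam - 1) • cayleyResolvent (PowerSeries.exp ℝ) lam -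
        (lam * (1 - lam)) • cayleyResolvent (PowerSeries.exp ℝ) lam ^ 2 := by
  have hu := isUnit_resolventDenom constantCoeff_exp_real lam
  have h1 := cayleyResolvent_mul hu
  set P := cayleyResolvent (PowerSeries.exp ℝ) lam with hP
  set E := PowerSeries.exp ℝ with hE
  set Q := algebraMap ℝ (PowerSeries ℝ) lam + (1 - lam) • E with hQ
  set L : PowerSeries ℝ := algebraMap ℝ (PowerSeries ℝ) lam with hL
  have hQ' : Q = L + (1 - L) * E := by
    rw [hQ, Algebra.smul_def, map_sub, map_one]
  have hdQ : PowerSeries.derivative ℝ Q = (1 - L) * E := by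
    rw [hQ, map_add, Derivation.map_algebraMap, zero_add, Derivation.map_smul, PowerSeries.derivative_exp,
      Algebra.smul_def, map_sub, map_one]
  have h2 := congrArg (PowerSeries.derivative ℝ) h1
  rw [Derivation.leibniz, map_sub, PowerSeries.derivative_exp, Derivation.map_one_eq_zero, sub_zero, hdQ,
    smul_eq_mul, smul_eq_mul] at h2
  have hs1 : (2 * lam - 1) • P = (2 * L - 1) * P := by
    rw [Algebra.smul_def, map_sub, map_mul, map_one]; congr
  have hs2 : (lam * (1 - lam)) • P ^ 2 = L * (1 - L) * P ^ 2 := by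
    rw [Algebra.smul_def, map_mul, map_sub, map_one]
  rw [hs1, hs2]
  have hQ0 : Q * Q ≠ 0 := mul_ne_zero hu.ne_zero hu.ne_zero
  apply mul_right_cancel₀ hQ0
  rw [hQ'] at h1 h2 ⊢
  linear_combination (L + (1 - L) * E) * h2 - ((1 - L) * E + (2 * L - 1) * (L + (1 - L) * E) -
    L * (1 - L) * (P * (L + (1 - L) * E) + E - 1)) * h1

lemma rhoCoeff_zero (lam : ℝ) : rhoCoeff lam 0 = 0 := by
  have h1 := congrArg PowerSeries.constantCoeff
    (cayleyResolvent_rec (isUnit_resolventDenom constantCoeff_exp_real lam))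
  have h2 : PowerSeries.constantCoeff
      ((lam - 1) • ((PowerSeries.exp ℝ - 1) * cayleyResolvent (PowerSeries.exp ℝ) lam)) = 0 := by
    rw [← PowerSeries.coeff_zero_eq_constantCoeff_apply, PowerSeries.coeff_smul]
    simp
  rw [map_add, h2] at h1
  rw [rhoCoeff, PowerSeries.coeff_zero_eq_constantCoeff_apply, h1]
  simp

lemma rhoCoeff_succ (lam : ℝ) (n : ℕ) : rhoCoeff lam (n + 1) * (n + 1) =
    (if n = 0 then 1 else 0) + (2 * lam - 1) * rhoCoeff lam n - lam * (1 - lam) *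
      ∑ p ∈ Finset.HasAntidiagonal.antidiagonal n, rhoCoeff lam p.1 * rhoCoeff lam p.2 := by
  have h := congrArg (PowerSeries.coeff n) (rho_ode lam)
  rw [PowerSeries.coeff_derivative, map_sub, map_add, PowerSeries.coeff_one,
    PowerSeries.coeff_smul, PowerSeries.coeff_smul, sq, PowerSeries.coeff_mul] at h
  exact h

/-- The triangle inequality replaces both Riccati coefficients by their absolute values, which gives
the equation of g. -/
lemma abs_rhoCoeff_succ_le {lam : ℝ} (hlam : lam ∈ Icc (0 : ℝ) 1) (n : ℕ) :
    |rhoCoeff lam (n + 1)| * (n + 1) ≤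
      (if n = 0 then 1 else 0) + |1 - 2 * lam| * |rhoCoeff lam n| + lam * (1 - lam) *
        ∑ p ∈ Finset.HasAntidiagonal.antidiagonal n, |rhoCoeff lam p.1| * |rhoCoeff lam p.2| := by
  have hb : 0 ≤ lam * (1 - lam) := mul_nonneg hlam.1 (by linarith [hlam.2])
  have e : |rhoCoeff lam (n + 1)| * (n + 1) = |rhoCoeff lam (n + 1) * (n + 1)| := by
    rw [abs_mul, abs_of_pos (by positivity : (0 : ℝ) < n + 1)]
  rw [e, rhoCoeff_succ, abs_sub_comm 1 (2 * lam), ← abs_mul]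
  refine (abs_sub _ _).trans ?_
  refine add_le_add ((abs_add_le _ _).trans (add_le_add ?_ le_rfl)) ?_
  · split_ifs <;> simp
  · rw [abs_mul, abs_of_nonneg hb]
    gcongr
    refine (Finset.abs_sum_le_sum_abs _ _).trans_eq ?_
    simp_rw [abs_mul]

/-- Partial sums of the one-variable majorant. -/
def rhoSum (lam : ℝ) (N : ℕ) (x : ℝ) : ℝ := ∑ n ∈ Finset.range N, |rhoCoeff lam n| * x ^ n

lemma hasDerivAt_rhoSum (lam : ℝ) (N : ℕ) (x : ℝ) : HasDerivAt (rhoSum lam (N + 1))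
    (∑ n ∈ Finset.range N, |rhoCoeff lam (n + 1)| * (n + 1) * x ^ n) x := by
  have : rhoSum lam (N + 1) = fun x => (∑ n ∈ Finset.range N,
      |rhoCoeff lam (n + 1)| * x ^ (n + 1)) + |rhoCoeff lam 0| := by
    ext x
    rw [rhoSum, Finset.sum_range_succ']
    simp
  rw [this]
  refine HasDerivAt.add_const _ (HasDerivAt.fun_sum fun n _ => ?_)
  refine ((hasDerivAt_pow (n + 1) x).const_mul _).congr_deriv ?_
  push_cast
  ring

/-- Sum the coefficient inequalities. The truncated convolution is part of the square of the partial
sum, and all terms are nonnegative. -/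
lemma deriv_rhoSum_le {lam : ℝ} (hlam : lam ∈ Icc (0 : ℝ) 1) (N : ℕ) {x : ℝ} (hx : 0 ≤ x) :
    ∑ n ∈ Finset.range N, |rhoCoeff lam (n + 1)| * (n + 1) * x ^ n ≤
      1 + |1 - 2 * lam| * rhoSum lam (N + 1) x + lam * (1 - lam) * rhoSum lam (N + 1) x ^ 2 := by
  have hb : 0 ≤ lam * (1 - lam) := mul_nonneg hlam.1 (by linarith [hlam.2])
  calc _ ≤ ∑ n ∈ Finset.range N, ((if n = 0 then 1 else 0) + |1 - 2 * lam| * |rhoCoeff lam n| +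
        lam * (1 - lam) * ∑ p ∈ Finset.HasAntidiagonal.antidiagonal n, |rhoCoeff lam p.1| * |rhoCoeff lam p.2|) *
          x ^ n := by
        refine Finset.sum_le_sum fun n _ => ?_
        gcongr
        exact abs_rhoCoeff_succ_le hlam n
    _ = ∑ n ∈ Finset.range N, (if n = 0 then 1 else 0) * x ^ n +
        |1 - 2 * lam| * rhoSum lam N x + lam * (1 - lam) * ∑ n ∈ Finset.range N,
          ∑ p ∈ Finset.HasAntidiagonal.antidiagonal n,
            (|rhoCoeff lam p.1| * x ^ p.1) * (|rhoCoeff lam p.2| * x ^ p.2) := by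
        rw [rhoSum, Finset.mul_sum, Finset.mul_sum, ← Finset.sum_add_distrib,
          ← Finset.sum_add_distrib]
        refine Finset.sum_congr rfl fun n _ => ?_
        have : ∑ p ∈ Finset.HasAntidiagonal.antidiagonal n,
            (|rhoCoeff lam p.1| * x ^ p.1) * (|rhoCoeff lam p.2| * x ^ p.2) =
            (∑ p ∈ Finset.HasAntidiagonal.antidiagonal n, |rhoCoeff lam p.1| * |rhoCoeff lam p.2|) * x ^ n := by
          rw [Finset.sum_mul]
          refine Finset.sum_congr rfl fun p hp => ?_
          rw [← Finset.HasAntidiagonal.mem_antidiagonal.1 hp, pow_add]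
          ring
        rw [this]
        ring
    _ ≤ _ := by
        refine add_le_add (add_le_add ?_ ?_) ?_
        · have : ∀ n ∈ Finset.range N, (if n = 0 then 1 else 0) * x ^ n =
              if n = 0 then (1 : ℝ) else 0 := by
            intro n _
            split_ifs with h <;> simp [h]
          rw [Finset.sum_congr rfl this, Finset.sum_ite_eq']
          split_ifs <;> norm_num
        · gcongr
          rw [rhoSum, rhoSum, Finset.sum_range_succ]
          have : 0 ≤ |rhoCoeff lam N| * x ^ N := by positivity
          linarith
        · gcongr
          rw [sq, rhoSum, Finset.sum_mul_sum, ← Finset.sum_product']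
          have hfib := Finset.sum_fiberwise_of_maps_to
            (s := ((Finset.range (N + 1) ×ˢ Finset.range (N + 1)).filter
              fun p : ℕ × ℕ => p.1 + p.2 < N)) (t := Finset.range N) (g := fun p => p.1 + p.2)
            (fun p hp => Finset.mem_range.2 (Finset.mem_filter.1 hp).2)
            (fun p => (|rhoCoeff lam p.1| * x ^ p.1) * (|rhoCoeff lam p.2| * x ^ p.2))
          have hanti : ∀ n ∈ Finset.range N, Finset.HasAntidiagonal.antidiagonal n =
              ((Finset.range (N + 1) ×ˢ Finset.range (N + 1)).filter
                fun p : ℕ × ℕ => p.1 + p.2 < N).filter fun p => p.1 + p.2 = n := by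
            intro n hn
            rw [Finset.mem_range] at hn
            ext p
            simp only [Finset.HasAntidiagonal.mem_antidiagonal, Finset.mem_filter,
              Finset.mem_product, Finset.mem_range]
            omega
          rw [Finset.sum_congr rfl fun n hn => by rw [hanti n hn], hfib]
          exact Finset.sum_le_sum_of_subset_of_nonneg (Finset.filter_subset _ _)
            fun _ _ _ => by positivity

/-- The partial sums of the majorant are dominated by the solution of the Riccati equation. -/
lemma rhoSum_le_gFun {lam : ℝ} (hlam : lam ∈ Icc (0 : ℝ) 1) (N : ℕ) {x : ℝ} (hx0 : 0 ≤ x)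
    (hx : ENNReal.ofReal x < h lam) : rhoSum lam (N + 1) x ≤ gFun lam x := by
  have hb : 0 ≤ lam * (1 - lam) := mul_nonneg hlam.1 (by linarith [hlam.2])
  have hdom : ∀ t ∈ Icc 0 x, ENNReal.ofReal t < h lam := fun t ht =>
    lt_of_le_of_lt (ENNReal.ofReal_le_ofReal ht.2) hx
  have hd : ∀ t ∈ Icc 0 x, HasDerivAt (gFun lam)
      (1 + |1 - 2 * lam| * gFun lam t + lam * (1 - lam) * gFun lam t ^ 2) t := fun t ht =>
    hasDerivAt_gFun (gDen_pos hlam ht.1 (hdom t ht)).1.ne'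
  -- Shrinking the argument by r < 1 makes the differential inequality strict at a contact point, as
  -- the comparison principle requires; then r tends to 1.
  have key : ∀ r ∈ Ioo (0 : ℝ) 1, rhoSum lam (N + 1) (r * x) ≤ gFun lam x := by
    intro r hr
    have hS : ∀ t, HasDerivAt (fun t => rhoSum lam (N + 1) (r * t))
        ((∑ n ∈ Finset.range N, |rhoCoeff lam (n + 1)| * (n + 1) * (r * t) ^ n) * r) t := by
      intro t
      refine ((hasDerivAt_rhoSum lam N (r * t)).comp t
        ((hasDerivAt_id t).const_mul r)).congr_deriv ?_
      rw [mul_one]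
    refine image_le_of_deriv_right_lt_deriv_boundary' (a := 0) (b := x)
      (f := fun t => rhoSum lam (N + 1) (r * t)) (B := gFun lam)
      (fun t _ => (hS t).continuousAt.continuousWithinAt)
      (fun t _ => (hS t).hasDerivWithinAt) ?_
      (fun t ht => (hd t ht).continuousAt.continuousWithinAt)
      (fun t ht => (hd t (Ico_subset_Icc_self ht)).hasDerivWithinAt) ?_ (right_mem_Icc.2 hx0)
    · rw [gFun_zero, mul_zero, rhoSum, Finset.sum_eq_zero]
      intro n _
      rcases Nat.eq_zero_or_pos n with rfl | hn
      · simp [rhoCoeff_zero]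
      · rw [zero_pow hn.ne', mul_zero]
    · intro t ht heq
      have h0 := gFun_nonneg hlam ht.1 (hdom t (Ico_subset_Icc_self ht))
      have hle := deriv_rhoSum_le hlam N (mul_nonneg hr.1.le ht.1)
      rw [heq] at hle
      have hpos : 0 < 1 + |1 - 2 * lam| * gFun lam t + lam * (1 - lam) * gFun lam t ^ 2 := by
        positivity
      calc _ ≤ (1 + |1 - 2 * lam| * gFun lam t + lam * (1 - lam) * gFun lam t ^ 2) * r :=
            mul_le_mul_of_nonneg_right hle hr.1.le
        _ < _ := mul_lt_of_lt_one_right hpos hr.2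
  have hcont : Filter.Tendsto (fun r : ℝ => rhoSum lam (N + 1) (r * x)) (nhdsWithin 1 (Iio 1))
      (nhds (rhoSum lam (N + 1) (1 * x))) := by
    refine Filter.Tendsto.mono_left (Continuous.tendsto ?_ 1) nhdsWithin_le_nhds
    unfold rhoSum
    fun_prop
  rw [one_mul] at hcont
  refine le_of_tendsto hcont ?_
  filter_upwards [Ioo_mem_nhdsLT (zero_lt_one' ℝ)] with r hr
  exact key r hr

lemma rhoTilde_le_g {lam : ℝ} (hlam : lam ∈ Icc (0 : ℝ) 1) {x : ℝ≥0∞} :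
    rhoTilde lam x ≤ g lam x := by
  by_cases hx : x < h lam
  · have hxt : x ≠ ⊤ := hx.ne_top
    obtain ⟨t, ht0, rfl⟩ : ∃ t : ℝ, 0 ≤ t ∧ x = ENNReal.ofReal t :=
      ⟨x.toReal, ENNReal.toReal_nonneg, (ENNReal.ofReal_toReal hxt).symm⟩
    rw [g_eq_gFun hlam ht0 hx, rhoTilde, ENNReal.tsum_eq_iSup_nat' (Filter.tendsto_add_atTop_nat 1)]
    refine iSup_le fun N => ?_
    refine le_trans (le_of_eq ?_) (ENNReal.ofReal_le_ofReal (rhoSum_le_gFun hlam N ht0 hx))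
    rw [rhoSum, ENNReal.ofReal_sum_of_nonneg fun _ _ => by positivity]
    refine Finset.sum_congr rfl fun n _ => ?_
    rw [ENNReal.ofReal_mul (abs_nonneg _), ENNReal.ofReal_pow ht0]
    rfl
  · rw [g, if_neg hx]
    exact le_top

end Comparison

/-! ### Bounds uniform in the parameter -/

section Uniform

lemma sqrt_bounds {b : ℝ} (hb0 : 0 ≤ b) (hb : b ≤ 1 / 32) :
    1 / 2 ≤ √(1 - 8 * b) ∧ √(1 - 8 * b) ≤ 1 := by
  constructor
  · apply Real.le_sqrt_of_sq_le; linarith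
  · rw [Real.sqrt_le_one]; linarith

/-- A bound for `g` near the ends of the parameter interval. -/
lemma gFun_le_of_small {lam x : ℝ} (hlam : lam ∈ Icc (0 : ℝ) 1) (hx : 0 ≤ x)
    (hb : lam * (1 - lam) ≤ Real.exp (-x) / 32) : gFun lam x ≤ 4 * Real.exp x := by
  have hb0 : 0 ≤ lam * (1 - lam) := mul_nonneg hlam.1 (by linarith [hlam.2])
  have hex : Real.exp (-x) ≤ 1 := Real.exp_le_one_iff.2 (by linarith)
  have hd := disc_eq lam
  have ha := abs_sq_eq lam
  have ha0 : 0 ≤ |1 - 2 * lam| := abs_nonneg _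
  have hD : 0 < disc lam := by linarith
  obtain ⟨hs1, hs2⟩ := sqrt_bounds hb0 (by linarith)
  rw [← hd] at hs1 hs2
  have hs : √(disc lam) ^ 2 = disc lam := Real.sq_sqrt hD.le
  have n1 : ¬ disc lam < 0 := by linarith
  have n2 : disc lam ≠ 0 := by linarith
  unfold gFun gDen
  simp only [sinD, cosD, if_neg n1, if_neg n2]
  set s := √(disc lam) with hsdef
  set v := x / 2 * s with hv
  have hv0 : 0 ≤ v := by positivity
  have hvx : v + v ≤ x := by rw [hv]; nlinarith
  have hsa : s ≤ |1 - 2 * lam| := by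
    apply le_of_sq_le_sq _ ha0
    linarith
  -- This is a² - s² = 4 lam(1 - lam) together with a + s ≥ 1.
  have hdiff : |1 - 2 * lam| - s ≤ 4 * (lam * (1 - lam)) := by
    have : (|1 - 2 * lam| - s) * (|1 - 2 * lam| + s) = 4 * (lam * (1 - lam)) := by
      ring_nf
      ring_nf at ha hd
      rw [ha, hs, hd]
      ring
    nlinarith
  have hE : Real.exp v * Real.exp (-v) = 1 := by rw [← Real.exp_add]; simp
  have hp := Real.exp_pos v
  have hq := Real.exp_pos (-v)
  have hbv : lam * (1 - lam) * Real.exp v ≤ Real.exp (-v) / 32 := by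
    have : Real.exp (-x) ≤ Real.exp (-v) * Real.exp (-v) := by
      rw [← Real.exp_add]; exact Real.exp_le_exp.2 (by linarith)
    calc _ ≤ Real.exp (-x) / 32 * Real.exp v := by gcongr
      _ ≤ Real.exp (-v) * Real.exp (-v) / 32 * Real.exp v := by gcongr
      _ = Real.exp (-v) / 32 * (Real.exp v * Real.exp (-v)) := by ring
      _ = _ := by rw [hE, mul_one]
  -- In exponentials the right side is ((a + s)e^(-v) - (a - s)e^v) / 2. The smallness of lam(1 -
  -- lam) makes the growing term negligible.
  have hden : Real.exp (-v) / 4 ≤ s * Real.cosh v - |1 - 2 * lam| * Real.sinh v := by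
    rw [Real.cosh_eq, Real.sinh_eq]
    have h1 : (|1 - 2 * lam| - s) * Real.exp v ≤ 4 * (lam * (1 - lam)) * Real.exp v := by gcongr
    have h2 : 1 / 2 * Real.exp (-v) ≤ s * Real.exp (-v) := by gcongr
    have h3 : 1 / 2 * Real.exp (-v) ≤ |1 - 2 * lam| * Real.exp (-v) := by
      gcongr; linarith
    nlinarith
  have hspos : 0 < s := by linarith
  have e : 2 / s * Real.sinh v / (Real.cosh v - |1 - 2 * lam| / 2 * (2 / s * Real.sinh v)) =
      2 * Real.sinh v / (s * Real.cosh v - |1 - 2 * lam| * Real.sinh v) := by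
    have hden' : s * Real.cosh v - |1 - 2 * lam| * Real.sinh v ≠ 0 := by
      have : 0 < Real.exp (-v) / 4 := by positivity
      linarith
    have : Real.cosh v - |1 - 2 * lam| / 2 * (2 / s * Real.sinh v) =
        (s * Real.cosh v - |1 - 2 * lam| * Real.sinh v) / s := by
      field_simp
    rw [this]
    field_simp
  rw [e, div_le_iff₀ (lt_of_lt_of_le (by positivity) hden)]
  have h4 : Real.sinh v ≤ Real.exp v / 2 := by rw [Real.sinh_eq]; linarith
  have h5 : Real.exp v ≤ Real.exp x * Real.exp (-v) := by
    rw [← Real.exp_add]; exact Real.exp_le_exp.2 (by linarith)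
  calc 2 * Real.sinh v ≤ Real.exp x * Real.exp (-v) := by linarith
    _ = 4 * Real.exp x * (Real.exp (-v) / 4) := by ring
    _ ≤ _ := by gcongr

/-- A uniform bound for the majorant. -/
lemma exists_uniform_bound {x y δ : ℝ} (hx : 0 ≤ x) (hy : 0 ≤ y) (hδ : 0 < δ)
    (hh : ∀ lam ∈ Icc (0 : ℝ) 1, ENNReal.ofReal (x + y + 2 * δ) < h lam) :
    ∃ K : ℝ, ∀ lam ∈ Icc (0 : ℝ) 1,
      0 < 1 - lam * (1 - lam) * (gFun lam x * gFun lam y) ∧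
      (gFun lam x + gFun lam y + gFun lam x * gFun lam y) /
        (1 - lam * (1 - lam) * (gFun lam x * gFun lam y)) ≤ K := by
  set b₀ := Real.exp (-(x + y)) / 32 with hb₀
  have hb₀pos : 0 < b₀ := by positivity
  set M := 1 / (b₀ * δ) with hM
  set M' := 4 * Real.exp (x + y) with hM'
  -- The two entries serve lam(1 - lam) ≥ b₀ and < b₀. In the first case slack δ in each variable
  -- bounds p, q and the denominator. In the second the explicit bound near the endpoints applies,
  -- and b₀ makes lam(1 - lam)pq ≤ 1/2.
  refine ⟨max ((M + M + M * M) / (b₀ * δ ^ 2)) (2 * (M' + M' + M' * M')), fun lam hlam => ?_⟩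
  have hmono : ∀ t, t ≤ x + y + 2 * δ → ENNReal.ofReal t < h lam := fun t ht =>
    lt_of_le_of_lt (ENNReal.ofReal_le_ofReal ht) (hh lam hlam)
  have hb0 : 0 ≤ lam * (1 - lam) := mul_nonneg hlam.1 (by linarith [hlam.2])
  have hp0 := gFun_nonneg hlam hx (hmono x (by linarith))
  have hq0 := gFun_nonneg hlam hy (hmono y (by linarith))
  have h1 := gFun_mul_lt hlam (by linarith : 0 ≤ x + δ) (by linarith : 0 ≤ y + δ)
    (hmono _ (by linarith))
  have h2 := gFun_add_le hlam hx hδ.le (hmono _ (by linarith))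
  have h3 := gFun_add_le hlam hy hδ.le (hmono _ (by linarith))
  set p := gFun lam x with hp
  set q := gFun lam y with hq
  set b := lam * (1 - lam) with hb
  have h4 : b * ((p + δ) * (q + δ)) < 1 := by
    refine lt_of_le_of_lt ?_ h1
    have := gFun_nonneg hlam (by linarith : 0 ≤ x + δ) (hmono _ (by linarith))
    gcongr
  have hbpd : 0 ≤ b * (p * δ) := by positivity
  have hbqd : 0 ≤ b * (q * δ) := by positivity
  have hbpq : 0 ≤ b * (p * q) := by positivity
  have hbdd : 0 ≤ b * (δ * δ) := by positivity
  have h5 : b * (p * δ) ≤ 1 := by nlinarith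
  have h6 : b * (q * δ) ≤ 1 := by nlinarith
  have h7 : b * (δ * δ) < 1 - b * (p * q) := by nlinarith
  refine ⟨by linarith, ?_⟩
  rw [div_le_iff₀ (by linarith)]
  rcases le_or_gt b₀ b with hcase | hcase
  · have hpM : p ≤ M := by
      rw [hM, le_div_iff₀ (by positivity)]
      nlinarith [mul_nonneg hp0 hδ.le]
    have hqM : q ≤ M := by
      rw [hM, le_div_iff₀ (by positivity)]
      nlinarith [mul_nonneg hq0 hδ.le]
    have hK : 0 ≤ (M + M + M * M) / (b₀ * δ ^ 2) := by positivity
    calc p + q + p * q ≤ M + M + M * M := by gcongr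
      _ = (M + M + M * M) / (b₀ * δ ^ 2) * (b₀ * δ ^ 2) := by field_simp
      _ ≤ (M + M + M * M) / (b₀ * δ ^ 2) * (1 - b * (p * q)) := by
          apply mul_le_mul_of_nonneg_left _ hK
          nlinarith [mul_pos hδ hδ]
      _ ≤ _ := by
          apply mul_le_mul_of_nonneg_right (le_max_left _ _)
          linarith
  · have hpM : p ≤ 4 * Real.exp x := by
      refine gFun_le_of_small hlam hx (hcase.le.trans ?_)
      rw [hb₀]
      have := Real.exp_le_exp.2 (by linarith : -(x + y) ≤ -x)
      linarith
    have hqM : q ≤ 4 * Real.exp y := by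
      refine gFun_le_of_small hlam hy (hcase.le.trans ?_)
      rw [hb₀]
      have := Real.exp_le_exp.2 (by linarith : -(x + y) ≤ -y)
      linarith
    have hpq : b * (p * q) ≤ 1 / 2 := by
      calc b * (p * q) ≤ b₀ * ((4 * Real.exp x) * (4 * Real.exp y)) := by gcongr
        _ = Real.exp (-(x + y)) * Real.exp (x + y) / 2 := by
            rw [hb₀, Real.exp_add x y]; ring
        _ = 1 / 2 := by rw [← Real.exp_add]; simp
    have hpM' : p ≤ M' := by
      refine hpM.trans ?_
      have := Real.exp_le_exp.2 (by linarith : x ≤ x + y)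
      rw [hM']; linarith
    have hqM' : q ≤ M' := by
      refine hqM.trans ?_
      have := Real.exp_le_exp.2 (by linarith : y ≤ x + y)
      rw [hM']; linarith
    have hM'0 : 0 ≤ M' := by positivity
    calc p + q + p * q ≤ M' + M' + M' * M' := by gcongr
      _ = 2 * (M' + M' + M' * M') * (1 / 2) := by ring
      _ ≤ 2 * (M' + M' + M' * M') * (1 - b * (p * q)) := by
          gcongr; linarith
      _ ≤ _ := by
          apply mul_le_mul_of_nonneg_right (le_max_right _ _)
          linarith

lemma frac_g_eq {lam x y : ℝ} (hlam : lam ∈ Icc (0 : ℝ) 1) (hx0 : 0 ≤ x) (hy0 : 0 ≤ y)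
    (hx : ENNReal.ofReal x < h lam) (hy : ENNReal.ofReal y < h lam)
    (hpos : 0 < 1 - lam * (1 - lam) * (gFun lam x * gFun lam y)) :
    frac lam (g lam (ENNReal.ofReal x)) (g lam (ENNReal.ofReal y)) =
      ENNReal.ofReal ((gFun lam x + gFun lam y + gFun lam x * gFun lam y) /
        (1 - lam * (1 - lam) * (gFun lam x * gFun lam y))) := by
  have hb0 : 0 ≤ lam * (1 - lam) := mul_nonneg hlam.1 (by linarith [hlam.2])
  have hp0 := gFun_nonneg hlam hx0 hx
  have hq0 := gFun_nonneg hlam hy0 hy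
  rw [g_eq_gFun hlam hx0 hx, g_eq_gFun hlam hy0 hy, frac, ENNReal.ofReal_div_of_pos hpos,
    ENNReal.ofReal_sub _ (by positivity), ENNReal.ofReal_mul hb0, ENNReal.ofReal_mul hp0,
    ENNReal.ofReal_add (by positivity) (by positivity), ENNReal.ofReal_add hp0 hq0,
    ENNReal.ofReal_mul hp0, ENNReal.ofReal_one]

end Uniform

/-! ### Evaluation of formal series in a Banach algebra -/

section Evaluation

variable {A : Type*} [NormedRing A] [NormedAlgebra ℝ A] [CompleteSpace A]

/-- The term of a word in the evaluation of a formal series at `X, Y`. -/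
def wordTerm (X Y : A) (F : NCSeries (Fin 2)) (l : List (Fin 2)) : A :=
  wordCoeff F (FreeMonoid.ofList l) • (l.map (letter X Y)).prod

/-- The value of a formal series at `X, Y`. -/
def evalSeries (X Y : A) (F : NCSeries (Fin 2)) : A := ∑' l, wordTerm X Y F l

omit [CompleteSpace A] in
lemma summable_norm_wordTerm {X Y : A} {F : NCSeries (Fin 2)}
    (hF : wnorm ‖X‖ₑ ‖Y‖ₑ ⊤ F ≠ ⊤) : Summable fun l => ‖wordTerm X Y F l‖ := by
  have h : ∑' l, ‖wordTerm X Y F l‖ₑ ≠ ⊤ := by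
    -- The summand ‖1‖ pays for the empty word, the summand 1 for all others.
    have hle : ∑' l, ‖wordTerm X Y F l‖ₑ ≤ (1 + ‖(1 : A)‖ₑ) * wnorm ‖X‖ₑ ‖Y‖ₑ ⊤ F := by
      rw [wnorm, ← ENNReal.tsum_mul_left]
      refine ENNReal.tsum_le_tsum fun l => ?_
      rw [if_pos le_top, wordTerm, enorm_smul, Real.enorm_eq_ofReal_abs, mul_left_comm]
      refine mul_le_mul' le_rfl ?_
      by_cases hl : l = []
      · subst hl
        simp [wordWt]
      · refine (enorm_prod_letter_le X Y l hl).trans ?_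
        rw [wordWt, add_mul, one_mul]
        exact le_self_add
    refine ne_top_of_le_ne_top (ENNReal.mul_ne_top ?_ hF) hle
    exact ENNReal.add_ne_top.2 ⟨ENNReal.one_ne_top, enorm_ne_top⟩
  have := tsum_enorm_ne_top_iff_summable_norm.1 h
  exact this

lemma summable_wordTerm {X Y : A} {F : NCSeries (Fin 2)} (hF : wnorm ‖X‖ₑ ‖Y‖ₑ ⊤ F ≠ ⊤) :
    Summable (wordTerm X Y F) := (summable_norm_wordTerm hF).of_norm

lemma evalSeries_add {X Y : A} {F G : NCSeries (Fin 2)} (hF : wnorm ‖X‖ₑ ‖Y‖ₑ ⊤ F ≠ ⊤)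
    (hG : wnorm ‖X‖ₑ ‖Y‖ₑ ⊤ G ≠ ⊤) :
    evalSeries X Y (F + G) = evalSeries X Y F + evalSeries X Y G := by
  rw [evalSeries, evalSeries, evalSeries, ← (summable_wordTerm hF).tsum_add (summable_wordTerm hG)]
  refine tsum_congr fun l => ?_
  rw [wordTerm, wordCoeff_add, add_smul]
  rfl

omit [CompleteSpace A] in
lemma evalSeries_smul (X Y : A) (c : ℝ) (F : NCSeries (Fin 2)) :
    evalSeries X Y (c • F) = c • evalSeries X Y F := by
  rw [evalSeries, evalSeries, ← tsum_const_smul'']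
  refine tsum_congr fun l => ?_
  rw [wordTerm, wordCoeff_smul, mul_smul]
  rfl

omit [CompleteSpace A] in
lemma evalSeries_one (X Y : A) : evalSeries X Y 1 = 1 := by
  rw [evalSeries, tsum_eq_single ([] : List (Fin 2))]
  · rw [wordTerm, wordCoeff_one]; simp
  · intro l hl
    rw [wordTerm, wordCoeff_one, if_neg hl, zero_smul]

/-- The Cauchy product of two absolutely convergent families, regrouped by the concatenated word. -/
lemma evalSeries_mul {X Y : A} {F G : NCSeries (Fin 2)} (hF : Homog F)
    (hF' : wnorm ‖X‖ₑ ‖Y‖ₑ ⊤ F ≠ ⊤) (hG : wnorm ‖X‖ₑ ‖Y‖ₑ ⊤ G ≠ ⊤) :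
    evalSeries X Y (F * G) = evalSeries X Y F * evalSeries X Y G := by
  have hF1 := summable_norm_wordTerm hF'
  have hG1 := summable_norm_wordTerm hG
  have hs := summable_mul_of_summable_norm hF1 hG1
  have hs' : Summable fun c : Σ l : List (Fin 2), Fin (l.length + 1) =>
      wordTerm X Y F (splitEquiv (Fin 2) c).1 * wordTerm X Y G (splitEquiv (Fin 2) c).2 :=
    (splitEquiv (Fin 2)).summable_iff.2 hs
  rw [evalSeries, evalSeries, evalSeries, tsum_mul_tsum_of_summable_norm hF1 hG1,
    ← (splitEquiv (Fin 2)).tsum_eq, hs'.tsum_sigma' (fun _ => Summable.of_finite)]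
  refine tsum_congr fun l => ?_
  rw [tsum_fintype, wordTerm, wordCoeff_mul hF, Finset.sum_smul, Finset.sum_range]
  refine Finset.sum_congr rfl fun k _ => ?_
  show _ = wordTerm X Y F (l.take k) * wordTerm X Y G (l.drop k)
  rw [wordTerm, wordTerm, smul_mul_smul_comm, ← List.prod_append, ← List.map_append,
    List.take_append_drop]

omit [CompleteSpace A] in
lemma evalSeries_expVar (X Y : A) (c : Fin 2) :
    evalSeries X Y (expVar c) = NormedSpace.exp (letter X Y c) := by
  have hinj : Function.Injective fun n : ℕ => List.replicate n c := fun m n h => by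
    simpa using congrArg List.length h
  rw [evalSeries, ← hinj.tsum_eq, NormedSpace.exp_eq_tsum ℝ]
  · refine tsum_congr fun n => ?_
    rw [wordTerm, wordCoeff_expVar, List.length_replicate, if_pos rfl, List.map_replicate,
      List.prod_replicate]
  · intro l hl
    rw [Function.mem_support, wordTerm, wordCoeff_expVar] at hl
    by_cases h : l = List.replicate l.length c
    · exact ⟨l.length, h.symm⟩
    · rw [if_neg h, zero_smul] at hl
      exact absurd rfl hl

lemma wnorm_expVar_ne_top {x y : ℝ≥0∞} (hx : x ≠ ⊤) (hy : y ≠ ⊤) (c : Fin 2) :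
    wnorm x y ⊤ (expVar c) ≠ ⊤ := by
  rw [← substVar_exp, wnorm_substVar]
  have hz : (if c = 0 then x else y) ≠ ⊤ := by split_ifs <;> assumption
  obtain ⟨t, ht0, ht⟩ : ∃ t : ℝ, 0 ≤ t ∧ (if c = 0 then x else y) = ENNReal.ofReal t :=
    ⟨_, ENNReal.toReal_nonneg, (ENNReal.ofReal_toReal hz).symm⟩
  rw [ht]
  have : ∀ n : ℕ, ENNReal.ofReal |PowerSeries.coeff n (PowerSeries.exp ℝ)| *
      ENNReal.ofReal t ^ n = ENNReal.ofReal (t ^ n / n.factorial) := by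
    intro n
    rw [← ENNReal.ofReal_pow ht0, ← ENNReal.ofReal_mul (abs_nonneg _), PowerSeries.coeff_exp]
    congr 1
    have : (0 : ℝ) ≤ (n.factorial : ℝ)⁻¹ := by positivity
    simp
    ring
  simp_rw [this]
  rw [← ENNReal.ofReal_tsum_of_nonneg (fun n => by positivity) (Real.summable_pow_div_factorial t)]
  exact ENNReal.ofReal_ne_top

lemma wnorm_one_ne_top (x y : ℝ≥0∞) : wnorm x y ⊤ 1 ≠ ⊤ :=
  ne_top_of_le_ne_top ENNReal.one_ne_top (wnorm_one_le x y ⊤)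

/-- The resolvent in the Banach algebra is the value of the formal resolvent, if the latter
converges absolutely. -/
lemma cayleyResolvent_exp_mul_exp {X Y : A} {lam : ℝ} (hG : Gam lam ‖X‖ₑ ‖Y‖ₑ ≠ ⊤) :
    IsUnit (algebraMap ℝ A lam + (1 - lam) • (NormedSpace.exp X * NormedSpace.exp Y)) ∧
    cayleyResolvent (NormedSpace.exp X * NormedSpace.exp Y) lam =
      evalSeries X Y (cayleyResolvent (expVar (0 : Fin 2) * expVar 1) lam) := by
  rw [Gam_eq_wnorm] at hG
  have hX : wnorm ‖X‖ₑ ‖Y‖ₑ ⊤ (expVar 0) ≠ ⊤ := wnorm_expVar_ne_top enorm_ne_top enorm_ne_top 0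
  have hY : wnorm ‖X‖ₑ ‖Y‖ₑ ⊤ (expVar 1) ≠ ⊤ := wnorm_expVar_ne_top enorm_ne_top enorm_ne_top 1
  have hE : wnorm ‖X‖ₑ ‖Y‖ₑ ⊤ (expVar 0 * expVar 1) ≠ ⊤ :=
    ne_top_of_le_ne_top (ENNReal.mul_ne_top hX hY) (wnorm_mul_le _ _ _ (homog_expVar _) _)
  have hevE : evalSeries X Y (expVar 0 * expVar 1) = NormedSpace.exp X * NormedSpace.exp Y := by
    rw [evalSeries_mul (homog_expVar _) hX hY, evalSeries_expVar, evalSeries_expVar]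
    simp [letter]
  have h1 := wnorm_one_ne_top ‖X‖ₑ ‖Y‖ₑ
  have hu := isUnit_resolventDenom constantCoeff_expVar_mul_expVar lam
  set E := expVar (0 : Fin 2) * expVar 1 with hEdef
  set P := cayleyResolvent E lam with hP
  have hPh : Homog P := homog_expVar_mul_expVar.cayleyResolvent constantCoeff_expVar_mul_expVar lam
  have hden : algebraMap ℝ (NCSeries (Fin 2)) lam + (1 - lam) • E = lam • (1 : NCSeries (Fin 2)) +
      (1 - lam) • E := by rw [Algebra.algebraMap_eq_smul_one]
  have hl1 : wnorm ‖X‖ₑ ‖Y‖ₑ ⊤ (lam • (1 : NCSeries (Fin 2))) ≠ ⊤ := by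
    rw [wnorm_smul]; exact ENNReal.mul_ne_top ENNReal.ofReal_ne_top h1
  have hlE : wnorm ‖X‖ₑ ‖Y‖ₑ ⊤ ((1 - lam) • E) ≠ ⊤ := by
    rw [wnorm_smul]; exact ENNReal.mul_ne_top ENNReal.ofReal_ne_top hE
  have hQ : wnorm ‖X‖ₑ ‖Y‖ₑ ⊤ (lam • (1 : NCSeries (Fin 2)) + (1 - lam) • E) ≠ ⊤ :=
    ne_top_of_le_ne_top (ENNReal.add_ne_top.2 ⟨hl1, hlE⟩) (wnorm_add_le _ _ _ _ _)
  have hm1 : wnorm ‖X‖ₑ ‖Y‖ₑ ⊤ ((-1 : ℝ) • (1 : NCSeries (Fin 2))) ≠ ⊤ := by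
    rw [wnorm_smul]; exact ENNReal.mul_ne_top ENNReal.ofReal_ne_top h1
  have hQh : Homog (lam • (1 : NCSeries (Fin 2)) + (1 - lam) • E) :=
    (homog_one.smul _).add (homog_expVar_mul_expVar.smul _)
  set e := NormedSpace.exp X * NormedSpace.exp Y with he
  have hevQ : evalSeries X Y (lam • (1 : NCSeries (Fin 2)) + (1 - lam) • E) =
      algebraMap ℝ A lam + (1 - lam) • e := by
    rw [evalSeries_add hl1 hlE, evalSeries_smul, evalSeries_smul, evalSeries_one, hevE,
      Algebra.algebraMap_eq_smul_one]
  have hevE1 : evalSeries X Y (E - 1) = e - 1 := by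
    have : E - 1 = E + (-1 : ℝ) • (1 : NCSeries (Fin 2)) := by module
    rw [this, evalSeries_add hE hm1, evalSeries_smul, evalSeries_one, hevE]
    module
  have r1 := cayleyResolvent_mul hu
  have r2 := mul_cayleyResolvent hu
  rw [hden] at r1 r2
  have s1 : evalSeries X Y P * (algebraMap ℝ A lam + (1 - lam) • e) = e - 1 := by
    rw [← hevQ, ← evalSeries_mul hPh hG hQ, r1, hevE1]
  have s2 : (algebraMap ℝ A lam + (1 - lam) • e) * evalSeries X Y P = e - 1 := by
    rw [← hevQ, ← evalSeries_mul hQh hQ hG, r2, hevE1]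
  have hunit : IsUnit (algebraMap ℝ A lam + (1 - lam) • e) := by
    -- With Q = 1 + (1 - lam)(e - 1) and QP = PQ = e - 1 after evaluation, 1 - (1 - lam)P is the
    -- inverse of Q.
    refine ⟨⟨_, 1 - (1 - lam) • evalSeries X Y P, ?_, ?_⟩, rfl⟩
    · rw [mul_sub, mul_one, mul_smul_comm, s2, Algebra.algebraMap_eq_smul_one]
      module
    · rw [sub_mul, one_mul, smul_mul_assoc, s1, Algebra.algebraMap_eq_smul_one]
      module
  exact ⟨hunit, (eq_cayleyResolvent hunit s1).symm⟩

/-- The resolvent series converges to the resolvent. -/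
lemma hasSum_resolventTerm {X Y : A} {lam : ℝ} (hlam : lam ∈ Icc (0 : ℝ) 1)
    (hG : Gam lam ‖X‖ₑ ‖Y‖ₑ ≠ ⊤) :
    HasSum (fun n : ℕ => resolventTerm lam (Icc 0 2) (concatDensity X Y) (n + 1))
      (cayleyResolvent (NormedSpace.exp X * NormedSpace.exp Y) lam) := by
  rw [(cayleyResolvent_exp_mul_exp hG).2]
  rw [Gam_eq_wnorm] at hG
  have hs := (summable_wordTerm hG).hasSum
  rw [← (List.equivSigmaTuple (α := Fin 2)).symm.hasSum_iff] at hs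
  have hs2 := hs.sigma fun n => hasSum_fintype _
  have h0 : ∑ v : Fin 0 → Fin 2, (wordTerm X Y
      (cayleyResolvent (expVar (0 : Fin 2) * expVar 1) lam) ∘
        (List.equivSigmaTuple (α := Fin 2)).symm) ⟨0, v⟩ = 0 := by
    refine Finset.sum_eq_zero fun v _ => ?_
    show wordTerm X Y _ (List.ofFn v) = 0
    rw [List.ofFn_zero, wordTerm, wordCoeff_cayleyResolvent homog_expVar_mul_expVar
      constantCoeff_expVar_mul_expVar, wordCoeff_sub_one_nil constantCoeff_expVar_mul_expVar,
      List.length_nil, Finset.sum_range_one, List.take_zero,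
      wordCoeff_sub_one_nil constantCoeff_expVar_mul_expVar, zero_mul, mul_zero, add_zero,
      zero_smul]
  rw [← hasSum_nat_add_iff' 1] at hs2
  rw [Finset.sum_range_one, h0, sub_zero] at hs2
  refine Eq.mpr (congrArg (fun f => HasSum f _) (funext fun n => ?_)) hs2
  rw [resolventTerm_eq_sum hlam]
  refine Finset.sum_congr rfl fun v _ => ?_
  show _ = wordTerm X Y _ (List.ofFn v)
  rw [wordTerm, List.map_ofFn]
  rfl

-- For t ≤ 0 the parameter lam = -t / (1 - t) lies in [0, 1], and t - a is the nonzero multiple -(1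
-- - t) of lam + (1 - lam)a.
omit [CompleteSpace A] in
lemma logable_of_isUnit {a : A}
    (ha : ∀ lam ∈ Icc (0 : ℝ) 1, IsUnit (algebraMap ℝ A lam + (1 - lam) • a)) : Logable a := by
  rw [Logable, Set.disjoint_left]
  intro t ht ht0
  rw [mem_Iic] at ht0
  apply ht
  have h1 : 0 < 1 - t := by linarith
  have hl : -t / (1 - t) ∈ Icc (0 : ℝ) 1 :=
    ⟨div_nonneg (by linarith) h1.le, by rw [div_le_one h1]; linarith⟩
  have hu := ha _ hl
  have e : algebraMap ℝ A t - a = (-(1 - t)) •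
      (algebraMap ℝ A (-t / (1 - t)) + (1 - -t / (1 - t)) • a) := by
    rw [Algebra.algebraMap_eq_smul_one, Algebra.algebraMap_eq_smul_one, smul_add, smul_smul,
      smul_smul]
    have e1 : -(1 - t) * (-t / (1 - t)) = t := by field_simp
    have e2 : -(1 - t) * (1 - -t / (1 - t)) = -1 := by field_simp; ring
    rw [e1, e2]; module
  show IsUnit (algebraMap ℝ A t - a)
  rw [e]
  exact hu.smul (Units.mk0 (-(1 - t)) (neg_ne_zero.2 h1.ne'))

/-- The Baker–Campbell–Hausdorff formula from a uniform bound on the resolvent series. -/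
lemma bch_of_bounded {X Y : A} {K : NNReal}
    (hK : ∀ lam ∈ Icc (0 : ℝ) 1, Gam lam ‖X‖ₑ ‖Y‖ₑ ≤ K) :
    (Summable fun n : ℕ => ‖bchTerm X Y (n + 1)‖) ∧
      Logable (NormedSpace.exp X * NormedSpace.exp Y) ∧
      HasSum (fun n : ℕ => bchTerm X Y (n + 1))
        (blog (NormedSpace.exp X * NormedSpace.exp Y)) := by
  have hG : ∀ lam ∈ Icc (0 : ℝ) 1, Gam lam ‖X‖ₑ ‖Y‖ₑ ≠ ⊤ := fun lam hlam =>
    ne_top_of_le_ne_top ENNReal.coe_ne_top (hK lam hlam)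
  let F : ℕ → ℝ → A := fun n lam => resolventTerm lam (Icc 0 2) (concatDensity X Y) (n + 1)
  have hF : ∀ n, IntegrableOn (F n) (Ioc 0 1) := fun n =>
    ((continuousOn_resolventTerm X Y n).integrableOn_compact isCompact_Icc).mono_set
      Ioc_subset_Icc_self
  have hb : ∀ lam ∈ Icc (0 : ℝ) 1, ∀ N : ℕ, ∑ n ∈ Finset.range N, ‖F n lam‖ ≤ K := by
    intro lam hlam N
    have h1 : ∑ n ∈ Finset.range N, ‖F n lam‖ₑ ≤ K :=
      (ENNReal.sum_le_tsum _).trans ((tsum_enorm_resolventTerm_le hlam X Y).trans (hK lam hlam))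
    simp only [enorm_eq_nnnorm] at h1
    have h2 : ∑ n ∈ Finset.range N, ‖F n lam‖₊ ≤ K := by exact_mod_cast h1
    have h3 := NNReal.coe_le_coe.2 h2
    push_cast at h3
    exact h3
  -- The uniform bound K on partial sums survives integration over an interval of length 1; this
  -- licenses exchanging sum and integral.
  have hsum : Summable fun n => ∫ lam in Ioc (0 : ℝ) 1, ‖F n lam‖ := by
    refine summable_of_sum_range_le (c := K) (fun n => integral_nonneg fun _ => norm_nonneg _)
      fun N => ?_
    rw [← integral_finsetSum _ fun n _ => (hF n).norm]
    calc _ ≤ ∫ lam in Ioc (0 : ℝ) 1, (K : ℝ) := by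
          refine setIntegral_mono_on (integrable_finsetSum _ fun n _ => (hF n).norm)
            (integrableOn_const (by simp)) measurableSet_Ioc fun lam hlam => ?_
          exact hb lam (Ioc_subset_Icc_self hlam) N
      _ = K := by simp
  have hbch : ∀ n, bchTerm X Y (n + 1) = ∫ lam in Ioc (0 : ℝ) 1, F n lam := by
    intro n
    rw [← integral_resolventTerm, intervalIntegral.integral_of_le zero_le_one]
  refine ⟨?_, ?_, ?_⟩
  · refine Summable.of_nonneg_of_le (fun _ => norm_nonneg _) (fun n => ?_) hsum
    rw [hbch]
    exact norm_integral_le_integral_norm _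
  · exact logable_of_isUnit fun lam hlam => (cayleyResolvent_exp_mul_exp (hG lam hlam)).1
  · have h := hasSum_integral_of_summable_integral_norm (fun n => hF n) hsum
    simp_rw [← hbch] at h
    have e : blog (NormedSpace.exp X * NormedSpace.exp Y) =
        ∫ lam in Ioc (0 : ℝ) 1, ∑' n, F n lam := by
      unfold blog
      rw [intervalIntegral.integral_of_le zero_le_one]
      refine setIntegral_congr_fun measurableSet_Ioc fun lam hlam => ?_
      have hlam' := Ioc_subset_Icc_self hlam
      exact (hasSum_resolventTerm hlam' (hG lam hlam')).tsum_eq.symm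
    rw [e]
    exact h

end Evaluation

/-! ### The minimum of `h` -/

section Minimum

lemma nonneg_of_hasDerivAt_nonneg {f f' : ℝ → ℝ} (h0 : 0 ≤ f 0)
    (hf : ∀ x, HasDerivAt f (f' x) x) (hf' : ∀ x, 0 ≤ x → 0 ≤ f' x) :
    ∀ x, 0 ≤ x → 0 ≤ f x := by
  have hm : MonotoneOn f (Ici 0) := by
    refine monotoneOn_of_deriv_nonneg (convex_Ici 0)
      (fun x _ => (hf x).continuousAt.continuousWithinAt)
      (fun x _ => (hf x).differentiableAt.differentiableWithinAt) fun x hx => ?_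
    rw [(hf x).deriv]
    rw [interior_Ici] at hx
    exact hf' x (le_of_lt hx)
  exact fun x hx => h0.trans (hm self_mem_Ici hx hx)

/-- The Taylor polynomials of the sine of degree `2 n - 1`. -/
def sinTaylor (n : ℕ) (x : ℝ) : ℝ :=
  ∑ k ∈ Finset.range n, (-1) ^ k / ((2 * k + 1).factorial : ℝ) * x ^ (2 * k + 1)

/-- The Taylor polynomials of the cosine of degree `2 n - 2`. -/
def cosTaylor (n : ℕ) (x : ℝ) : ℝ :=
  ∑ k ∈ Finset.range n, (-1) ^ k / ((2 * k).factorial : ℝ) * x ^ (2 * k)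

lemma hasDerivAt_sinTaylor (n : ℕ) (x : ℝ) : HasDerivAt (sinTaylor n) (cosTaylor n x) x := by
  have : ∀ k ∈ Finset.range n, HasDerivAt
      (fun x : ℝ => (-1) ^ k / ((2 * k + 1).factorial : ℝ) * x ^ (2 * k + 1))
      ((-1) ^ k / ((2 * k).factorial : ℝ) * x ^ (2 * k)) x := by
    intro k _
    refine ((hasDerivAt_pow (2 * k + 1) x).const_mul _).congr_deriv ?_
    rw [Nat.factorial_succ]
    have := Nat.factorial_ne_zero (2 * k)
    push_cast
    have h2 : (2 * (k : ℝ) + 1) ≠ 0 := by positivity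
    field_simp
  exact HasDerivAt.fun_sum this

lemma hasDerivAt_cosTaylor (n : ℕ) (x : ℝ) :
    HasDerivAt (cosTaylor (n + 1)) (-sinTaylor n x) x := by
  have : ∀ k ∈ Finset.range n, HasDerivAt
      (fun x : ℝ => (-1) ^ (k + 1) / ((2 * (k + 1)).factorial : ℝ) * x ^ (2 * (k + 1)))
      (-((-1) ^ k / ((2 * k + 1).factorial : ℝ) * x ^ (2 * k + 1))) x := by
    intro k _
    refine ((hasDerivAt_pow (2 * (k + 1)) x).const_mul _).congr_deriv ?_
    rw [show 2 * (k + 1) = (2 * k + 1) + 1 by ring, Nat.factorial_succ]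
    have := Nat.factorial_ne_zero (2 * k + 1)
    push_cast
    have h2 : (2 * (k : ℝ) + 1 + 1) ≠ 0 := by positivity
    field_simp
    ring
  have e : cosTaylor (n + 1) = fun x => (∑ k ∈ Finset.range n,
      (-1) ^ (k + 1) / ((2 * (k + 1)).factorial : ℝ) * x ^ (2 * (k + 1))) + 1 := by
    ext x; simp [cosTaylor, Finset.sum_range_succ']
  rw [e]
  refine ((HasDerivAt.fun_sum this).add_const 1).congr_deriv ?_
  simp [sinTaylor]

/-- The Taylor polynomials of the sine and the cosine are alternately upper and lower bounds. -/
lemma taylor_bounds (n : ℕ) :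
    (∀ x, 0 ≤ x → 0 ≤ (-1) ^ n * (cosTaylor (n + 1) x - Real.cos x)) ∧
      ∀ x, 0 ≤ x → 0 ≤ (-1) ^ n * (sinTaylor (n + 1) x - Real.sin x) := by
  have hs : ∀ n, (∀ x, 0 ≤ x → 0 ≤ (-1) ^ n * (cosTaylor (n + 1) x - Real.cos x)) →
      ∀ x, 0 ≤ x → 0 ≤ (-1) ^ n * (sinTaylor (n + 1) x - Real.sin x) := fun n hc =>
    nonneg_of_hasDerivAt_nonneg (by simp [sinTaylor])
      (fun x => ((hasDerivAt_sinTaylor (n + 1) x).sub (Real.hasDerivAt_sin x)).const_mul _) hc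
  induction n with
  | zero =>
    have : ∀ x : ℝ, 0 ≤ x → 0 ≤ (-1 : ℝ) ^ 0 * (cosTaylor (0 + 1) x - Real.cos x) := by
      intro x _
      simpa [cosTaylor] using Real.cos_le_one x
    exact ⟨this, hs 0 this⟩
  | succ n ih =>
    have : ∀ x : ℝ, 0 ≤ x →
        0 ≤ (-1 : ℝ) ^ (n + 1) * (cosTaylor (n + 1 + 1) x - Real.cos x) := by
      refine nonneg_of_hasDerivAt_nonneg ?_
        (fun x => ((hasDerivAt_cosTaylor (n + 1) x).sub (Real.hasDerivAt_cos x)).const_mul _) ?_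
      · simp [cosTaylor, Finset.sum_range_succ']
      · intro x hx
        have := ih.2 x hx
        rw [pow_succ]
        linarith
    exact ⟨this, hs _ this⟩

lemma sin_le_taylor {x : ℝ} (hx : 0 ≤ x) :
    Real.sin x ≤ x - x ^ 3 / 6 + x ^ 5 / 120 - x ^ 7 / 5040 + x ^ 9 / 362880 := by
  have := (taylor_bounds 4).2 x hx
  simp only [sinTaylor, Finset.sum_range_succ, Finset.sum_range_zero, Nat.factorial] at this
  norm_num at this
  linarith

lemma taylor_le_sin {x : ℝ} (hx : 0 ≤ x) :
    x - x ^ 3 / 6 + x ^ 5 / 120 - x ^ 7 / 5040 ≤ Real.sin x := by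
  have := (taylor_bounds 3).2 x hx
  simp only [sinTaylor, Finset.sum_range_succ, Finset.sum_range_zero, Nat.factorial] at this
  norm_num at this
  linarith

/-- The values of `h` where the discriminant is negative, in terms of
`φ = arctan (√(-disc) / |1 - 2 lam|)`. -/
def hAngle (φ : ℝ) : ℝ := 2 * φ * √(1 + Real.cos φ ^ 2) / Real.sin φ

/-- Here s² = 1 - 2a², so tan φ = s / a gives sin²φ = s² / (1 - a²) and 1 + cos²φ = 1 / (1 - a²),
whence 1 / s = √(1 + cos²φ) / sin φ. The value lam = 1/2 corresponds to φ = π / 2. -/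
lemma h_eq_hAngle {lam : ℝ} (hlam : lam ∈ Icc (0 : ℝ) 1) (hd : disc lam < 0) :
    ∃ φ ∈ Ioc 0 (Real.pi / 2), h lam = ENNReal.ofReal (hAngle φ) := by
  have h0 : lam ≠ 0 := by rintro rfl; norm_num [disc] at hd
  have h1 : lam ≠ 1 := by rintro rfl; norm_num [disc] at hd
  by_cases hh : lam = 1 / 2
  · refine ⟨Real.pi / 2, ⟨by positivity, le_rfl⟩, ?_⟩
    unfold h
    rw [if_neg (by tauto), if_pos hh]
    congr 1
    simp [hAngle]
    ring
  · set a := |1 - 2 * lam| with ha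
    set s := √(-disc lam) with hs
    have ha0 : 0 < a := abs_pos.2 fun h => hh (by linarith)
    have hs0 : 0 < s := Real.sqrt_pos.2 (by linarith)
    have hsq : s ^ 2 = 1 - 2 * a ^ 2 := by
      rw [hs, Real.sq_sqrt (by linarith), ha, abs_sq_eq, disc_eq]; ring
    have h1a : 0 < 1 - a ^ 2 := by nlinarith
    have e : 1 + (s / a) ^ 2 = (1 - a ^ 2) / a ^ 2 := by
      field_simp; linarith
    refine ⟨Real.arctan (s / a), ⟨Real.arctan_pos.2 (by positivity), (Real.arctan_lt_pi_div_two _).le⟩, ?_⟩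
    unfold h
    rw [if_neg (by tauto), if_neg hh, if_pos hd]
    congr 1
    rw [hAngle, Real.cos_arctan, Real.sin_arctan, e, Real.sqrt_div h1a.le, Real.sqrt_sq ha0.le]
    have hr : 0 < √(1 - a ^ 2) := Real.sqrt_pos.2 h1a
    have e2 : 1 + (1 / (√(1 - a ^ 2) / a)) ^ 2 = 1 / (1 - a ^ 2) := by
      rw [one_div_div, div_pow, Real.sq_sqrt h1a.le]; field_simp; ring
    rw [e2, Real.sqrt_div zero_le_one, Real.sqrt_one, ← ha, ← hs]
    field_simp

lemma exists_h_eq_hAngle {φ : ℝ} (hφ : φ ∈ Ioc 0 (Real.pi / 2)) :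
    ∃ lam ∈ Icc (0 : ℝ) 1, h lam = ENNReal.ofReal (hAngle φ) := by
  rcases hφ.2.eq_or_lt with rfl | hlt
  · refine ⟨1 / 2, by constructor <;> norm_num, ?_⟩
    unfold h
    rw [if_neg (by norm_num), if_pos rfl]
    congr 1
    simp [hAngle]
    ring
  · have hc : 0 < Real.cos φ := Real.cos_pos_of_mem_Ioo ⟨by linarith [hφ.1, Real.pi_pos], hlt⟩
    have hs : 0 < Real.sin φ := Real.sin_pos_of_pos_of_lt_pi hφ.1 (by linarith [Real.pi_pos])
    have hr : 0 < √(1 + Real.cos φ ^ 2) := Real.sqrt_pos.2 (by positivity)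
    have hr2 : √(1 + Real.cos φ ^ 2) ^ 2 = 1 + Real.cos φ ^ 2 := Real.sq_sqrt (by positivity)
    have hsc := Real.sin_sq_add_cos_sq φ
    set r := √(1 + Real.cos φ ^ 2) with hrdef
    -- This inverts the parametrization cos²φ = a² / (1 - a²), and lam = (1 - a) / 2.
    set a := Real.cos φ / r with ha
    have ha0 : 0 < a := by positivity
    have ha1 : a < 1 := by
      rw [ha, div_lt_one hr]; nlinarith
    have habs : |1 - 2 * ((1 - a) / 2)| = a := by
      rw [show 1 - 2 * ((1 - a) / 2) = a by ring, abs_of_pos ha0]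
    have hdisc : -disc ((1 - a) / 2) = (Real.sin φ / r) ^ 2 := by
      have : disc ((1 - a) / 2) = 2 * a ^ 2 - 1 := by unfold disc; ring
      rw [this, ha, div_pow, div_pow, hr2]
      field_simp
      linarith
    have hneg : disc ((1 - a) / 2) < 0 := by
      have : 0 < (Real.sin φ / r) ^ 2 := by positivity
      linarith
    refine ⟨(1 - a) / 2, ⟨by linarith, by linarith⟩, ?_⟩
    unfold h
    rw [if_neg (by rintro (h | h) <;> linarith), if_neg (by intro h; linarith), if_pos hneg,
      habs, hdisc, Real.sqrt_sq (by positivity), hAngle]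
    congr 1
    have : Real.sin φ / r / a = Real.tan φ := by
      rw [Real.tan_eq_sin_div_cos, ha]; field_simp
    rw [this, Real.arctan_tan (by linarith [hφ.1, Real.pi_pos]) hlt, ← hrdef]
    field_simp

lemma artanh_lower {u : ℝ} (hu0 : 0 ≤ u) (hu1 : u < 1) :
    u + u ^ 3 / 3 + u ^ 5 / 5 ≤ Real.artanh u := by
  have hs := Real.hasSum_log_sub_log_of_abs_lt_one (x := u) (by rwa [abs_of_nonneg hu0])
  have := hs.summable.sum_le_tsum (Finset.range 3) (fun k _ => by positivity)
  rw [hs.tsum_eq, ← Real.log_div (by linarith) (by linarith)] at this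
  rw [Real.artanh_eq_half_log ⟨by linarith, hu1.le⟩]
  norm_num [Finset.sum_range_succ] at this
  linarith

lemma h_lower_of_disc_nonneg {lam : ℝ} (hlam : lam ∈ Icc (0 : ℝ) 1) (hd : 0 ≤ disc lam) :
    ENNReal.ofReal (2 * √2) ≤ h lam := by
  unfold h
  split_ifs with h1 h2 h3 h4
  · exact le_top
  · rw [h2] at hd; norm_num [disc] at hd
  · linarith
  · exact le_rfl
  · have hd0 : 0 < disc lam := lt_of_le_of_ne hd (Ne.symm h4)
    refine ENNReal.ofReal_le_ofReal ?_
    set a := |1 - 2 * lam| with ha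
    set s := √(disc lam) with hs
    have ha0 : 0 < a := abs_pos.2 fun h => h2 (by linarith)
    have hs0 : 0 < s := Real.sqrt_pos.2 hd0
    have hsq : s ^ 2 = 2 * a ^ 2 - 1 := by
      rw [hs, Real.sq_sqrt hd, ha, abs_sq_eq, disc_eq]; ring
    have ha1 : a < 1 := by
      have h0 : 0 < lam := lt_of_le_of_ne hlam.1 fun h => h1 (Or.inl h.symm)
      have h1 : lam < 1 := lt_of_le_of_ne hlam.2 fun h => h1 (Or.inr h)
      rw [ha, abs_lt]; constructor <;> linarith
    have hu1 : s / a < 1 := by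
      rw [div_lt_one ha0]; nlinarith
    have hu0 : 0 < s / a := by positivity
    have hA := artanh_lower hu0.le hu1
    set u := s / a with hu
    have hsu : s = u * a := by rw [hu]; field_simp
    have hau : a ^ 2 * (2 - u ^ 2) = 1 := by
      rw [hsu] at hsq; linarith
    rw [le_div_iff₀ hs0]
    refine le_trans ?_ (mul_le_mul_of_nonneg_left hA zero_le_two)
    -- By a²(2 - u²) = 1 this is 2 / (2 - z) ≤ (1 + z/3 + z²/5)² with z = u² in (0, 1). Without the
    -- last term it would fail near z = 1.
    have key : √2 * a ≤ 1 + u ^ 2 / 3 + u ^ 4 / 5 := by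
      refine le_of_sq_le_sq ?_ (by positivity)
      rw [mul_pow, Real.sq_sqrt zero_le_two]
      have hz : 0 < 2 - u ^ 2 := by nlinarith
      have : a ^ 2 = 1 / (2 - u ^ 2) := by field_simp; linarith
      rw [this, mul_one_div, div_le_iff₀ hz]
      have hz1 : u ^ 2 < 1 := by nlinarith
      have e4 : u ^ 4 = (u ^ 2) ^ 2 := by ring
      rw [e4]
      have hz0 : 0 < u ^ 2 := by positivity
      generalize u ^ 2 = z at *
      nlinarith [mul_nonneg hz0.le (sub_nonneg.2 hz1.le), mul_nonneg (sq_nonneg z) (sub_nonneg.2 hz1.le),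
        mul_nonneg (pow_nonneg hz0.le 3) (sub_nonneg.2 hz1.le), mul_nonneg (pow_nonneg hz0.le 4) (sub_nonneg.2 hz1.le),
        pow_pos hz0 3, pow_pos hz0 4, pow_pos hz0 5]
    rw [hsu]
    nlinarith [mul_le_mul_of_nonneg_left key hu0.le]

/-- The Taylor polynomial of degree `9` of the sine, as `x * sinPoly (x ^ 2)`. -/
def sinPoly (z : ℝ) : ℝ := 1 - z / 6 + z ^ 2 / 120 - z ^ 3 / 5040 + z ^ 4 / 362880

/-- Division with remainder by (z - 39/40)², where 39/40 is close to the critical z = φ². The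
quotient is grouped into even powers times affine functions positive on the range, and the affine
remainder is positive for z ≥ 0. -/
lemma sinPoly_bound {z : ℝ} (hz0 : 0 ≤ z) (hz : z ≤ 5 / 2) :
    (z + 1.3507 ^ 2) * sinPoly z ^ 2 ≤ 2 := by
  have key : 2 - (z + 1.3507 ^ 2) * sinPoly z ^ 2 = (z - 39 / 40) ^ 2 *
      ((13666930965433565842748153/73987522560000000000000000) - 13210688574465816870953/396361728000000000000000 * z
        + z ^ 2 * (222106536002381273639/83235962880000000000000 - 326914443855703271/2601123840000000000000 * z)
        + z ^ 4 * (3051473152561679/780337152000000000000 - 7129931470597/87787929600000000000 * z)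
        + z ^ 6 * (2003222993/1881169920000000000 - 1/131681894400 * z))
      + 707605097720776171949/41104179200000000000000000 * (z - 39 / 40)
      + 360565476757694741210231/13153337344000000000000000000 := by
    unfold sinPoly; ring
  have hQ : 0 ≤ (13666930965433565842748153/73987522560000000000000000 : ℝ) - 13210688574465816870953/396361728000000000000000 * z
        + z ^ 2 * (222106536002381273639/83235962880000000000000 - 326914443855703271/2601123840000000000000 * z)
        + z ^ 4 * (3051473152561679/780337152000000000000 - 7129931470597/87787929600000000000 * z)
        + z ^ 6 * (2003222993/1881169920000000000 - 1/131681894400 * z) := by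
    refine add_nonneg (add_nonneg (add_nonneg ?_ (mul_nonneg (by positivity) ?_))
      (mul_nonneg (by positivity) ?_)) (mul_nonneg (by positivity) ?_) <;> linarith
  have := mul_nonneg (sq_nonneg (z - 39 / 40)) hQ
  linarith

lemma sin_pos_of_mem_Ioc {φ : ℝ} (hφ : φ ∈ Ioc 0 (Real.pi / 2)) : 0 < Real.sin φ :=
  Real.sin_pos_of_pos_of_lt_pi hφ.1 (by linarith [hφ.2, Real.pi_pos])

lemma hAngle_lower {φ : ℝ} (hφ : φ ∈ Ioc 0 (Real.pi / 2)) : 2.7014 ≤ hAngle φ := by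
  have hs := sin_pos_of_mem_Ioc hφ
  have hφ2 : φ ^ 2 ≤ 5 / 2 := by nlinarith [hφ.1, hφ.2, Real.pi_lt_d2]
  have h1 : Real.sin φ ^ 2 ≤ (φ * sinPoly (φ ^ 2)) ^ 2 := by
    refine pow_le_pow_left₀ hs.le ((sin_le_taylor hφ.1.le).trans (le_of_eq ?_)) 2
    unfold sinPoly; ring
  have h2 := sinPoly_bound (sq_nonneg φ) hφ2
  -- This is the squared claim after writing 1 + cos² = 2 - sin²; note 1.3507 = 2.7014 / 2.
  have h3 : (φ ^ 2 + 1.3507 ^ 2) * Real.sin φ ^ 2 ≤ 2 * φ ^ 2 :=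
    calc _ ≤ (φ ^ 2 + 1.3507 ^ 2) * (φ * sinPoly (φ ^ 2)) ^ 2 := by gcongr
      _ = (φ ^ 2 + 1.3507 ^ 2) * sinPoly (φ ^ 2) ^ 2 * φ ^ 2 := by ring
      _ ≤ 2 * φ ^ 2 := by gcongr
  rw [hAngle, le_div_iff₀ hs]
  have hφ0 := hφ.1
  refine le_of_sq_le_sq ?_ (by positivity)
  rw [mul_pow (2 * φ), Real.sq_sqrt (by positivity), Real.cos_sq']
  linarith

lemma hAngle_upper : (79 / 80 : ℝ) ∈ Ioc (1 / 4) (Real.pi / 2) ∧ hAngle (79 / 80) < 2.7015 := by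
  have hm : (79 / 80 : ℝ) ∈ Ioc (1 / 4) (Real.pi / 2) :=
    ⟨by norm_num, by linarith [Real.pi_gt_three]⟩
  refine ⟨hm, ?_⟩
  have h1 := taylor_le_sin (x := 79 / 80) (by norm_num)
  have h2 : (0.83456 : ℝ) ≤ Real.sin (79 / 80) := le_trans (by norm_num) h1
  have hs : 0 < Real.sin (79 / 80) := by linarith
  rw [hAngle, div_lt_iff₀ hs]
  refine lt_of_pow_lt_pow_left₀ 2 (by positivity) ?_
  rw [mul_pow (2 * (79 / 80)), Real.sq_sqrt (by positivity), Real.cos_sq']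
  nlinarith

/-- Keeps the minimizer away from φ = 0, where the formula is singular, so that compactness of [1/4,
π/2] applies. -/
lemma hAngle_of_small {φ : ℝ} (hφ0 : 0 < φ) (hφ : φ ≤ 1 / 4) : 2.7015 ≤ hAngle φ := by
  have hs := sin_pos_of_mem_Ioc ⟨hφ0, by linarith [Real.pi_gt_three]⟩
  have h1 : Real.sin φ ≤ φ := Real.sin_le hφ0.le
  rw [hAngle, le_div_iff₀ hs]
  refine le_of_sq_le_sq ?_ (by positivity)
  rw [mul_pow (2 * φ), Real.sq_sqrt (by positivity), Real.cos_sq', mul_pow]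
  have h2 : Real.sin φ ^ 2 ≤ φ ^ 2 := pow_le_pow_left₀ hs.le h1 2
  have h3 : φ ^ 2 ≤ 1 / 16 := by nlinarith
  nlinarith [mul_le_mul_of_nonneg_left h2 (sq_nonneg φ), mul_le_mul_of_nonneg_left h3 (sq_nonneg φ)]

lemma continuousOn_hAngle : ContinuousOn hAngle (Icc (1 / 4) (Real.pi / 2)) := by
  unfold hAngle
  refine ContinuousOn.div (by fun_prop) (by fun_prop) fun φ hφ => ?_
  exact (sin_pos_of_mem_Ioc ⟨by linarith [hφ.1], hφ.2⟩).ne'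

theorem exists_isLeast_h : ∃ c : ℝ, IsLeast (h '' Icc 0 1) (ENNReal.ofReal c) ∧
    2.7014 ≤ c ∧ c < 2.7015 := by
  obtain ⟨⟨hm1, hm2⟩, hup⟩ := hAngle_upper
  obtain ⟨φ₀, hφ₀, hmin⟩ := isCompact_Icc.exists_isMinOn
    ⟨79 / 80, hm1.le, hm2⟩ continuousOn_hAngle
  have hlt : hAngle φ₀ < 2.7015 := (hmin ⟨hm1.le, hm2⟩).trans_lt hup
  have hφ₀' : φ₀ ∈ Ioc 0 (Real.pi / 2) := ⟨by linarith [hφ₀.1], hφ₀.2⟩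
  refine ⟨hAngle φ₀, ⟨?_, ?_⟩, hAngle_lower hφ₀', hlt⟩
  · obtain ⟨lam, hlam, he⟩ := exists_h_eq_hAngle hφ₀'
    exact ⟨lam, hlam, he⟩
  · rintro _ ⟨lam, hlam, rfl⟩
    rcases lt_or_ge (disc lam) 0 with hd | hd
    · obtain ⟨φ, hφ, he⟩ := h_eq_hAngle hlam hd
      rw [he]
      refine ENNReal.ofReal_le_ofReal ?_
      rcases le_total φ (1 / 4) with hs | hs
      · exact hlt.le.trans (hAngle_of_small hφ.1 hs)
      · exact hmin ⟨hs, hφ.2⟩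
    · refine le_trans (ENNReal.ofReal_le_ofReal ?_) (h_lower_of_disc_nonneg hlam hd)
      have : (1.4 : ℝ) ≤ √2 := Real.le_sqrt_of_sq_le (by norm_num)
      linarith

end Minimum

end

end MagnusBCH

/-! ### The main theorem -/

theorem mainTheorem7 {A : Type*} [NormedRing A] [NormedAlgebra ℝ A] [CompleteSpace A] (X Y : A) :
    -- the constant: a minimum, `2.7014…`
    (IsLeast (h '' Icc 0 1) C₁ ∧
      ENNReal.ofReal 2.7014 ≤ C₁ ∧ C₁ < ENNReal.ofReal 2.7015) ∧
    -- the estimates, as inequalities in `[0, ∞]`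
    (∀ lam ∈ Icc (0 : ℝ) 1,
      ∑' n : ℕ, ‖resolventTerm lam (Icc 0 2) (concatDensity X Y) (n + 1)‖ₑ
          ≤ Gam lam ‖X‖ₑ ‖Y‖ₑ ∧
        Gam lam ‖X‖ₑ ‖Y‖ₑ ≤ frac lam (rhoTilde lam ‖X‖ₑ) (rhoTilde lam ‖Y‖ₑ) ∧
        frac lam (rhoTilde lam ‖X‖ₑ) (rhoTilde lam ‖Y‖ₑ) ≤ frac lam (g lam ‖X‖ₑ) (g lam ‖Y‖ₑ)) ∧
    -- the Magnus expansion of the concatenation is the Baker–Campbell–Hausdorff series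
    (∀ n : ℕ, magnusTerm (Icc 0 2) (concatDensity X Y) (n + 1) = bchTerm X Y (n + 1)) ∧
    (‖X‖ₑ + ‖Y‖ₑ < C₁ →
      -- the bounds are well defined and finite
      (∀ lam ∈ Icc (0 : ℝ) 1,
        ‖X‖ₑ < h lam ∧ ‖Y‖ₑ < h lam ∧
        ENNReal.ofReal (lam * (1 - lam)) * (g lam ‖X‖ₑ * g lam ‖Y‖ₑ) < 1 ∧
        frac lam (g lam ‖X‖ₑ) (g lam ‖Y‖ₑ) < ⊤) ∧
      -- the resolvent series is bounded uniformly in `lam`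
      (∃ K : NNReal, ∀ lam ∈ Icc (0 : ℝ) 1,
        ∑' n : ℕ, ‖resolventTerm lam (Icc 0 2) (concatDensity X Y) (n + 1)‖ₑ ≤ K) ∧
      -- the logarithmic Baker–Campbell–Hausdorff formula
      (Summable fun n : ℕ => ‖bchTerm X Y (n + 1)‖) ∧
      Logable (NormedSpace.exp X * NormedSpace.exp Y) ∧
      HasSum (fun n : ℕ => bchTerm X Y (n + 1))
        (blog (NormedSpace.exp X * NormedSpace.exp Y))) := by
  obtain ⟨c, hc, hc1, hc2⟩ := exists_isLeast_h
  have hC : C₁ = ENNReal.ofReal c := hc.csInf_eq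
  refine ⟨⟨hC ▸ hc, ?_, ?_⟩, fun lam hlam => ⟨tsum_enorm_resolventTerm_le hlam X Y,
    Gam_le_frac hlam enorm_ne_top enorm_ne_top,
    frac_mono lam (rhoTilde_le_g hlam) (rhoTilde_le_g hlam)⟩,
    fun n => magnusTerm_eq_bchTerm X Y (n + 1), fun hXY => ?_⟩
  · rw [hC]; exact ENNReal.ofReal_le_ofReal hc1
  · rw [hC]; exact (ENNReal.ofReal_lt_ofReal_iff (by norm_num)).2 hc2
  have hx0 := norm_nonneg X
  have hy0 := norm_nonneg Y
  have hCh : ∀ lam ∈ Icc (0 : ℝ) 1, ENNReal.ofReal c ≤ h lam := fun lam hlam =>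
    hc.2 ⟨lam, hlam, rfl⟩
  have hxy : ‖X‖ + ‖Y‖ < c := by
    rw [hC, ← ofReal_norm, ← ofReal_norm, ← ENNReal.ofReal_add hx0 hy0] at hXY
    exact (ENNReal.ofReal_lt_ofReal_iff (by linarith)).1 hXY
  have hlt : ∀ r < c, ∀ lam ∈ Icc (0 : ℝ) 1, ENNReal.ofReal r < h lam := fun r hr lam hlam =>
    ((ENNReal.ofReal_lt_ofReal_iff (by linarith)).2 hr).trans_le (hCh lam hlam)
  have hX := hlt ‖X‖ (by linarith)
  have hY := hlt ‖Y‖ (by linarith)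
  -- With this δ the enlarged sum ‖X‖ + ‖Y‖ + 2δ is the midpoint between ‖X‖ + ‖Y‖ and c, still
  -- below every h.
  obtain ⟨K, hK⟩ := exists_uniform_bound hx0 hy0 (δ := (c - (‖X‖ + ‖Y‖)) / 4) (by linarith)
    (hlt _ (by linarith))
  have hfrac : ∀ lam ∈ Icc (0 : ℝ) 1, frac lam (g lam ‖X‖ₑ) (g lam ‖Y‖ₑ) ≤ K.toNNReal := by
    intro lam hlam
    rw [← ofReal_norm, ← ofReal_norm, frac_g_eq hlam hx0 hy0 (hX lam hlam) (hY lam hlam)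
      (hK lam hlam).1]
    exact ENNReal.ofReal_le_ofReal (hK lam hlam).2
  have hGam : ∀ lam ∈ Icc (0 : ℝ) 1, Gam lam ‖X‖ₑ ‖Y‖ₑ ≤ K.toNNReal := fun lam hlam =>
    (Gam_le_frac hlam enorm_ne_top enorm_ne_top).trans
      ((frac_mono lam (rhoTilde_le_g hlam) (rhoTilde_le_g hlam)).trans (hfrac lam hlam))
  refine ⟨fun lam hlam => ⟨?_, ?_, ?_, (hfrac lam hlam).trans_lt ENNReal.coe_lt_top⟩,
    ⟨K.toNNReal, fun lam hlam => (tsum_enorm_resolventTerm_le hlam X Y).trans (hGam lam hlam)⟩,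
    bch_of_bounded hGam⟩
  · rw [← ofReal_norm]; exact hX lam hlam
  · rw [← ofReal_norm]; exact hY lam hlam
  · have hb0 : 0 ≤ lam * (1 - lam) := mul_nonneg hlam.1 (by linarith [hlam.2])
    rw [← ofReal_norm, ← ofReal_norm, g_eq_gFun hlam hx0 (hX lam hlam),
      g_eq_gFun hlam hy0 (hY lam hlam), ← ENNReal.ofReal_mul (gFun_nonneg hlam hx0 (hX lam hlam)),
      ← ENNReal.ofReal_mul hb0, ENNReal.ofReal_lt_one]
    linarith [(hK lam hlam).1]
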